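/- Let $N$ be an odd positive integer and let $\alpha,\beta>0$ satisfy $\alpha\beta^{N}=\pi^{N+1}$. Let $\zeta$ be the Riemann zeta function and $B_k$ the Bernoulli numbers, $\frac{x}{e^x-1}=\sum_{k\ge 0}B_k\frac{x^k}{k!}$ for $|x|<2\pi$. Then for every non-zero integer $m$ all the infinite series below converge absolutely and $$\begin{aligned} &\alpha^{-\frac{2Nm}{N+1}}\left(\frac12\zeta(2Nm+1)+\sum_{n=1}^{\infty}\frac{n^{-2Nm-1}}{\exp\left((2n)^{N}\alpha\right)-1}\right)\\ &=\left(-\beta^{\frac{2N}{N+1}}\right)^{-m}\frac{2^{2m(N-1)}}{N}\left(\frac12\zeta(2m+1)+(-1)^{\frac{N+3}{2}}\sum_{j=-\frac{N-1}{2}}^{\frac{N-1}{2}}(-1)^{j}\sum_{n=1}^{\infty}\frac{n^{-2m-1}}{\exp\left((2n)^{\frac1N}\beta e^{\frac{i\pi j}{N}}\right)-1}\right)\\ &\quad+(-1)^{m+\frac{N+3}{2}}2^{2Nm}\sum_{j=0}^{\left\lfloor\frac{N+1}{2N}+m\right\rfloor}\frac{(-1)^jB_{2j}B_{N+1+2N(m-j)}}{(2j)!\,(N+1+2N(m-j))!}\,\alpha^{\frac{2j}{N+1}}\beta^{N+\frac{2N^2(m-j)}{N+1}},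 \end{aligned}$$ where a sum whose upper limit is smaller than its lower limit is $0$. In particular, for $N=1$ (so $\alpha\beta=\pi^2$) this is Ramanujan's formula $$\alpha^{-m}\left\{\frac12\zeta(2m+1)+\sum_{n=1}^{\infty}\frac{n^{-2m-1}}{e^{2\alpha n}-1}\right\}=(-\beta)^{-m}\left\{\frac12\zeta(2m+1)+\sum_{n=1}^{\infty}\frac{n^{-2m-1}}{e^{2\beta n}-1}\right\}-2^{2m}\sum_{j=0}^{m+1}\frac{(-1)^jB_{2j}B_{2m+2-2j}}{(2j)!\,(2m+2-2j)!}\,\alpha^{m+1-j}\beta^{j}.$$ -/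

import Mathlib

open scoped Nat

/-! Write N = 2h+1 and c = 2π/(2^N α). Then (2n)^N α = 2π n^N/c and (2n)^{1/N} β = 2π (cn)^{1/N}, so
both sides are Lambert series in `altBose`: with index 0 at d = n^N/c on the left, with index h at d
= (cn)^{1/N} on the right. The two are linked by the partial fraction expansion `hasSum_altBose`: up
to an extra term when h = 0, π(`altBose h d` + 1/2) is the sum over n of N d^N n^{2h}/(n^{2N} +
d^{2N}). With the two choices of d, both sides lead to the same kernel 1/(n^{2N} + c²k²).

For m = M > 0 both sides become absolutely convergent double series over this kernel, with
numerators n^{2h-2NM} and n^{2h} k^{-2M}. Put u = n^{2N} and v = -c²k². The relevant difference is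
n^{2h}(u^{-M} - v^{-M})/(u - v), a finite sum of products of a power of n and a power of k, so the
double sum collapses to products of even zeta values (`lambert_transformation_pos`).

For m = -M < 0 the double series no longer converge absolutely, and the kernel is regularised by the
theta series `psi`. Poisson summation makes `psi N p` vanish to infinite order at 0 for even p
(`exists_psi_le_pow`), and differentiation raises p by 2N (`hasDerivAt_psi`). Integrating by parts M
times moves the M derivatives from one factor of ∫ ψ_N(t) ψ_1(c²t) dt to the other
(`integral_psi_mul_psi_swap`). The Laplace transform of the undifferentiated factor is exactly a
multiple of `altBose` (`integral_exp_mul_psi_eq_altBose`). Writing the differentiated factor as a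
sum minus an integral therefore gives a Lambert series minus a Mellin integral, and by the
functional equation that integral is the zeta term of the opposite side
(`lambert_transformation_neg`).

Finally Euler's formula turns even zeta values into Bernoulli numbers. If A and B are the (N+1)-th
roots of α and β, then π = A B^N, so all remaining factors are signed monomials in 2, A, B and only
exponents have to be compared. -/

/-! ### Partial fractions for the alternating Bose sum -/

lemma exp_ne_one_of_re_pos {z : ℂ} (hz : 0 < z.re) : Complex.exp z ≠ 1 := by
  intro h
  have h1 : ‖Complex.exp z‖ = 1 := by rw [h]; simp
  rw [Complex.norm_exp] at h1
  have : 1 < Real.exp z.re := Real.one_lt_exp_iff.mpr hz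
  linarith

lemma sq_add_sq_ne_zero_of_re_pos {y : ℂ} (hy : 0 < y.re) (r : ℝ) :
    y ^ 2 + (r : ℂ) ^ 2 ≠ 0 := by
  intro h
  have h1 : (y + Complex.I * r) * (y - Complex.I * r) = 0 := by
    ring_nf; rw [Complex.I_sq]; linear_combination h
  rcases mul_eq_zero.mp h1 with h2 | h2
  · have := congrArg Complex.re h2
    simp at this; linarith
  · have := congrArg Complex.re h2
    simp at this; linarith

/-- This is the Mittag-Leffler expansion of π cot(πz) at z = iy, with the cotangent rewritten
through exp(2πy). -/
lemma hasSum_div_sq_add_sq {y : ℂ} (hy : 0 < y.re) :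
    HasSum (fun n : ℕ+ => y / (y ^ 2 + (n : ℂ) ^ 2))
      (Real.pi * (1 / (Complex.exp (2 * Real.pi * y) - 1) + 1 / 2 - 1 / (2 * Real.pi * y))) := by
  have hy0 : y ≠ 0 := by rintro rfl; simp at hy
  have hz : Complex.I * y ∈ Complex.integerComplement := by
    rintro ⟨k, hk⟩
    have := congrArg Complex.im hk
    simp at this
    linarith
  have hterm : ∀ n : ℕ, cotTerm (Complex.I * y) n =
      (-2 * Complex.I) * (y / (y ^ 2 + ((n + 1 : ℕ) : ℂ) ^ 2)) := by
    intro n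
    rw [cotTerm_identity hz n]
    have h1 := sq_add_sq_ne_zero_of_re_pos hy ((n + 1 : ℕ) : ℝ)
    rw [Complex.ofReal_natCast] at h1
    have h2 : (Complex.I * y + ((n : ℂ) + 1)) * (Complex.I * y - ((n : ℂ) + 1)) =
        -(y ^ 2 + ((n + 1 : ℕ) : ℂ) ^ 2) := by
      push_cast
      linear_combination y ^ 2 * Complex.I_sq
    rw [h2]
    field_simp
  have hs : HasSum (fun n : ℕ => cotTerm (Complex.I * y) n)
      (Real.pi * Complex.cot (Real.pi * (Complex.I * y)) - 1 / (Complex.I * y)) := by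
    rw [cot_series_rep' hz]
    exact (summable_cotTerm hz).hasSum
  have hs2 := hs.mul_left (Complex.I / 2)
  have e : (fun n : ℕ => Complex.I / 2 * cotTerm (Complex.I * y) n) =
      fun n : ℕ => (fun k : ℕ => y / (y ^ 2 + (k : ℂ) ^ 2)) (n + 1) := by
    funext n
    rw [hterm]
    simp only
    linear_combination -(y / (y ^ 2 + ((n + 1 : ℕ) : ℂ) ^ 2)) * Complex.I_sq
  rw [e] at hs2
  have hs3 := (hasSum_pnat_iff_hasSum_succ (f := fun k : ℕ => y / (y ^ 2 + (k : ℂ) ^ 2))).mpr hs2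
  convert hs3 using 1
  rw [Complex.cot_pi_eq_exp_ratio]
  have h3 : 2 * (Real.pi : ℂ) * Complex.I * (Complex.I * y) = -(2 * Real.pi * y) := by
    linear_combination 2 * Real.pi * y * Complex.I_sq
  rw [h3, Complex.exp_neg]
  have h4 : Complex.exp (2 * Real.pi * y) - 1 ≠ 0 := by
    apply sub_ne_zero.mpr
    apply exp_ne_one_of_re_pos
    have : (2 * (Real.pi : ℂ) * y).re = 2 * Real.pi * y.re := by simp
    rw [this]; have := Real.pi_pos; positivity
  have h5 := Complex.exp_ne_zero (2 * Real.pi * y)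
  set E := Complex.exp (2 * Real.pi * y)
  have h6 : (Real.pi : ℂ) ≠ 0 := by exact_mod_cast Real.pi_ne_zero
  have h7 : 1 - E⁻¹ ≠ 0 := by
    intro h; apply h4; field_simp at h; linear_combination h
  have hI := Complex.I_ne_zero
  field_simp
  ring

lemma sum_Icc_neg_zpow (h : ℕ) {z : ℂ} (hz : z ≠ 0) :
    ∑ j ∈ Finset.Icc (-(h : ℤ)) h, z ^ j = z ^ (-(h : ℤ)) * ∑ i ∈ Finset.range (2 * h + 1), z ^ i := by
  rw [Finset.mul_sum]
  symm
  apply Finset.sum_bij (fun (i : ℕ) _ => (i : ℤ) - h)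
  · intro i hi
    simp only [Finset.mem_range] at hi
    simp only [Finset.mem_Icc]
    omega
  · intro a _ b _ hab
    omega
  · intro b hb
    simp only [Finset.mem_Icc] at hb
    refine ⟨(b + h).toNat, ?_, ?_⟩
    · simp only [Finset.mem_range]; omega
    · omega
  · intro i _
    rw [← zpow_natCast z i, ← zpow_add₀ hz]
    congr 1
    ring

lemma sum_Icc_neg_one_zpow (h : ℕ) :
    ∑ j ∈ Finset.Icc (-(h : ℤ)) h, (-1 : ℂ) ^ j = (-1) ^ h := by
  rw [sum_Icc_neg_zpow h (by norm_num), neg_one_geom_sum]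
  have : ¬ Even (2 * h + 1) := by simp
  rw [if_neg this, mul_one, zpow_neg, zpow_natCast]
  rcases Nat.even_or_odd h with h1 | h1 <;> simp [h1]

/-- Orthogonality of characters of ℤ/N, over the symmetric set of representatives |j| ≤ h. -/
lemma sum_Icc_rootOfUnity (h q : ℕ) {ω : ℂ} (hω : IsPrimitiveRoot ω (2 * h + 1)) :
    ∑ j ∈ Finset.Icc (-(h : ℤ)) h, (ω ^ j) ^ q = if 2 * h + 1 ∣ q then (2 * h + 1 : ℂ) else 0 := by
  have hω0 : ω ≠ 0 := hω.ne_zero (by omega)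
  have e : ∀ j : ℤ, (ω ^ j) ^ q = (ω ^ q) ^ j := by
    intro j
    rw [← zpow_natCast, ← zpow_natCast, ← zpow_mul, ← zpow_mul, mul_comm]
  simp_rw [e]
  rw [sum_Icc_neg_zpow h (pow_ne_zero _ hω0)]
  split_ifs with hd
  · rw [(hω.pow_eq_one_iff_dvd q).mpr hd]
    simp
  · have h1 : ω ^ q ≠ 1 := fun h1 => hd ((hω.pow_eq_one_iff_dvd q).mp h1)
    rw [geom_sum_eq h1, ← pow_mul, mul_comm q, pow_mul, hω.pow_eq_one]
    simp

/-- The point `exp (iπj/(2h+1))` on the unit circle. -/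
noncomputable def oddUnit (h : ℕ) (j : ℤ) : ℂ :=
  Complex.exp (Complex.I * Real.pi * j / (2 * h + 1 : ℕ))

lemma oddUnit_re_pos {h : ℕ} {j : ℤ} (hj : j ∈ Finset.Icc (-(h : ℤ)) h) :
    0 < (oddUnit h j).re := by
  simp only [Finset.mem_Icc] at hj
  have e : Complex.I * Real.pi * j / (2 * h + 1 : ℕ) =
      ((Real.pi * j / (2 * h + 1 : ℕ) : ℝ) : ℂ) * Complex.I := by
    push_cast; ring
  rw [oddUnit, e, Complex.exp_ofReal_mul_I_re]
  have hp := Real.pi_pos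
  have hN : (0 : ℝ) < (2 * h + 1 : ℕ) := by positivity
  have h1 : (-(h : ℝ)) ≤ j := by exact_mod_cast hj.1
  have h2 : (j : ℝ) ≤ h := by exact_mod_cast hj.2
  apply Real.cos_pos_of_mem_Ioo
  constructor
  · rw [lt_div_iff₀ hN]; push_cast; nlinarith
  · rw [div_lt_iff₀ hN]; push_cast; nlinarith

lemma oddUnit_pow (h : ℕ) (j : ℤ) : oddUnit h j ^ (2 * h + 1) = (-1) ^ j := by
  rw [oddUnit, ← Complex.exp_nat_mul]
  have e : ((2 * h + 1 : ℕ) : ℂ) * (Complex.I * Real.pi * j / (2 * h + 1 : ℕ)) =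
      j * (Real.pi * Complex.I) := by
    have : ((2 * h + 1 : ℕ) : ℂ) ≠ 0 := by exact_mod_cast (by omega : 2 * h + 1 ≠ 0)
    field_simp
  rw [e, Complex.exp_int_mul, Complex.exp_pi_mul_I]

lemma oddUnit_sq_eq (h : ℕ) (j : ℤ) :
    oddUnit h j ^ 2 = Complex.exp (2 * Real.pi * Complex.I / (2 * h + 1 : ℕ)) ^ j := by
  rw [oddUnit, ← Complex.exp_nat_mul, ← Complex.exp_int_mul]
  congr 1
  push_cast
  ring

lemma neg_one_zpow_mul_self (j : ℤ) : ((-1 : ℂ) ^ j) * (-1) ^ j = 1 := by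
  rw [← mul_zpow]; norm_num

/-- Write w for `oddUnit h j`. Since w^{2N} = 1 and N is odd, x^{2N} + d^{2N} = (x²)^N - (-d²w²)^N
is divisible by x² + d²w² for every j. Expanding each quotient as a geometric sum and summing over j
leaves one power by orthogonality. -/
lemma sum_div_oddUnit_sq_add_sq (h : ℕ) {d : ℝ} (hd : 0 < d) (x : ℝ) :
    ∑ j ∈ Finset.Icc (-(h : ℤ)) h, (-1 : ℂ) ^ j *
        ((d * oddUnit h j) / ((d * oddUnit h j) ^ 2 + (x : ℂ) ^ 2)) =
      (-1) ^ h * ((2 * h + 1 : ℕ) * (d : ℂ) ^ (2 * h + 1) * (x : ℂ) ^ (2 * h) /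
        ((x : ℂ) ^ (2 * (2 * h + 1)) + (d : ℂ) ^ (2 * (2 * h + 1)))) := by
  set N := 2 * h + 1 with hN
  set ω := Complex.exp (2 * Real.pi * Complex.I / N)
  have hω : IsPrimitiveRoot ω N := Complex.isPrimitiveRoot_exp N (by omega)
  set D : ℂ := (x : ℂ) ^ (2 * N) + (d : ℂ) ^ (2 * N) with hD
  have hD0 : D ≠ 0 := by
    have : D = ((x ^ (2 * N) + d ^ (2 * N) : ℝ) : ℂ) := by push_cast; rfl
    rw [this]
    have h1 : 0 ≤ x ^ (2 * N) := by rw [pow_mul]; positivity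
    have h2 : 0 < d ^ (2 * N) := by positivity
    exact_mod_cast (by linarith : 0 < x ^ (2 * N) + d ^ (2 * N)).ne'
  have key : ∀ j ∈ Finset.Icc (-(h : ℤ)) h, (-1 : ℂ) ^ j *
        ((d * oddUnit h j) / ((d * oddUnit h j) ^ 2 + (x : ℂ) ^ 2)) =
      ∑ i ∈ Finset.range N, ((x : ℂ) ^ 2) ^ i * (-(d : ℂ) ^ 2) ^ (N - 1 - i) * d / D *
        (ω ^ j) ^ (h + 1 + (N - 1 - i)) := by
    intro j hj
    have hw : oddUnit h j ^ 2 = ω ^ j := oddUnit_sq_eq h j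
    have hwN : (oddUnit h j ^ 2) ^ N = 1 := by
      rw [← pow_mul, mul_comm, pow_mul, oddUnit_pow, sq, neg_one_zpow_mul_self]
    -- The sign (-1)^j is w^N, so (-1)^j w = w^{N+1} is a power of w² = ω^j; this is why the
    -- alternating sum is the one that filters.
    have he : (-1 : ℂ) ^ j * oddUnit h j = (ω ^ j) ^ (h + 1) := by
      rw [← oddUnit_pow h, ← hw, ← pow_mul, ← pow_succ]
      congr 1
    have hgeom := geom_sum₂_mul ((x : ℂ) ^ 2) (-(d : ℂ) ^ 2 * oddUnit h j ^ 2) N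
    have hre : 0 < ((d : ℂ) * oddUnit h j).re := by
      rw [Complex.re_ofReal_mul]
      exact mul_pos hd (oddUnit_re_pos hj)
    have hne := sq_add_sq_ne_zero_of_re_pos hre x
    have hDeq : ((x : ℂ) ^ 2) ^ N - (-(d : ℂ) ^ 2 * oddUnit h j ^ 2) ^ N = D := by
      rw [mul_pow, hwN, Odd.neg_pow (by rw [hN]; simp), hD, pow_mul, pow_mul]
      ring
    rw [hDeq] at hgeom
    have h1 : (d * oddUnit h j) / ((d * oddUnit h j) ^ 2 + (x : ℂ) ^ 2) =
        (∑ i ∈ Finset.range N, ((x : ℂ) ^ 2) ^ i *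
          (-(d : ℂ) ^ 2 * oddUnit h j ^ 2) ^ (N - 1 - i)) * (d * oddUnit h j) / D := by
      rw [div_eq_div_iff hne hD0, ← hgeom]
      ring
    rw [h1, Finset.sum_mul, Finset.sum_div, Finset.mul_sum]
    apply Finset.sum_congr rfl
    intro i _
    rw [mul_pow, pow_add (ω ^ j), ← he, hw]
    ring
  rw [Finset.sum_congr rfl key, Finset.sum_comm]
  simp_rw [← Finset.mul_sum, sum_Icc_rootOfUnity h _ hω]
  -- The exponent h+1+(N-1-i) runs from h+1 to 3h+1 < 2N, so N divides it only when it equals N,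
  -- that is for i = h.
  rw [Finset.sum_eq_single h]
  · have e1 : N - 1 - h = h := by omega
    have e2 : N ∣ h + 1 + (N - 1 - h) := ⟨1, by omega⟩
    rw [if_pos e2, e1, ← pow_mul, neg_pow, ← pow_mul]
    push_cast [hN]
    ring
  · intro i hi hih
    simp only [Finset.mem_range] at hi
    rw [if_neg, mul_zero]
    rintro ⟨k, hk⟩
    have hk1 : k < 2 := by
      by_contra hk2
      have : N * 2 ≤ N * k := Nat.mul_le_mul_left _ (by omega)
      rw [← hN] at hk
      omega
    interval_cases k <;> omega
  · intro hh
    simp at hh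
    omega

/-- The alternating sum `(-1)^h ∑_{|j| ≤ h} (-1)^j / (exp (2πd e^{iπj/(2h+1)}) - 1)`. -/
noncomputable def altBose (h : ℕ) (d : ℝ) : ℂ :=
  (-1) ^ h * ∑ j ∈ Finset.Icc (-(h : ℤ)) h, (-1 : ℂ) ^ j *
    (1 / (Complex.exp (2 * Real.pi * (d * oddUnit h j)) - 1))

lemma neg_one_pow_mul_self' (h : ℕ) : ((-1 : ℂ) ^ h) * (-1) ^ h = 1 := by
  rw [← mul_pow]; norm_num

/-- Apply the cotangent expansion at y = d · `oddUnit h j` and sum over j with signs. The factor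
0^(2h) is 1 for h = 0 and 0 otherwise, so the polar correction is present only for N = 1. -/
lemma hasSum_altBose (h : ℕ) {d : ℝ} (hd : 0 < d) :
    HasSum (fun n : ℕ+ => ((2 * h + 1 : ℕ) * (d : ℂ) ^ (2 * h + 1) * (n : ℂ) ^ (2 * h) /
        ((n : ℂ) ^ (2 * (2 * h + 1)) + (d : ℂ) ^ (2 * (2 * h + 1)))))
      (Real.pi * (altBose h d + 1 / 2) -
        1 / 2 * ((2 * h + 1 : ℕ) * 0 ^ (2 * h) / (d : ℂ) ^ (2 * h + 1))) := by
  have hre : ∀ j ∈ Finset.Icc (-(h : ℤ)) h, 0 < ((d : ℂ) * oddUnit h j).re := by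
    intro j hj
    rw [Complex.re_ofReal_mul]
    exact mul_pos hd (oddUnit_re_pos hj)
  have hs := (hasSum_sum (fun j hj =>
    (hasSum_div_sq_add_sq (hre j hj)).mul_left ((-1 : ℂ) ^ j))).mul_left ((-1 : ℂ) ^ h)
  have hd0 : (d : ℂ) ≠ 0 := by exact_mod_cast hd.ne'
  have hpi : (Real.pi : ℂ) ≠ 0 := by exact_mod_cast Real.pi_ne_zero
  have hval : (Real.pi * (altBose h d + 1 / 2) -
        1 / 2 * ((2 * h + 1 : ℕ) * 0 ^ (2 * h) / (d : ℂ) ^ (2 * h + 1)) : ℂ) =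
      (-1) ^ h * ∑ j ∈ Finset.Icc (-(h : ℤ)) h, (-1 : ℂ) ^ j * (Real.pi *
        (1 / (Complex.exp (2 * Real.pi * (d * oddUnit h j)) - 1) + 1 / 2 -
          1 / (2 * Real.pi * (d * oddUnit h j)))) := by
    -- The terms 1/(2πy) are, up to a constant, the summands y/(y² + x²) at x = 0, so the same
    -- finite identity evaluates their sum.
    have h0 := sum_div_oddUnit_sq_add_sq h hd 0
    have e : ∀ j : ℤ, (-1 : ℂ) ^ j * (Real.pi * (1 / (Complex.exp (2 * Real.pi * (d * oddUnit h j)) - 1)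
        + 1 / 2 - 1 / (2 * Real.pi * (d * oddUnit h j)))) =
        Real.pi * ((-1 : ℂ) ^ j * (1 / (Complex.exp (2 * Real.pi * (d * oddUnit h j)) - 1))) +
        Real.pi / 2 * (-1 : ℂ) ^ j - 1 / 2 * ((-1 : ℂ) ^ j * ((d * oddUnit h j) /
          ((d * oddUnit h j) ^ 2 + ((0 : ℝ) : ℂ) ^ 2))) := by
      intro j
      have : oddUnit h j ≠ 0 := Complex.exp_ne_zero _
      generalize 1 / (Complex.exp (2 * Real.pi * (d * oddUnit h j)) - 1) = z
      push_cast
      field_simp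
      ring
    rw [Finset.sum_congr rfl (fun j _ => e j)]
    rw [Finset.sum_sub_distrib, Finset.sum_add_distrib, ← Finset.mul_sum, ← Finset.mul_sum,
      ← Finset.mul_sum, h0, sum_Icc_neg_one_zpow, altBose]
    have hh := neg_one_pow_mul_self' h
    have e2 : ((0 : ℝ) : ℂ) ^ (2 * (2 * h + 1)) = 0 := by simp
    rw [e2, zero_add]
    have e3 : (d : ℂ) ^ (2 * (2 * h + 1)) = (d : ℂ) ^ (2 * h + 1) * (d : ℂ) ^ (2 * h + 1) := by
      rw [two_mul, pow_add]
    have e4 : ((2 * h + 1 : ℕ) * (d : ℂ) ^ (2 * h + 1) * ((0 : ℝ) : ℂ) ^ (2 * h) /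
        (d : ℂ) ^ (2 * (2 * h + 1))) = (2 * h + 1 : ℕ) * 0 ^ (2 * h) / (d : ℂ) ^ (2 * h + 1) := by
      rw [e3]
      have := pow_ne_zero (2 * h + 1) hd0
      rw [Complex.ofReal_zero]
      field_simp
    rw [e4]
    linear_combination (-(Real.pi : ℂ) / 2 + 1 / 2 * ((2 * h + 1 : ℕ) * 0 ^ (2 * h) / (d : ℂ) ^ (2 * h + 1))) * hh
  rw [hval]
  have hterm : ∀ n : ℕ+, ((2 * h + 1 : ℕ) * (d : ℂ) ^ (2 * h + 1) * (n : ℂ) ^ (2 * h) /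
        ((n : ℂ) ^ (2 * (2 * h + 1)) + (d : ℂ) ^ (2 * (2 * h + 1)))) =
      (-1) ^ h * ∑ j ∈ Finset.Icc (-(h : ℤ)) h, (-1 : ℂ) ^ j *
        ((d * oddUnit h j) / ((d * oddUnit h j) ^ 2 + (n : ℂ) ^ 2)) := by
    intro n
    have := sum_div_oddUnit_sq_add_sq h hd (n : ℕ)
    rw [Complex.ofReal_natCast] at this
    rw [this, ← mul_assoc, neg_one_pow_mul_self', one_mul]
  simp_rw [hterm]
  exact hs

/-! ### Poisson summation and Schwartz functions -/

section

open scoped FourierTransform SchwartzMap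

lemma fourier_comp_mul_left (f : ℝ → ℂ) {ε : ℝ} (hε : 0 < ε) (ξ : ℝ) :
    𝓕 (fun y => f (ε * y)) ξ = (ε⁻¹ : ℝ) • 𝓕 f (ξ / ε) := by
  rw [Real.fourier_real_eq_integral_exp_smul, Real.fourier_real_eq_integral_exp_smul]
  have := MeasureTheory.Measure.integral_comp_mul_left
    (fun y : ℝ => Complex.exp (↑(-2 * Real.pi * y * (ξ / ε)) * Complex.I) • f y) ε
  rw [abs_of_pos (inv_pos.mpr hε)] at this
  rw [← this]
  congr 1
  funext y
  congr 4
  field_simp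

/-- By Poisson summation the Riemann sum equals the sum of 𝓕 f(n/ε). The term n = 0 is the integral,
and the rapid decay of 𝓕 f makes the remaining terms O(ε^{K+2}). The exponent K+2 also makes the sum
over n converge. -/
lemma SchwartzMap.exists_riemannSum_sub_integral_le (f : 𝓢(ℝ, ℂ)) (K : ℕ) :
    ∃ C : ℝ, 0 ≤ C ∧ ∀ ε : ℝ, 0 < ε →
      ‖(ε : ℂ) * ∑' n : ℤ, f (ε * n) - ∫ y, f y‖ ≤ C * ε ^ (K + 2) := by
  obtain ⟨B, hB0, hB⟩ := (𝓕 f).decay (K + 2) 0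
  have hsum : Summable fun n : ℤ => 1 / |(n : ℝ)| ^ (K + 2) := by
    have := (Real.summable_one_div_int_pow (p := K + 2)).mpr (by omega)
    refine this.abs.congr fun n => ?_
    rw [abs_div, abs_pow, abs_one]
  refine ⟨B * ∑' n : ℤ, 1 / |(n : ℝ)| ^ (K + 2), by positivity, fun ε hε => ?_⟩
  have hbound : ∀ n : ℤ, n ≠ 0 → ‖𝓕 f (n / ε)‖ ≤ B * ε ^ (K + 2) * (1 / |(n : ℝ)| ^ (K + 2)) := by
    intro n hn
    have h1 := hB (n / ε)
    rw [norm_iteratedFDeriv_zero, Real.norm_eq_abs, abs_div, abs_of_pos hε, div_pow] at h1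
    have hn' : 0 < |(n : ℝ)| ^ (K + 2) := by positivity
    rw [mul_one_div, le_div_iff₀ hn']
    rw [div_mul_eq_mul_div, div_le_iff₀ (by positivity)] at h1
    linarith
  have hcoe : ∀ x : ℝ, 𝓕 (fun y => f (ε * y)) x = (ε⁻¹ : ℝ) • 𝓕 f (x / ε) :=
    fun x => fourier_comp_mul_left f hε x
  have hsF : Summable fun n : ℤ => 𝓕 f (n / ε) := by
    refine Summable.of_norm_bounded_eventually (hsum.mul_left (B * ε ^ (K + 2))) ?_
    have : {0}ᶜ ∈ (Filter.cofinite : Filter ℤ) := (Set.finite_singleton 0).compl_mem_cofinite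
    filter_upwards [this] with n hn
    exact hbound n hn
  have hP : ∑' n : ℤ, f (ε * n) = (ε⁻¹ : ℝ) • ∑' n : ℤ, 𝓕 f (n / ε) := by
    have hdec : (fun y => f (ε * y)) =O[Filter.cocompact ℝ] fun x : ℝ => |x| ^ (-(2 : ℝ)) := by
      have h1 := f.isBigO_cocompact_rpow (-2)
      have h2 : Filter.Tendsto (fun y : ℝ => ε * y) (Filter.cocompact ℝ) (Filter.cocompact ℝ) :=
        (Homeomorph.mulLeft₀ ε hε.ne').isClosedEmbedding.tendsto_cocompact
      have h3 := h1.comp_tendsto h2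
      refine h3.trans ?_
      refine Asymptotics.IsBigO.of_bound (ε ^ (-(2 : ℝ))) (Filter.Eventually.of_forall fun x => ?_)
      simp only [Function.comp, Real.norm_eq_abs, abs_mul]
      rw [abs_of_pos hε, Real.mul_rpow hε.le (abs_nonneg x), abs_mul,
        abs_of_pos (Real.rpow_pos_of_pos hε _)]
    have := Real.tsum_eq_tsum_fourier_of_rpow_decay_of_summable (f := fun y => f (ε * y))
      (f.continuous.comp (continuous_const_mul ε)) one_lt_two hdec
      (by simp_rw [hcoe]; exact hsF.const_smul _) 0
    simp only [zero_add] at this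
    rw [this]
    simp_rw [hcoe]
    rw [← hsF.tsum_const_smul]
    simp
  have h0 : 𝓕 f ((0 : ℤ) / ε : ℝ) = ∫ y, f y := by
    rw [SchwartzMap.fourier_coe, Real.fourier_real_eq_integral_exp_smul]
    simp
  rw [hP, hsF.tsum_eq_add_tsum_ite 0, h0, Complex.real_smul, ← mul_assoc]
  have e : (ε : ℂ) * ((ε⁻¹ : ℝ) : ℂ) = 1 := by
    rw [← Complex.ofReal_mul, mul_inv_cancel₀ hε.ne', Complex.ofReal_one]
  rw [e, one_mul, add_sub_cancel_left, mul_right_comm, ← tsum_mul_left]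
  refine tsum_of_norm_bounded (hsum.mul_left _).hasSum fun n => ?_
  split_ifs with hn
  · simp only [norm_zero]; positivity
  · exact hbound n hn

lemma abs_pow_mul_exp_neg_pow_le {N : ℕ} (hN : 0 < N) (k : ℕ) (y : ℝ) :
    |y| ^ k * Real.exp (-y ^ (2 * N)) ≤ k ! := by
  have hf : (1 : ℝ) ≤ k ! := by exact_mod_cast Nat.factorial_pos k
  have hy : y ^ (2 * N) = |y| ^ (2 * N) := by rw [pow_mul, pow_mul, sq_abs]
  rw [hy]
  rcases le_total |y| 1 with h | h
  · have h1 : |y| ^ k ≤ 1 := pow_le_one₀ (abs_nonneg _) h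
    have h2 : Real.exp (-|y| ^ (2 * N)) ≤ 1 := Real.exp_le_one_iff.mpr (by
      have : 0 ≤ |y| ^ (2 * N) := by positivity
      linarith)
    calc _ ≤ 1 * 1 := mul_le_mul h1 h2 (Real.exp_pos _).le zero_le_one
      _ ≤ _ := by linarith
  · have h1 : |y| ≤ |y| ^ (2 * N) := le_self_pow₀ h (by omega)
    have h2 : Real.exp (-|y| ^ (2 * N)) ≤ Real.exp (-|y|) := Real.exp_le_exp.mpr (by linarith)
    have h3 := Real.pow_div_factorial_le_exp |y| (abs_nonneg _) k
    rw [div_le_iff₀ (by positivity)] at h3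
    calc _ ≤ |y| ^ k * Real.exp (-|y|) := by gcongr
      _ ≤ (Real.exp |y| * k !) * Real.exp (-|y|) := by gcongr
      _ = k ! := by rw [mul_right_comm, ← Real.exp_add]; simp

/-- Functions of the form polynomial times exp(-y^{2N}) are stable under differentiation, so the
Schwartz seminorms reduce to decay of functions of this one shape. -/
lemma exists_iteratedDeriv_polynomial_mul_exp (N : ℕ) (P : Polynomial ℂ) (n : ℕ) :
    ∃ Q : Polynomial ℂ, iteratedDeriv n (fun y : ℝ => P.eval (y : ℂ) * Complex.exp (-(y : ℂ) ^ (2 * N))) =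
      fun y : ℝ => Q.eval (y : ℂ) * Complex.exp (-(y : ℂ) ^ (2 * N)) := by
  induction n with
  | zero => exact ⟨P, by simp⟩
  | succ n ih =>
    obtain ⟨Q, hQ⟩ := ih
    refine ⟨Q.derivative - Polynomial.C ((2 * N : ℕ) : ℂ) * Polynomial.X ^ (2 * N - 1) * Q, ?_⟩
    rw [iteratedDeriv_succ, hQ]
    funext y
    have h1 : HasDerivAt (fun z : ℂ => Q.eval z * Complex.exp (-z ^ (2 * N)))
        (Q.derivative.eval (y : ℂ) * Complex.exp (-(y : ℂ) ^ (2 * N)) + Q.eval (y : ℂ) *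
          (Complex.exp (-(y : ℂ) ^ (2 * N)) * (-(((2 * N : ℕ) : ℂ) * (y : ℂ) ^ (2 * N - 1))))) y :=
      (Q.hasDerivAt _).mul ((hasDerivAt_pow (2 * N) (y : ℂ)).fun_neg.cexp)
    rw [h1.comp_ofReal.deriv]
    simp only [Polynomial.eval_sub, Polynomial.eval_mul, Polynomial.eval_C, Polynomial.eval_pow,
      Polynomial.eval_X]
    ring

lemma exists_bound_polynomial_mul_exp {N : ℕ} (hN : 0 < N) (Q : Polynomial ℂ) (k : ℕ) :
    ∃ C : ℝ, ∀ y : ℝ, ‖y‖ ^ k * ‖Q.eval (y : ℂ) * Complex.exp (-(y : ℂ) ^ (2 * N))‖ ≤ C := by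
  refine ⟨∑ i ∈ Finset.range (Q.natDegree + 1), ‖Q.coeff i‖ * (k + i)!, fun y => ?_⟩
  have h1 : ‖Complex.exp (-(y : ℂ) ^ (2 * N))‖ = Real.exp (-y ^ (2 * N)) := by
    rw [Complex.norm_exp]
    congr 1
    norm_cast
  rw [norm_mul, h1, Polynomial.eval_eq_sum_range]
  calc _ ≤ ‖y‖ ^ k * ((∑ i ∈ Finset.range (Q.natDegree + 1), ‖Q.coeff i * (y : ℂ) ^ i‖) *
        Real.exp (-y ^ (2 * N))) := by
        gcongr
        exact norm_sum_le _ _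
    _ = ∑ i ∈ Finset.range (Q.natDegree + 1), ‖Q.coeff i‖ * (|y| ^ (k + i) *
        Real.exp (-y ^ (2 * N))) := by
        rw [Finset.sum_mul, Finset.mul_sum]
        refine Finset.sum_congr rfl fun i _ => ?_
        rw [norm_mul, norm_pow, Complex.norm_real, Real.norm_eq_abs, pow_add]
        ring
    _ ≤ _ := by
        gcongr with i _
        exact abs_pow_mul_exp_neg_pow_le hN _ _

/-- The function `y ↦ y ^ p * exp (-y ^ (2N))` as a Schwartz function. -/
noncomputable def powMulExpSchwartz {N : ℕ} (hN : 0 < N) (p : ℕ) : 𝓢(ℝ, ℂ) where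
  toFun y := (y : ℂ) ^ p * Complex.exp (-(y : ℂ) ^ (2 * N))
  smooth' := by
    have : ContDiff ℝ (⊤ : ℕ∞) (fun y : ℝ => (y : ℂ)) := Complex.ofRealCLM.contDiff
    fun_prop
  decay' k n := by
    obtain ⟨Q, hQ⟩ := exists_iteratedDeriv_polynomial_mul_exp N (Polynomial.X ^ p) n
    obtain ⟨C, hC⟩ := exists_bound_polynomial_mul_exp hN Q k
    refine ⟨C, fun y => ?_⟩
    rw [norm_iteratedFDeriv_eq_norm_iteratedDeriv]
    simp only [Polynomial.eval_pow, Polynomial.eval_X] at hQ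
    rw [hQ]
    exact hC y

lemma powMulExpSchwartz_apply {N : ℕ} (hN : 0 < N) (p : ℕ) (y : ℝ) :
    powMulExpSchwartz hN p y = ((y ^ p * Real.exp (-y ^ (2 * N)) : ℝ) : ℂ) := by
  change (y : ℂ) ^ p * Complex.exp (-(y : ℂ) ^ (2 * N)) = _
  push_cast
  rfl

end

/-! ### The regularised theta series -/

section

open MeasureTheory

lemma summable_pow_mul_exp_neg_mul_pow {N : ℕ} (hN : 0 < N) (p : ℕ) {t : ℝ} (ht : 0 < t) :
    Summable fun n : ℕ+ => (n : ℝ) ^ p * Real.exp (-t * (n : ℝ) ^ (2 * N)) := by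
  have h1 := (Real.summable_pow_mul_exp_neg_nat_mul p ht).comp_injective PNat.coe_injective
  refine Summable.of_nonneg_of_le (fun n => by positivity) (fun n => ?_) h1
  simp only [Function.comp]
  have hn : (1 : ℝ) ≤ n := by exact_mod_cast n.2
  have h2 : (n : ℝ) ≤ (n : ℝ) ^ (2 * N) := le_self_pow₀ hn (by omega)
  gcongr ?_ * Real.exp ?_
  nlinarith

/-- The integral `∫₀^∞ y ^ p exp (-y ^ (2N)) dy`. -/
noncomputable def powExpIntegral (N p : ℕ) : ℝ := 1 / (2 * N) * Real.Gamma ((p + 1) / (2 * N))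

/-- The theta series `∑_{n ≥ 1} n ^ p exp (-t n ^ (2N))`, with half of the term `n = 0` added and
its leading singularity at `t = 0` removed. -/
noncomputable def psi (N p : ℕ) (t : ℝ) : ℝ :=
  0 ^ p / 2 + ∑' n : ℕ+, (n : ℝ) ^ p * Real.exp (-t * (n : ℝ) ^ (2 * N)) -
    powExpIntegral N p * t ^ (-((p + 1) / (2 * N) : ℝ))

lemma powExpIntegral_nonneg (N p : ℕ) : 0 ≤ powExpIntegral N p := by
  unfold powExpIntegral
  have := Real.Gamma_nonneg_of_nonneg (s := (p + 1) / (2 * N)) (by positivity)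
  positivity

lemma integral_pow_mul_exp_neg_mul_pow {N : ℕ} (hN : 0 < N) (p : ℕ) {t : ℝ} (ht : 0 < t) :
    ∫ y in Set.Ioi (0 : ℝ), y ^ p * Real.exp (-t * y ^ (2 * N)) =
      powExpIntegral N p * t ^ (-((p + 1) / (2 * N) : ℝ)) := by
  have h := integral_rpow_mul_exp_neg_mul_rpow (p := (2 * N : ℕ)) (q := p) (b := t)
    (by positivity) (by have : (0 : ℝ) ≤ p := by positivity
                        linarith) ht
  simp only [Real.rpow_natCast] at h
  rw [h, powExpIntegral]
  push_cast
  rw [neg_div]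
  ring

lemma integral_even_pow_mul_exp_neg_pow {N : ℕ} (hN : 0 < N) {p : ℕ} (hp : Even p) :
    ∫ y : ℝ, y ^ p * Real.exp (-y ^ (2 * N)) = 2 * powExpIntegral N p := by
  have h := integral_comp_abs (f := fun y : ℝ => y ^ p * Real.exp (-y ^ (2 * N)))
  have h2 := integral_pow_mul_exp_neg_mul_pow hN p zero_lt_one
  simp only [neg_mul, one_mul, Real.one_rpow, mul_one] at h2
  rw [h2] at h
  rw [← h]
  congr 1
  funext y
  rw [hp.pow_abs, (even_two_mul N).pow_abs]

/-- With ε = t^{1/(2N)} and f(y) = y^p exp(-y^{2N}), the quantity 2 ε^{p+1} ψ(t) is the Riemann sum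
of f over εℤ minus its integral. Evenness of p folds ℤ onto the positive integers. -/
lemma exists_psi_le_pow {N : ℕ} (hN : 0 < N) {p : ℕ} (hp : Even p) (K : ℕ) :
    ∃ C : ℝ, 0 ≤ C ∧ ∀ t : ℝ, 0 < t → t ≤ 1 → |psi N p t| ≤ C * t ^ K := by
  -- The order p + 2NK is what is needed: ε^{p+2NK+2} = ε^{p+1} · t^K · ε, which absorbs the
  -- normalisation ε^{p+1}.
  obtain ⟨C, hC0, hC⟩ := (powMulExpSchwartz hN p).exists_riemannSum_sub_integral_le (p + 2 * N * K)
  refine ⟨C, hC0, fun t ht ht1 => ?_⟩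
  have hN' : (2 * N : ℝ) ≠ 0 := by positivity
  set ε : ℝ := t ^ (1 / (2 * N) : ℝ) with hε
  have hε0 : 0 < ε := Real.rpow_pos_of_pos ht _
  have hε1 : ε ≤ 1 := Real.rpow_le_one ht.le ht1 (by positivity)
  have hεN : ε ^ (2 * N) = t := by
    rw [hε, ← Real.rpow_natCast, ← Real.rpow_mul ht.le]
    push_cast
    rw [one_div, inv_mul_cancel₀ hN', Real.rpow_one]
  have hεp : t ^ (-((p + 1) / (2 * N) : ℝ)) * ε ^ (p + 1) = 1 := by
    rw [hε, ← Real.rpow_natCast, ← Real.rpow_mul ht.le, ← Real.rpow_add ht]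
    push_cast
    rw [show (-((p + 1) / (2 * N) : ℝ) + 1 / (2 * N) * (p + 1)) = 0 by ring, Real.rpow_zero]
  have h := hC ε hε0
  simp_rw [powMulExpSchwartz_apply] at h
  rw [integral_complex_ofReal, integral_even_pow_mul_exp_neg_pow hN hp, ← Complex.ofReal_tsum,
    ← Complex.ofReal_mul, ← Complex.ofReal_sub, Complex.norm_real, Real.norm_eq_abs] at h
  have hterm : ∀ n : ℕ+, (ε * ((n : ℤ) : ℝ)) ^ p * Real.exp (-(ε * ((n : ℤ) : ℝ)) ^ (2 * N)) =
      ε ^ p * ((n : ℝ) ^ p * Real.exp (-t * (n : ℝ) ^ (2 * N))) := by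
    intro n
    rw [mul_pow, mul_pow, hεN]
    push_cast
    ring_nf
  have hsum : Summable fun n : ℤ => (ε * (n : ℝ)) ^ p * Real.exp (-(ε * (n : ℝ)) ^ (2 * N)) := by
    have hpos : Summable fun n : ℕ =>
        (ε * ((n : ℤ) : ℝ)) ^ p * Real.exp (-(ε * ((n : ℤ) : ℝ)) ^ (2 * N)) := by
      rw [← summable_pnat_iff_summable_nat]
      refine ((summable_pow_mul_exp_neg_mul_pow hN p ht).mul_left (ε ^ p)).congr fun n => ?_
      exact (hterm n).symm
    refine Summable.of_nat_of_neg hpos (hpos.congr fun n => ?_)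
    push_cast
    rw [mul_neg, hp.neg_pow, (even_two_mul N).neg_pow]
  rw [tsum_int_eq_zero_add_two_mul_tsum_pnat (fun n => by
    push_cast
    rw [mul_neg, hp.neg_pow, (even_two_mul N).neg_pow]) hsum] at h
  rw [tsum_congr hterm, tsum_mul_left, nsmul_eq_mul, Nat.cast_ofNat] at h
  set S := ∑' n : ℕ+, (n : ℝ) ^ p * Real.exp (-t * (n : ℝ) ^ (2 * N)) with hS
  have hz : (ε * ((0 : ℤ) : ℝ)) ^ p * Real.exp (-(ε * ((0 : ℤ) : ℝ)) ^ (2 * N)) = ε ^ p * 0 ^ p := by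
    rw [← mul_pow]; simp [hN.ne']
  have hkey : ε * ((ε * ((0 : ℤ) : ℝ)) ^ p * Real.exp (-(ε * ((0 : ℤ) : ℝ)) ^ (2 * N)) +
      2 * (ε ^ p * S)) - 2 * powExpIntegral N p = 2 * ε ^ (p + 1) * psi N p t := by
    rw [hz, psi, ← hS]
    linear_combination (2 * powExpIntegral N p) * hεp
  rw [hkey, abs_mul, abs_of_pos (by positivity)] at h
  have h2 : C * ε ^ (p + 2 * N * K + 2) = (2 * ε ^ (p + 1)) * (C * t ^ K * (ε / 2)) := by
    rw [← hεN, ← pow_mul]; ring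
  rw [h2] at h
  have h3 := le_of_mul_le_mul_left h (by positivity)
  refine h3.trans (mul_le_of_le_one_right (by positivity) (by linarith))

/-- For t ≥ 1 the theta series is exponentially small, so after removing the constant the subtracted
power of t governs the size. -/
lemma exists_psi_sub_le_rpow {N : ℕ} (hN : 0 < N) (p : ℕ) :
    ∃ C : ℝ, 0 ≤ C ∧ ∀ t : ℝ, 1 ≤ t →
      |psi N p t - 0 ^ p / 2| ≤ C * t ^ (-((p + 1) / (2 * N) : ℝ)) := by
  set A := ∑' n : ℕ+, (n : ℝ) ^ p * Real.exp (-(1 / 2) * (n : ℝ) ^ (2 * N)) with hA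
  have hsA := summable_pow_mul_exp_neg_mul_pow hN p (t := 1 / 2) (by norm_num)
  have hA0 : 0 ≤ A := tsum_nonneg fun n => by positivity
  have hc := powExpIntegral_nonneg N p
  refine ⟨A * ((p + 1)! * 2 ^ (p + 1)) + powExpIntegral N p, by positivity, fun t ht => ?_⟩
  have ht0 : 0 < t := by linarith
  have hr : 0 < t ^ (-((p + 1) / (2 * N) : ℝ)) := Real.rpow_pos_of_pos ht0 _
  have h1 : ∑' n : ℕ+, (n : ℝ) ^ p * Real.exp (-t * (n : ℝ) ^ (2 * N)) ≤ A * Real.exp (-(t / 2)) := by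
    rw [hA, ← tsum_mul_right]
    refine (summable_pow_mul_exp_neg_mul_pow hN p ht0).tsum_le_tsum (fun n => ?_) (hsA.mul_right _)
    rw [mul_assoc, ← Real.exp_add]
    have hn : (1 : ℝ) ≤ (n : ℝ) ^ (2 * N) := one_le_pow₀ (by exact_mod_cast n.2)
    gcongr ?_ * Real.exp ?_
    nlinarith
  have h2 : Real.exp (-(t / 2)) ≤ ((p + 1)! * 2 ^ (p + 1)) * t ^ (-((p + 1) / (2 * N) : ℝ)) := by
    have h3 := Real.pow_div_factorial_le_exp (t / 2) (by positivity) (p + 1)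
    have h4 : t ^ (-((p + 1 : ℕ) : ℝ)) ≤ t ^ (-((p + 1) / (2 * N) : ℝ)) := by
      apply Real.rpow_le_rpow_of_exponent_le ht
      push_cast
      have : (1 : ℝ) ≤ 2 * N := by
        have : (1 : ℝ) ≤ N := by exact_mod_cast hN
        linarith
      have := div_le_self (a := (p + 1 : ℝ)) (by positivity) this
      linarith
    rw [Real.rpow_neg ht0.le, Real.rpow_natCast] at h4
    refine le_trans ?_ (mul_le_mul_of_nonneg_left h4 (by positivity))
    rw [Real.exp_neg, inv_le_comm₀ (Real.exp_pos _) (by positivity)]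
    refine le_trans (le_of_eq ?_) h3
    rw [div_pow]
    field_simp
  have h0 : 0 ≤ ∑' n : ℕ+, (n : ℝ) ^ p * Real.exp (-t * (n : ℝ) ^ (2 * N)) :=
    tsum_nonneg fun n => by positivity
  have e : psi N p t - 0 ^ p / 2 = ∑' n : ℕ+, (n : ℝ) ^ p * Real.exp (-t * (n : ℝ) ^ (2 * N)) -
    powExpIntegral N p * t ^ (-((p + 1) / (2 * N) : ℝ)) := by rw [psi]; ring
  rw [e]
  refine (abs_sub _ _).trans ?_
  rw [abs_of_nonneg h0, abs_of_nonneg (by positivity), add_mul, mul_assoc A]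
  gcongr
  exact h1.trans (mul_le_mul_of_nonneg_left h2 hA0)

lemma powExpIntegral_add {N : ℕ} (hN : 0 < N) (p : ℕ) :
    powExpIntegral N (p + 2 * N) = ((p + 1) / (2 * N)) * powExpIntegral N p := by
  have hN' : (N : ℝ) ≠ 0 := by positivity
  rw [powExpIntegral, powExpIntegral]
  have : (((p + 2 * N : ℕ) : ℝ) + 1) / (2 * N) = ((p : ℝ) + 1) / (2 * N) + 1 := by
    push_cast; field_simp; ring
  rw [this, Real.Gamma_add_one (by positivity)]
  ring

/-- Each exponential contributes a factor -n^{2N}, and Γ(s+1) = sΓ(s) makes the subtracted power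
differentiate into the one belonging to p + 2N. The constant disappears, in agreement with 0^(p+2N)
= 0. -/
lemma hasDerivAt_psi {N : ℕ} (hN : 0 < N) (p : ℕ) {t : ℝ} (ht : 0 < t) :
    HasDerivAt (psi N p) (-psi N (p + 2 * N) t) t := by
  have hN' : (N : ℝ) ≠ 0 := by positivity
  have h1 : HasDerivAt (fun t : ℝ => ∑' n : ℕ+, (n : ℝ) ^ p * Real.exp (-t * (n : ℝ) ^ (2 * N)))
      (∑' n : ℕ+, -((n : ℝ) ^ (p + 2 * N) * Real.exp (-t * (n : ℝ) ^ (2 * N)))) t := by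
    refine hasDerivAt_tsum_of_isPreconnected
      (g := fun (n : ℕ+) (t : ℝ) => (n : ℝ) ^ p * Real.exp (-t * (n : ℝ) ^ (2 * N)))
      (g' := fun (n : ℕ+) (t : ℝ) => -((n : ℝ) ^ (p + 2 * N) * Real.exp (-t * (n : ℝ) ^ (2 * N))))
      -- On y > t/2 the differentiated terms are dominated by their values at t/2, which gives a
      -- summable bound uniform in y.
      (t := Set.Ioi (t / 2)) (y₀ := t)
      (summable_pow_mul_exp_neg_mul_pow hN (p + 2 * N) (half_pos ht)) isOpen_Ioi
      isPreconnected_Ioi (fun n y _ => ?_) (fun n y hy => ?_) ?_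
      (summable_pow_mul_exp_neg_mul_pow hN p ht) ?_
    · have := (((hasDerivAt_neg y).mul_const ((n : ℝ) ^ (2 * N))).exp).const_mul ((n : ℝ) ^ p)
      refine this.congr_deriv ?_
      ring
    · simp only [Set.mem_Ioi] at hy
      rw [norm_neg, Real.norm_eq_abs, abs_of_nonneg (by positivity)]
      gcongr
    · simp only [Set.mem_Ioi]; linarith
    · simp only [Set.mem_Ioi]; linarith
  have h2 := (Real.hasDerivAt_rpow_const (p := -((p + 1) / (2 * N) : ℝ)) (Or.inl ht.ne')).const_mul
    (powExpIntegral N p)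
  have h3 := (h1.const_add (0 ^ p / 2)).sub h2
  refine h3.congr_deriv ?_
  rw [psi, tsum_neg, powExpIntegral_add hN, zero_pow (by omega)]
  have e : -((((p + 2 * N : ℕ) : ℝ) + 1) / (2 * N)) = -(((p : ℝ) + 1) / (2 * N)) - 1 := by
    push_cast; field_simp; ring
  rw [e]
  ring

end

/-! ### Integration by parts for products of theta series -/

section

open MeasureTheory

lemma continuousOn_psi {N : ℕ} (hN : 0 < N) (p : ℕ) : ContinuousOn (psi N p) (Set.Ioi 0) :=
  fun _ ht => (hasDerivAt_psi hN p ht).continuousAt.continuousWithinAt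

lemma exists_psi_bound {N : ℕ} (hN : 0 < N) {p : ℕ} (hp : Even p) :
    ∃ C : ℝ, 0 ≤ C ∧ ∀ t : ℝ, 0 < t → |psi N p t| ≤ C := by
  obtain ⟨A, hA0, hA⟩ := exists_psi_le_pow hN hp 0
  obtain ⟨B, hB0, hB⟩ := exists_psi_sub_le_rpow hN p
  refine ⟨A + (B + 1 / 2), by positivity, fun t ht => ?_⟩
  rcases le_total t 1 with h | h
  · have := hA t ht h
    rw [pow_zero, mul_one] at this
    linarith
  · have h1 := hB t h
    have h2 : t ^ (-((p + 1) / (2 * N) : ℝ)) ≤ 1 :=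
      Real.rpow_le_one_of_one_le_of_nonpos h (by
        have : (0 : ℝ) ≤ (p + 1) / (2 * N) := by positivity
        linarith)
    have h3 : |(0 : ℝ) ^ p / 2| ≤ 1 / 2 := by
      rcases Nat.eq_zero_or_pos p with rfl | h0
      · norm_num
      · rw [zero_pow h0.ne']; norm_num
    have h4 : |psi N p t| ≤ |psi N p t - 0 ^ p / 2| + |(0 : ℝ) ^ p / 2| := by
      simpa using abs_add_le (psi N p t - 0 ^ p / 2) (0 ^ p / 2)
    nlinarith

lemma exists_psi_le_pow' {N : ℕ} (hN : 0 < N) {p : ℕ} (hp : Even p) (K : ℕ) :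
    ∃ C : ℝ, 0 ≤ C ∧ ∀ t : ℝ, 0 < t → |psi N p t| ≤ C * t ^ K := by
  obtain ⟨A, hA0, hA⟩ := exists_psi_le_pow hN hp K
  obtain ⟨B, hB0, hB⟩ := exists_psi_bound hN hp
  refine ⟨A + B, by positivity, fun t ht => ?_⟩
  have h0 : 0 ≤ t ^ K := by positivity
  rcases le_total t 1 with h | h
  · have := hA t ht h
    nlinarith
  · have h1 := hB t ht
    have h2 : 1 ≤ t ^ K := one_le_pow₀ h
    nlinarith

lemma tendsto_psi_nhdsGT_zero {N : ℕ} (hN : 0 < N) {p : ℕ} (hp : Even p) :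
    Filter.Tendsto (psi N p) (nhdsWithin 0 (Set.Ioi 0)) (nhds 0) := by
  obtain ⟨C, hC0, hC⟩ := exists_psi_le_pow' hN hp 1
  have h1 : Filter.Tendsto (fun t : ℝ => C * t ^ 1) (nhdsWithin 0 (Set.Ioi 0)) (nhds 0) := by
    have : Filter.Tendsto (fun t : ℝ => C * t ^ 1) (nhds 0) (nhds (C * 0 ^ 1)) :=
      (by fun_prop : Continuous fun t : ℝ => C * t ^ 1).tendsto 0
    simp only [pow_one, mul_zero] at this
    simp only [pow_one]
    exact this.mono_left nhdsWithin_le_nhds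
  refine squeeze_zero_norm' ?_ h1
  filter_upwards [self_mem_nhdsWithin] with t ht
  exact hC t ht

lemma tendsto_psi_atTop {N : ℕ} (hN : 0 < N) (p : ℕ) :
    Filter.Tendsto (psi N p) Filter.atTop (nhds (0 ^ p / 2)) := by
  obtain ⟨C, hC0, hC⟩ := exists_psi_sub_le_rpow hN p
  rw [tendsto_iff_norm_sub_tendsto_zero]
  have h1 : Filter.Tendsto (fun t : ℝ => C * t ^ (-((p + 1) / (2 * N) : ℝ))) Filter.atTop (nhds 0) := by
    simpa using (tendsto_rpow_neg_atTop (y := ((p + 1) / (2 * N) : ℝ)) (by positivity)).const_mul C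
  refine squeeze_zero' (Filter.Eventually.of_forall fun _ => norm_nonneg _) ?_ h1
  filter_upwards [Filter.eventually_ge_atTop 1] with t ht
  exact hC t ht

/-- The condition 2N ≤ p removes the constant at infinity and makes the decay exponent (p+1)/(2N)
exceed 1. -/
lemma integrableOn_psi_mul {N : ℕ} (hN : 0 < N) {p : ℕ} (hp : Even p) (hNp : 2 * N ≤ p)
    {g : ℝ → ℝ} (hg : ContinuousOn g (Set.Ioi 0)) {B : ℝ} (hB : ∀ t, 0 < t → |g t| ≤ B) :
    IntegrableOn (fun t => psi N p t * g t) (Set.Ioi 0) := by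
  obtain ⟨A, hA0, hA⟩ := exists_psi_bound hN hp
  obtain ⟨C, hC0, hC⟩ := exists_psi_sub_le_rpow hN p
  have hB0 : 0 ≤ B := (abs_nonneg _).trans (hB 1 one_pos)
  have hmeas : ∀ s ⊆ Set.Ioi (0 : ℝ), MeasurableSet s →
      AEStronglyMeasurable (fun t => psi N p t * g t) (volume.restrict s) := fun s hs hms =>
    (((continuousOn_psi hN p).mul hg).mono hs).aestronglyMeasurable hms
  rw [← Set.Ioc_union_Ioi_eq_Ioi (zero_le_one (α := ℝ)), integrableOn_union]
  constructor
  · refine Integrable.mono' (g := fun _ => A * B) (integrableOn_const (by simp)) (hmeas _ (fun t ht => ht.1)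
      measurableSet_Ioc) ?_
    refine (ae_restrict_iff' measurableSet_Ioc).mpr (Filter.Eventually.of_forall fun t ht => ?_)
    rw [Real.norm_eq_abs, abs_mul]
    exact mul_le_mul (hA t ht.1) (hB t ht.1) (abs_nonneg _) hA0
  · have hN' : (0 : ℝ) < N := by exact_mod_cast hN
    have h1 : IntegrableOn (fun t : ℝ => t ^ (-((p + 1) / (2 * N) : ℝ))) (Set.Ioi 1) := by
      refine integrableOn_Ioi_rpow_of_lt ?_ one_pos
      have : (1 : ℝ) < (p + 1) / (2 * N) := by
        rw [lt_div_iff₀ (by positivity)]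
        have : ((2 * N : ℕ) : ℝ) ≤ p := by exact_mod_cast hNp
        push_cast at this
        linarith
      linarith
    refine Integrable.mono' ((h1.const_mul C).mul_const B) (hmeas _
      (Set.Ioi_subset_Ioi zero_le_one) measurableSet_Ioi) ?_
    refine (ae_restrict_iff' measurableSet_Ioi).mpr (Filter.Eventually.of_forall fun t ht => ?_)
    have ht1 : (1 : ℝ) < t := ht
    have ht0 : (0 : ℝ) < t := by linarith
    have h2 := hC t ht1.le
    rw [zero_pow (by omega), zero_div, sub_zero] at h2
    rw [Real.norm_eq_abs, abs_mul]
    exact mul_le_mul h2 (hB t ht0) (abs_nonneg _) (by positivity)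

/-- One integration by parts. Both factors vanish at 0; at infinity they tend to 0^p/2 and 0^q/2, so
a boundary term survives only for p = q = 0. -/
lemma integral_psi_add_mul_psi {N L : ℕ} (hN : 0 < N) (hL : 0 < L) {p q : ℕ} (hp : Even p)
    (hq : Even q) {a : ℝ} (ha : 0 < a) :
    ∫ t in Set.Ioi (0 : ℝ), psi N (p + 2 * N) t * psi L q (a * t) =
      -a * (∫ t in Set.Ioi (0 : ℝ), psi N p t * psi L (q + 2 * L) (a * t)) -
        (0 : ℝ) ^ p * 0 ^ q / 4 := by
  have hcomp : ∀ {r : ℕ}, ContinuousOn (fun t => psi L r (a * t)) (Set.Ioi 0) := fun {r} =>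
    (continuousOn_psi hL r).comp (by fun_prop) fun t ht => mul_pos ha ht
  have hu : ∀ t ∈ Set.Ioi (0 : ℝ), HasDerivAt (fun t => psi L q (a * t))
      (-a * psi L (q + 2 * L) (a * t)) t := by
    intro t ht
    have h1 := hasDerivAt_psi hL q (mul_pos ha ht)
    have h2 : HasDerivAt (fun t : ℝ => a * t) a t := by
      simpa using (hasDerivAt_id t).const_mul a
    exact (h1.comp t h2).congr_deriv (by ring)
  have hv : ∀ t ∈ Set.Ioi (0 : ℝ), HasDerivAt (psi N p) (-psi N (p + 2 * N) t) t :=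
    fun t ht => hasDerivAt_psi hN p ht
  obtain ⟨B, hB0, hB⟩ := exists_psi_bound hL hq
  obtain ⟨A, hA0, hA⟩ := exists_psi_bound hN hp
  have i1 : IntegrableOn ((fun t => psi L q (a * t)) * fun t => -psi N (p + 2 * N) t) (Set.Ioi 0) := by
    have := (integrableOn_psi_mul hN (hp.add (even_two_mul N)) (Nat.le_add_left _ _) (hcomp (r := q))
      (fun t ht => hB (a * t) (mul_pos ha ht))).neg
    refine this.congr_fun (fun t _ => ?_) measurableSet_Ioi
    simp only [Pi.neg_apply, Pi.mul_apply]; ring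
  have i2 : IntegrableOn ((fun t => -a * psi L (q + 2 * L) (a * t)) * psi N p) (Set.Ioi 0) := by
    have hg : ContinuousOn (fun s => psi N p (s / a)) (Set.Ioi 0) :=
      (continuousOn_psi hN p).comp (by fun_prop) fun t ht => div_pos ht ha
    have h1 := integrableOn_psi_mul hL (hq.add (even_two_mul L)) (Nat.le_add_left _ _) hg
      (fun t ht => hA (t / a) (div_pos ht ha))
    have h2 := (integrableOn_Ioi_comp_mul_left_iff
      (fun s => psi L (q + 2 * L) s * psi N p (s / a)) 0 ha).mpr (by simpa using h1)
    refine IntegrableOn.congr_fun (h2.const_mul (-a)) (fun t _ => ?_) measurableSet_Ioi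
    simp only [Pi.mul_apply]
    rw [mul_div_cancel_left₀ _ ha.ne']; ring
  have l0 : Filter.Tendsto ((fun t => psi L q (a * t)) * psi N p) (nhdsWithin 0 (Set.Ioi 0)) (nhds 0) := by
    have h1 : Filter.Tendsto (fun t : ℝ => a * t) (nhdsWithin 0 (Set.Ioi 0))
        (nhdsWithin 0 (Set.Ioi 0)) := by
      refine tendsto_nhdsWithin_iff.mpr ⟨?_, ?_⟩
      · have : Filter.Tendsto (fun t : ℝ => a * t) (nhds 0) (nhds (a * 0)) :=
          (continuous_const_mul a).tendsto 0
        rw [mul_zero] at this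
        exact this.mono_left nhdsWithin_le_nhds
      · filter_upwards [self_mem_nhdsWithin] with t ht
        exact mul_pos ha ht
    have := ((tendsto_psi_nhdsGT_zero hL hq).comp h1).mul (tendsto_psi_nhdsGT_zero hN hp)
    rw [mul_zero] at this
    exact this
  have l1 : Filter.Tendsto ((fun t => psi L q (a * t)) * psi N p) Filter.atTop
      (nhds (0 ^ q / 2 * (0 ^ p / 2))) :=
    ((tendsto_psi_atTop hL q).comp (Filter.tendsto_id.const_mul_atTop ha)).mul (tendsto_psi_atTop hN p)
  have key := integral_Ioi_mul_deriv_eq_deriv_mul hu hv i1 i2 l0 l1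
  have e1 : ∫ t in Set.Ioi (0 : ℝ), psi L q (a * t) * -psi N (p + 2 * N) t =
      -∫ t in Set.Ioi (0 : ℝ), psi N (p + 2 * N) t * psi L q (a * t) := by
    rw [← integral_neg]; congr 1; funext t; ring
  have e2 : ∫ t in Set.Ioi (0 : ℝ), -a * psi L (q + 2 * L) (a * t) * psi N p t =
      -a * ∫ t in Set.Ioi (0 : ℝ), psi N p t * psi L (q + 2 * L) (a * t) := by
    rw [← integral_const_mul]; congr 1; funext t; ring
  rw [e1, e2] at key
  linarith

/-- This is M integrations by parts. Only the first has q = 0, and it then has p = 2h + 2N(M-1),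
which vanishes exactly when h = 0 and M = 1. -/
lemma integral_psi_mul_psi_swap (h : ℕ) {M : ℕ} (hM : 0 < M) {a : ℝ} (ha : 0 < a) :
    ∫ t in Set.Ioi (0 : ℝ), psi (2 * h + 1) (2 * h + 2 * (2 * h + 1) * M) t * psi 1 0 (a * t) =
      (-a) ^ M * (∫ t in Set.Ioi (0 : ℝ), psi (2 * h + 1) (2 * h) t * psi 1 (2 * M) (a * t)) -
        (if h = 0 ∧ M = 1 then 1 / 4 else 0) := by
  have hN : 0 < 2 * h + 1 := by omega
  have hev : ∀ i, Even (2 * h + 2 * (2 * h + 1) * i) := fun i =>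
    (even_two_mul h).add (by rw [mul_assoc]; exact even_two_mul _)
  have hsucc : ∀ i, 2 * h + 2 * (2 * h + 1) * (i + 1) = 2 * h + 2 * (2 * h + 1) * i + 2 * (2 * h + 1) :=
    fun i => by ring
  -- The second index is kept of the form 2(j+1) > 0, so no boundary term appears anywhere in this
  -- induction.
  have step : ∀ i j : ℕ,
      ∫ t in Set.Ioi (0 : ℝ), psi (2 * h + 1) (2 * h + 2 * (2 * h + 1) * i) t *
        psi 1 (2 * (j + 1)) (a * t) =
      (-a) ^ i * ∫ t in Set.Ioi (0 : ℝ), psi (2 * h + 1) (2 * h) t * psi 1 (2 * (j + 1 + i)) (a * t) := by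
    intro i
    induction i with
    | zero => intro j; simp
    | succ i ih =>
      intro j
      rw [hsucc, integral_psi_add_mul_psi hN one_pos (hev i) (even_two_mul _) ha,
        zero_pow (M₀ := ℝ) (n := 2 * (j + 1)) (by omega),
        show 2 * (j + 1) + 2 * 1 = 2 * ((j + 1) + 1) by ring, ih (j + 1),
        show j + 1 + 1 + i = j + 1 + (i + 1) by ring]
      ring
  obtain ⟨m, rfl⟩ : ∃ m, M = m + 1 := ⟨M - 1, by omega⟩
  rw [hsucc, integral_psi_add_mul_psi hN one_pos (hev m) (by simp) ha, pow_zero,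
    show 0 + 2 * 1 = 2 * (0 + 1) by rfl, step m 0, show 0 + 1 + m = m + 1 by ring]
  have e : (0 : ℝ) ^ (2 * h + 2 * (2 * h + 1) * m) * 1 / 4 =
      if h = 0 ∧ m + 1 = 1 then 1 / 4 else 0 := by
    split_ifs with hc
    · obtain ⟨rfl, hm⟩ := hc
      have : m = 0 := by omega
      subst this
      norm_num
    · rw [zero_pow, zero_mul, zero_div]
      intro h0
      apply hc
      have h1 : 2 * h = 0 := by omega
      have h2 : 2 * (2 * h + 1) * m = 0 := by omega
      rcases Nat.mul_eq_zero.mp h2 with h3 | h3 <;> omega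
  rw [e]
  ring

end

/-! ### Laplace transforms of the theta series -/

section

open MeasureTheory

lemma integrableOn_pow_mul_exp_neg_mul (K : ℕ) {u : ℝ} (hu : 0 < u) :
    IntegrableOn (fun t : ℝ => t ^ K * Real.exp (-t * u)) (Set.Ioi 0) := by
  have h := integrableOn_rpow_mul_exp_neg_mul_rpow (p := 1) (s := K) (b := u)
    (by have : (0 : ℝ) ≤ K := by positivity
        linarith) one_pos hu
  refine h.congr_fun (fun t _ => ?_) measurableSet_Ioi
  simp only [Real.rpow_natCast, Real.rpow_one]
  ring_nf

lemma integral_pow_mul_exp_neg_mul (K : ℕ) {u : ℝ} (hu : 0 < u) :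
    ∫ t in Set.Ioi (0 : ℝ), t ^ K * Real.exp (-t * u) = K ! / u ^ (K + 1) := by
  have h := Real.integral_rpow_mul_exp_neg_mul_Ioi (a := (K + 1 : ℕ)) (r := u) (by positivity) hu
  rw [Real.rpow_natCast, Nat.cast_add_one, Real.Gamma_nat_eq_factorial] at h
  rw [div_eq_mul_one_div, mul_comm, ← one_div_pow, ← h]
  refine setIntegral_congr_fun measurableSet_Ioi fun t _ => ?_
  rw [add_sub_cancel_right, Real.rpow_natCast]
  ring_nf

lemma integrableOn_exp_neg_mul {u : ℝ} (hu : 0 < u) :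
    IntegrableOn (fun t : ℝ => Real.exp (-t * u)) (Set.Ioi 0) := by
  simpa using integrableOn_pow_mul_exp_neg_mul 0 hu

lemma integral_exp_neg_mul {u : ℝ} (hu : 0 < u) :
    ∫ t in Set.Ioi (0 : ℝ), Real.exp (-t * u) = 1 / u := by
  simpa using integral_pow_mul_exp_neg_mul 0 hu

lemma summable_pow_div_add_pow (h : ℕ) {u : ℝ} (hu : 0 < u) :
    Summable fun n : ℕ+ => (n : ℝ) ^ (2 * h) / (u + (n : ℝ) ^ (2 * (2 * h + 1))) := by
  have h1 : Summable fun n : ℕ+ => 1 / (n : ℝ) ^ 2 :=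
    (Real.summable_one_div_nat_pow.mpr one_lt_two).comp_injective PNat.coe_injective
  refine Summable.of_nonneg_of_le (fun n => by positivity) (fun n => ?_) h1
  have hn : (1 : ℝ) ≤ n := by exact_mod_cast n.2
  rw [div_le_div_iff₀ (by positivity) (by positivity), one_mul, ← pow_add]
  have : (n : ℝ) ^ (2 * h + 2) ≤ (n : ℝ) ^ (2 * (2 * h + 1)) :=
    pow_le_pow_right₀ hn (by omega)
  linarith

/-- Termwise Laplace transform. For p = 2h the singular exponent (p+1)/(2N) is 1/2, so the two Gamma
factors are both √π. -/
lemma integral_exp_mul_psi (h : ℕ) {u : ℝ} (hu : 0 < u) :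
    ∫ t in Set.Ioi (0 : ℝ), Real.exp (-t * u) * psi (2 * h + 1) (2 * h) t =
      0 ^ (2 * h) / 2 / u + ∑' n : ℕ+, (n : ℝ) ^ (2 * h) / (u + (n : ℝ) ^ (2 * (2 * h + 1))) -
        Real.pi / (2 * (2 * h + 1)) * u ^ (-(1 / 2) : ℝ) := by
  have i1 := integrableOn_exp_neg_mul hu
  have hF : ∀ n : ℕ+, IntegrableOn (fun t : ℝ => (n : ℝ) ^ (2 * h) *
      Real.exp (-t * (u + (n : ℝ) ^ (2 * (2 * h + 1))))) (Set.Ioi 0) := fun n =>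
    (integrableOn_exp_neg_mul (by positivity)).const_mul _
  have vF : ∀ n : ℕ+, ∫ t in Set.Ioi (0 : ℝ), (n : ℝ) ^ (2 * h) *
      Real.exp (-t * (u + (n : ℝ) ^ (2 * (2 * h + 1)))) =
      (n : ℝ) ^ (2 * h) / (u + (n : ℝ) ^ (2 * (2 * h + 1))) := fun n => by
    rw [integral_const_mul, integral_exp_neg_mul (by positivity), mul_one_div]
  have hs : Summable fun n : ℕ+ => ∫ t in Set.Ioi (0 : ℝ), ‖(n : ℝ) ^ (2 * h) *
      Real.exp (-t * (u + (n : ℝ) ^ (2 * (2 * h + 1))))‖ := by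
    refine (summable_pow_div_add_pow h hu).congr fun n => ?_
    rw [← vF n]
    congr 1; funext t
    rw [Real.norm_of_nonneg (by positivity)]
  have h2 := hasSum_integral_of_summable_integral_norm hF hs
  have e2 : ∀ t : ℝ, ∑' n : ℕ+, (n : ℝ) ^ (2 * h) *
      Real.exp (-t * (u + (n : ℝ) ^ (2 * (2 * h + 1)))) =
      Real.exp (-t * u) * ∑' n : ℕ+, (n : ℝ) ^ (2 * h) * Real.exp (-t * (n : ℝ) ^ (2 * (2 * h + 1))) := by
    intro t
    rw [← tsum_mul_left]
    congr 1; funext n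
    rw [mul_add, Real.exp_add]; ring
  simp_rw [e2, vF] at h2
  have i3 : IntegrableOn (fun t : ℝ => t ^ (-(1 / 2) : ℝ) * Real.exp (-t * u)) (Set.Ioi 0) := by
    have := integrableOn_rpow_mul_exp_neg_mul_rpow (p := 1) (s := -(1 / 2)) (b := u)
      (by norm_num) one_pos hu
    refine this.congr_fun (fun t _ => ?_) measurableSet_Ioi
    simp only [Real.rpow_one]
    ring_nf
  have v3 : ∫ t in Set.Ioi (0 : ℝ), t ^ (-(1 / 2) : ℝ) * Real.exp (-t * u) =
      u ^ (-(1 / 2) : ℝ) * √Real.pi := by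
    have h := Real.integral_rpow_mul_exp_neg_mul_Ioi (a := 1 / 2) (r := u) (by norm_num) hu
    rw [Real.Gamma_one_half_eq, one_div u, Real.inv_rpow hu.le, ← Real.rpow_neg hu.le] at h
    rw [← h]
    refine setIntegral_congr_fun measurableSet_Ioi fun t _ => ?_
    rw [show (1 / 2 - 1 : ℝ) = -(1 / 2) by norm_num]
    ring_nf
  have hpsi : ∀ t : ℝ, Real.exp (-t * u) * psi (2 * h + 1) (2 * h) t =
      0 ^ (2 * h) / 2 * Real.exp (-t * u) + Real.exp (-t * u) * (∑' n : ℕ+, (n : ℝ) ^ (2 * h) *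
        Real.exp (-t * (n : ℝ) ^ (2 * (2 * h + 1)))) -
      1 / (2 * (2 * h + 1)) * √Real.pi * (t ^ (-(1 / 2) : ℝ) * Real.exp (-t * u)) := by
    intro t
    have e3 : (((2 * h : ℕ) : ℝ) + 1) / (2 * (2 * h + 1 : ℕ)) = 1 / 2 := by
      push_cast; field_simp
    rw [psi, powExpIntegral, e3, Real.Gamma_one_half_eq]
    push_cast
    ring
  have i2 : IntegrableOn (fun t : ℝ => Real.exp (-t * u) * (∑' n : ℕ+, (n : ℝ) ^ (2 * h) *
        Real.exp (-t * (n : ℝ) ^ (2 * (2 * h + 1))))) (Set.Ioi 0) := by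
    -- The theta series itself is singular at 0; its integrability is recovered from the bounded
    -- function ψ by adding back the integrable t^{-1/2}.
    obtain ⟨B, hB0, hB⟩ := exists_psi_bound (N := 2 * h + 1) (by omega) (even_two_mul h)
    have i4 : IntegrableOn (fun t : ℝ => Real.exp (-t * u) * psi (2 * h + 1) (2 * h) t) (Set.Ioi 0) := by
      refine Integrable.mono' (i1.mul_const B) ?_ ?_
      · exact ((by fun_prop : ContinuousOn (fun t : ℝ => Real.exp (-t * u)) (Set.Ioi 0)).mul
          (continuousOn_psi (by omega) _)).aestronglyMeasurable measurableSet_Ioi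
      · refine (ae_restrict_iff' measurableSet_Ioi).mpr (Filter.Eventually.of_forall fun t ht => ?_)
        rw [norm_mul, Real.norm_of_nonneg (Real.exp_pos _).le]
        exact mul_le_mul_of_nonneg_left (hB t ht) (Real.exp_pos _).le
    have := (i4.sub (i1.const_mul (0 ^ (2 * h) / 2))).add
      (i3.const_mul (1 / (2 * (2 * h + 1)) * √Real.pi))
    refine IntegrableOn.congr_fun this (fun t _ => ?_) measurableSet_Ioi
    simp only [Pi.add_apply, Pi.sub_apply, hpsi]
    ring
  have i12 : IntegrableOn (fun t : ℝ => 0 ^ (2 * h) / 2 * Real.exp (-t * u) +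
      Real.exp (-t * u) * (∑' n : ℕ+, (n : ℝ) ^ (2 * h) *
        Real.exp (-t * (n : ℝ) ^ (2 * (2 * h + 1))))) (Set.Ioi 0) := (i1.const_mul _).add i2
  simp_rw [hpsi]
  rw [integral_sub i12 (i3.const_mul _), integral_add (i1.const_mul _) i2,
    integral_const_mul, integral_const_mul, integral_exp_neg_mul hu, v3, h2.tsum_eq]
  have hpi : √Real.pi * √Real.pi = Real.pi := Real.mul_self_sqrt Real.pi_pos.le
  linear_combination (-(1 / (2 * (2 * (h : ℝ) + 1))) * u ^ (-(1 / 2) : ℝ)) * hpi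

/-- The regularisation matches the partial fractions term by term at u = d^{2N}: the constant
0^(2h)/2 cancels the polar correction and the subtracted singularity cancels π/2. Only `altBose` is
left. -/
lemma integral_exp_mul_psi_eq_altBose (h : ℕ) {d : ℝ} (hd : 0 < d) :
    ((∫ t in Set.Ioi (0 : ℝ), Real.exp (-t * d ^ (2 * (2 * h + 1))) * psi (2 * h + 1) (2 * h) t : ℝ) : ℂ) =
      Real.pi / ((2 * h + 1 : ℕ) * (d : ℂ) ^ (2 * h + 1)) * altBose h d := by
  have hs := (hasSum_altBose h hd).tsum_eq
  have hdN : (d : ℂ) ^ (2 * h + 1) ≠ 0 := pow_ne_zero _ (by exact_mod_cast hd.ne')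
  have hN : ((2 * h + 1 : ℕ) : ℂ) ≠ 0 := by exact_mod_cast (by omega : 2 * h + 1 ≠ 0)
  simp_rw [mul_div_assoc] at hs
  rw [tsum_mul_left] at hs
  rw [integral_exp_mul_psi h (by positivity)]
  have e1 : ((∑' n : ℕ+, (n : ℝ) ^ (2 * h) / (d ^ (2 * (2 * h + 1)) + (n : ℝ) ^ (2 * (2 * h + 1))) : ℝ) : ℂ)
      = ∑' n : ℕ+, (n : ℂ) ^ (2 * h) / ((n : ℂ) ^ (2 * (2 * h + 1)) + (d : ℂ) ^ (2 * (2 * h + 1))) := by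
    rw [Complex.ofReal_tsum]
    congr 1; funext n
    push_cast
    rw [add_comm]
  have e2 : (d ^ (2 * (2 * h + 1))) ^ (-(1 / 2) : ℝ) = (d ^ (2 * h + 1))⁻¹ := by
    rw [← Real.rpow_natCast d, ← Real.rpow_mul hd.le, ← Real.rpow_natCast d, ← Real.rpow_neg hd.le]
    congr 1
    push_cast
    ring
  rw [e2, Complex.ofReal_sub, Complex.ofReal_add, e1]
  set S := ∑' n : ℕ+, (n : ℂ) ^ (2 * h) / ((n : ℂ) ^ (2 * (2 * h + 1)) + (d : ℂ) ^ (2 * (2 * h + 1)))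
  have e3 : (d : ℂ) ^ (2 * (2 * h + 1)) = (d : ℂ) ^ (2 * h + 1) * (d : ℂ) ^ (2 * h + 1) := by
    rw [two_mul (2 * h + 1), pow_add]
  push_cast at hs hN ⊢
  rw [e3]
  set D := (d : ℂ) ^ (2 * h + 1)
  have hS : S = (Real.pi * (altBose h d + 1 / 2) - 1 / 2 * ((2 * h + 1) * (0 ^ (2 * h) / D))) /
      ((2 * h + 1) * D) := by
    rw [eq_div_iff (mul_ne_zero hN hdN), ← hs]; ring
  rw [hS]
  field_simp
  ring

/-- Integrating against `psi` amounts to comparing the sum and the integral of a Laplace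
transform. -/
lemma integral_psi_mul_eq_tsum_sub_integral {N : ℕ} (hN : 0 < N) {p K : ℕ} (hp : Even p)
    (hNp : 2 * N ≤ p) (hK : p + 2 ≤ 2 * N * (K + 1)) {g : ℝ → ℝ}
    (hg : ContinuousOn g (Set.Ioi 0)) {B C : ℝ} (hB : ∀ t, 0 < t → |g t| ≤ B)
    (hC : ∀ t, 0 < t → |g t| ≤ C * t ^ K) :
    ∫ t in Set.Ioi (0 : ℝ), psi N p t * g t =
      (∑' n : ℕ+, (n : ℝ) ^ p * ∫ t in Set.Ioi (0 : ℝ), Real.exp (-t * (n : ℝ) ^ (2 * N)) * g t) -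
      ∫ y in Set.Ioi (0 : ℝ), y ^ p * ∫ t in Set.Ioi (0 : ℝ), Real.exp (-t * y ^ (2 * N)) * g t := by
  have hC0 : 0 ≤ C := by simpa using (abs_nonneg _).trans (hC 1 one_pos)
  have hB0 : 0 ≤ B := (abs_nonneg _).trans (hB 1 one_pos)
  have i0 : ∀ {u : ℝ}, 0 < u → IntegrableOn (fun t : ℝ => Real.exp (-t * u) * g t) (Set.Ioi 0) := by
    intro u hu
    have i1 := integrableOn_exp_neg_mul hu
    refine Integrable.mono' (i1.mul_const B) ?_ ?_
    · exact ((by fun_prop : ContinuousOn (fun t : ℝ => Real.exp (-t * u)) (Set.Ioi 0)).mul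
        hg).aestronglyMeasurable measurableSet_Ioi
    · refine (ae_restrict_iff' measurableSet_Ioi).mpr (Filter.Eventually.of_forall fun t ht => ?_)
      rw [norm_mul, Real.norm_of_nonneg (Real.exp_pos _).le]
      exact mul_le_mul_of_nonneg_left (hB t ht) (Real.exp_pos _).le
  have b1 : ∀ {u : ℝ}, 0 < u → ∫ t in Set.Ioi (0 : ℝ), ‖Real.exp (-t * u) * g t‖ ≤ B / u := by
    intro u hu
    rw [div_eq_mul_one_div, ← integral_exp_neg_mul hu, ← integral_const_mul]
    refine setIntegral_mono_on (i0 hu).norm ((integrableOn_exp_neg_mul hu).const_mul _) measurableSet_Ioi fun t ht => ?_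
    rw [norm_mul, Real.norm_of_nonneg (Real.exp_pos _).le, mul_comm B]
    exact mul_le_mul_of_nonneg_left (hB t ht) (Real.exp_pos _).le
  have b2 : ∀ {u : ℝ}, 0 < u → ∫ t in Set.Ioi (0 : ℝ), ‖Real.exp (-t * u) * g t‖ ≤
      C * K ! / u ^ (K + 1) := by
    intro u hu
    rw [mul_div_assoc, ← integral_pow_mul_exp_neg_mul K hu, ← integral_const_mul]
    refine setIntegral_mono_on (i0 hu).norm
      ((integrableOn_pow_mul_exp_neg_mul K hu).const_mul _) measurableSet_Ioi fun t ht => ?_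
    rw [norm_mul, Real.norm_of_nonneg (Real.exp_pos _).le, mul_comm, ← mul_assoc]
    exact mul_le_mul_of_nonneg_right (hC t ht) (Real.exp_pos _).le
  -- The vanishing of g to order K at 0 makes its Laplace transform decay fast enough to beat y^p.
  -- This controls both the series and the integral away from 0.
  have b3 : ∀ {y : ℝ}, 1 ≤ y → y ^ p * ∫ t in Set.Ioi (0 : ℝ), ‖Real.exp (-t * y ^ (2 * N)) * g t‖ ≤
      C * K ! * (1 / y ^ 2) := by
    intro y hy
    have hy0 : 0 < y := by linarith
    refine (mul_le_mul_of_nonneg_left (b2 (by positivity)) (by positivity)).trans ?_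
    rw [mul_comm, div_mul_eq_mul_div, mul_div_assoc]
    refine mul_le_mul_of_nonneg_left ?_ (by positivity)
    rw [div_le_div_iff₀ (by positivity) (by positivity), ← pow_add, one_mul, ← pow_mul]
    exact pow_le_pow_right₀ hy hK
  -- the series
  have hF : ∀ n : ℕ+, IntegrableOn (fun t : ℝ => (n : ℝ) ^ p *
      (Real.exp (-t * (n : ℝ) ^ (2 * N)) * g t)) (Set.Ioi 0) :=
    fun n => (i0 (by positivity)).const_mul _
  have hFs : Summable fun n : ℕ+ => ∫ t in Set.Ioi (0 : ℝ),
      ‖(n : ℝ) ^ p * (Real.exp (-t * (n : ℝ) ^ (2 * N)) * g t)‖ := by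
    have h1 : Summable fun n : ℕ+ => C * K ! * (1 / (n : ℝ) ^ 2) :=
      ((Real.summable_one_div_nat_pow.mpr one_lt_two).comp_injective PNat.coe_injective).mul_left _
    refine Summable.of_nonneg_of_le (fun n => integral_nonneg fun t => norm_nonneg _) (fun n => ?_) h1
    have hn : (1 : ℝ) ≤ n := by exact_mod_cast n.2
    refine le_trans (le_of_eq ?_) (b3 hn)
    rw [← integral_const_mul]
    congr 1; funext t
    rw [norm_mul, Real.norm_of_nonneg (by positivity)]
  have hsum := (hasSum_integral_of_summable_integral_norm hF hFs).tsum_eq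
  simp_rw [integral_const_mul] at hsum
  -- the integral
  have hmeas : AEStronglyMeasurable (fun z : ℝ × ℝ => z.2 ^ p * (Real.exp (-z.1 * z.2 ^ (2 * N)) * g z.1))
      ((volume.restrict (Set.Ioi 0)).prod (volume.restrict (Set.Ioi 0))) := by
    rw [Measure.prod_restrict]
    refine ContinuousOn.aestronglyMeasurable ?_ (measurableSet_Ioi.prod measurableSet_Ioi)
    have : ContinuousOn (fun z : ℝ × ℝ => g z.1) (Set.Ioi 0 ×ˢ Set.Ioi 0) :=
      hg.comp continuousOn_fst fun z hz => hz.1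
    exact (by fun_prop : Continuous fun z : ℝ × ℝ => z.2 ^ p).continuousOn.mul
      ((by fun_prop : Continuous fun z : ℝ × ℝ => Real.exp (-z.1 * z.2 ^ (2 * N))).continuousOn.mul this)
  have hint : Integrable (fun z : ℝ × ℝ => z.2 ^ p * (Real.exp (-z.1 * z.2 ^ (2 * N)) * g z.1))
      ((volume.restrict (Set.Ioi 0)).prod (volume.restrict (Set.Ioi 0))) := by
    rw [integrable_prod_iff' hmeas]
    constructor
    · refine (ae_restrict_iff' measurableSet_Ioi).mpr (Filter.Eventually.of_forall fun y hy => ?_)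
      have hy' : (0 : ℝ) < y := hy
      exact (i0 (u := y ^ (2 * N)) (by positivity)).const_mul (y ^ p)
    · have hm : AEStronglyMeasurable (fun y : ℝ => ∫ t in Set.Ioi (0 : ℝ),
          ‖y ^ p * (Real.exp (-t * y ^ (2 * N)) * g t)‖) (volume.restrict (Set.Ioi 0)) := by
        exact hmeas.norm.prod_swap.integral_prod_right'
      have hval : ∀ y : ℝ, 0 < y → ‖∫ t in Set.Ioi (0 : ℝ), ‖y ^ p * (Real.exp (-t * y ^ (2 * N)) * g t)‖‖ =
          y ^ p * ∫ t in Set.Ioi (0 : ℝ), ‖Real.exp (-t * y ^ (2 * N)) * g t‖ := by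
        intro y hy
        rw [Real.norm_of_nonneg (integral_nonneg fun _ => norm_nonneg _), ← integral_const_mul]
        congr 1; funext t
        rw [norm_mul, Real.norm_of_nonneg (by positivity)]
      suffices hI : IntegrableOn (fun y : ℝ => ∫ t in Set.Ioi (0 : ℝ),
          ‖y ^ p * (Real.exp (-t * y ^ (2 * N)) * g t)‖) (Set.Ioc 0 1 ∪ Set.Ioi 1) by
        rwa [Set.Ioc_union_Ioi_eq_Ioi (zero_le_one (α := ℝ))] at hI
      refine IntegrableOn.union ?_ ?_
      · refine Integrable.mono' (g := fun _ => B) (integrableOn_const (by simp))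
          (hm.mono_measure (Measure.restrict_mono_set _ Set.Ioc_subset_Ioi_self)) ?_
        refine (ae_restrict_iff' measurableSet_Ioc).mpr (Filter.Eventually.of_forall fun y hy => ?_)
        have hy0 : 0 < y := hy.1
        rw [hval y hy0]
        refine (mul_le_mul_of_nonneg_left (b1 (by positivity)) (by positivity)).trans ?_
        -- Near y = 0 the Laplace transform is only O(y^{-2N}), which is compensated by y^p because
        -- 2N ≤ p.
        rw [mul_div_assoc', div_le_iff₀ (by positivity), mul_comm]
        exact mul_le_mul_of_nonneg_left (pow_le_pow_of_le_one hy0.le hy.2 hNp) hB0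
      · have h1 : IntegrableOn (fun y : ℝ => y ^ (-2 : ℝ)) (Set.Ioi 1) :=
          integrableOn_Ioi_rpow_of_lt (by norm_num) one_pos
        refine Integrable.mono' (h1.const_mul (C * K !))
          (hm.mono_measure (Measure.restrict_mono_set _ (Set.Ioi_subset_Ioi zero_le_one))) ?_
        refine (ae_restrict_iff' measurableSet_Ioi).mpr (Filter.Eventually.of_forall fun y hy => ?_)
        have hy1 : (1 : ℝ) < y := hy
        rw [hval y (by linarith)]
        refine (b3 hy1.le).trans (le_of_eq ?_)
        rw [Real.rpow_neg (by linarith), one_div]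
        norm_cast
  have hswap := integral_integral_swap
    (f := fun t y : ℝ => y ^ p * (Real.exp (-t * y ^ (2 * N)) * g t)) hint
  have iP := hint.integral_prod_left
  have hP : ∀ t ∈ Set.Ioi (0 : ℝ), ∫ y in Set.Ioi (0 : ℝ), y ^ p * (Real.exp (-t * y ^ (2 * N)) * g t) =
      powExpIntegral N p * t ^ (-((p + 1) / (2 * N) : ℝ)) * g t := by
    intro t ht
    rw [← integral_pow_mul_exp_neg_mul_pow hN p ht, ← integral_mul_const]
    congr 1; funext y; ring
  have iP' : IntegrableOn (fun t => powExpIntegral N p * t ^ (-((p + 1) / (2 * N) : ℝ)) * g t)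
      (Set.Ioi 0) := IntegrableOn.congr_fun iP hP measurableSet_Ioi
  have vP := setIntegral_congr_fun (μ := volume) measurableSet_Ioi hP
  have hsplit : ∀ t : ℝ, psi N p t * g t = (∑' n : ℕ+, (n : ℝ) ^ p *
      (Real.exp (-t * (n : ℝ) ^ (2 * N)) * g t)) -
      powExpIntegral N p * t ^ (-((p + 1) / (2 * N) : ℝ)) * g t := by
    intro t
    simp_rw [← mul_assoc]
    rw [tsum_mul_right, psi, zero_pow (by omega)]
    ring
  have iS : IntegrableOn (fun t => ∑' n : ℕ+, (n : ℝ) ^ p *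
      (Real.exp (-t * (n : ℝ) ^ (2 * N)) * g t)) (Set.Ioi 0) := by
    refine IntegrableOn.congr_fun ((integrableOn_psi_mul hN hp hNp hg hB).add iP') (fun t _ => ?_)
      measurableSet_Ioi
    simp only [Pi.add_apply, hsplit]
    ring
  simp_rw [hsplit]
  rw [integral_sub iS iP', ← hsum, ← vP, hswap]
  simp_rw [integral_const_mul]

end

/-! ### Mellin integrals of Bose kernels and the functional equation -/

section

open MeasureTheory

lemma norm_pow_mul_cexp_neg_mul (K : ℕ) (r : ℂ) {t : ℝ} (ht : 0 < t) :
    ‖(t : ℂ) ^ K * Complex.exp (-(r * t))‖ = t ^ K * Real.exp (-t * r.re) := by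
  rw [norm_mul, norm_pow, Complex.norm_exp, Complex.norm_of_nonneg ht.le]
  congr 2
  simp
  ring

lemma integrableOn_pow_mul_cexp_neg_mul (K : ℕ) {r : ℂ} (hr : 0 < r.re) :
    IntegrableOn (fun t : ℝ => (t : ℂ) ^ K * Complex.exp (-(r * t))) (Set.Ioi 0) := by
  refine (integrableOn_pow_mul_exp_neg_mul K hr).mono'
    (by fun_prop : Continuous _).aestronglyMeasurable ?_
  refine (ae_restrict_iff' measurableSet_Ioi).mpr (Filter.Eventually.of_forall fun t ht => ?_)
  exact (norm_pow_mul_cexp_neg_mul K r ht).le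

lemma integral_pow_mul_cexp_neg_mul (K : ℕ) {r : ℂ} (hr : 0 < r.re) :
    ∫ t in Set.Ioi (0 : ℝ), (t : ℂ) ^ K * Complex.exp (-(r * t)) = K ! / r ^ (K + 1) := by
  have hr0 : r ≠ 0 := by rintro rfl; simp at hr
  induction K with
  | zero =>
    have := integral_exp_mul_complex_Ioi (a := -r) (by simpa using hr) 0
    simp only [neg_mul] at this
    simp [this]
  | succ K ih =>
    have hu : ∀ t ∈ Set.Ioi (0 : ℝ), HasDerivAt (fun t : ℝ => (t : ℂ) ^ (K + 1))
        (((K + 1 : ℕ) : ℂ) * (t : ℂ) ^ K) t := fun t _ => by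
      simpa using (hasDerivAt_pow (K + 1) (t : ℂ)).comp_ofReal
    have hv : ∀ t ∈ Set.Ioi (0 : ℝ), HasDerivAt (fun t : ℝ => -(1 / r) * Complex.exp (-(r * t)))
        (Complex.exp (-(r * t))) t := fun t _ => by
      have h1 : HasDerivAt (fun z : ℂ => -(1 / r) * Complex.exp (-(r * z)))
          (-(1 / r) * (Complex.exp (-(r * t)) * (-(r * 1)))) t :=
        ((((hasDerivAt_id (t : ℂ)).const_mul r).fun_neg).cexp).const_mul _
      refine h1.comp_ofReal.congr_deriv ?_
      field_simp
    have i1 := integrableOn_pow_mul_cexp_neg_mul (K + 1) hr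
    have i2 : IntegrableOn ((fun t : ℝ => ((K + 1 : ℕ) : ℂ) * (t : ℂ) ^ K) *
        fun t : ℝ => -(1 / r) * Complex.exp (-(r * t))) (Set.Ioi 0) := by
      refine IntegrableOn.congr_fun ((integrableOn_pow_mul_cexp_neg_mul K hr).const_mul
        (-((K + 1 : ℕ) : ℂ) / r)) (fun t _ => ?_) measurableSet_Ioi
      simp only [Pi.mul_apply]
      ring
    have l0 : Filter.Tendsto ((fun t : ℝ => (t : ℂ) ^ (K + 1)) *
        fun t : ℝ => -(1 / r) * Complex.exp (-(r * t))) (nhdsWithin 0 (Set.Ioi 0)) (nhds 0) := by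
      have h1 : Continuous ((fun t : ℝ => (t : ℂ) ^ (K + 1)) *
        fun t : ℝ => -(1 / r) * Complex.exp (-(r * t))) := by fun_prop
      have h2 := h1.tendsto 0
      simp only [Pi.mul_apply, Complex.ofReal_zero, zero_pow (Nat.succ_ne_zero K), zero_mul] at h2
      exact h2.mono_left nhdsWithin_le_nhds
    have l1 : Filter.Tendsto ((fun t : ℝ => (t : ℂ) ^ (K + 1)) *
        fun t : ℝ => -(1 / r) * Complex.exp (-(r * t))) Filter.atTop (nhds 0) := by
      have h1 := (tendsto_rpow_mul_exp_neg_mul_atTop_nhds_zero (K + 1 : ℕ) r.re hr).const_mul ‖1 / r‖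
      rw [mul_zero] at h1
      refine squeeze_zero_norm' ?_ h1
      filter_upwards [Filter.eventually_gt_atTop 0] with t ht
      rw [Pi.mul_apply, mul_left_comm, norm_mul, norm_neg, norm_pow_mul_cexp_neg_mul _ _ ht,
        Real.rpow_natCast]
      apply le_of_eq
      ring_nf
    have key := integral_Ioi_mul_deriv_eq_deriv_mul hu hv i1 i2 l0 l1
    rw [key]
    have e : ∀ t : ℝ, ((K + 1 : ℕ) : ℂ) * (t : ℂ) ^ K * (-(1 / r) * Complex.exp (-(r * t))) =
        (-((K + 1 : ℕ) : ℂ) / r) * ((t : ℂ) ^ K * Complex.exp (-(r * t))) := fun t => by ring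
    simp_rw [e]
    rw [integral_const_mul, ih, Nat.factorial_succ]
    push_cast
    field_simp
    ring

lemma pow_div_factorial_le_exp_sub_one {x : ℝ} (hx : 0 ≤ x) {A : ℕ} (hA : A ≠ 0) :
    x ^ A / A ! ≤ Real.exp x - 1 := by
  have h := Real.sum_le_exp_of_nonneg hx (A + 1)
  rw [Finset.sum_range_succ] at h
  have h1 : (1 : ℝ) ≤ ∑ i ∈ Finset.range A, x ^ i / i ! := by
    have := Finset.single_le_sum (f := fun i : ℕ => x ^ i / (i ! : ℝ)) (s := Finset.range A)
      (fun i _ => by positivity) (Finset.mem_range.mpr (Nat.pos_of_ne_zero hA))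
    simpa using this
  linarith

/-- Since |e^z - 1| ≥ e^{Re z} - 1, a single Taylor term gives decay of any positive order A; A is
chosen freely where this is used. -/
lemma norm_one_div_exp_sub_one_le {z : ℂ} (hz : 0 < z.re) {A : ℕ} (hA : A ≠ 0) :
    ‖1 / (Complex.exp z - 1)‖ ≤ A ! / z.re ^ A := by
  have h1 : Real.exp z.re - 1 ≤ ‖Complex.exp z - 1‖ := by
    have := norm_sub_norm_le (Complex.exp z) 1
    rwa [Complex.norm_exp, norm_one] at this
  have h2 := (pow_div_factorial_le_exp_sub_one hz.le hA).trans h1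
  have h3 : 0 < z.re ^ A / (A ! : ℝ) := by positivity
  rw [norm_div, norm_one, one_div, ← inv_div (z.re ^ A) (A ! : ℝ)]
  exact inv_anti₀ h3 h2

lemma integrableOn_pow_mul_one_div_exp_sub_one {K : ℕ} (hK : K ≠ 0) {e : ℂ} (he : 0 < e.re) :
    IntegrableOn (fun y : ℝ => (y : ℂ) ^ K * (1 / (Complex.exp (e * y) - 1))) (Set.Ioi 0) := by
  have hre : ∀ y : ℝ, (e * y).re = e.re * y := fun y => by simp
  have hb : ∀ {A : ℕ}, A ≠ 0 → ∀ y : ℝ, 0 < y →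
      ‖(y : ℂ) ^ K * (1 / (Complex.exp (e * y) - 1))‖ ≤ y ^ K * (A ! / (e.re * y) ^ A) := by
    intro A hA y hy
    rw [norm_mul, norm_pow, Complex.norm_of_nonneg hy.le, ← hre]
    exact mul_le_mul_of_nonneg_left (norm_one_div_exp_sub_one_le (by rw [hre]; positivity) hA)
      (by positivity)
  have hm : ContinuousOn (fun y : ℝ => (y : ℂ) ^ K * (1 / (Complex.exp (e * y) - 1))) (Set.Ioi 0) := by
    refine ContinuousOn.mul (by fun_prop) (ContinuousOn.div (by fun_prop) (by fun_prop) fun y hy => ?_)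
    exact sub_ne_zero.mpr (exp_ne_one_of_re_pos (by rw [hre]; exact mul_pos he hy))
  rw [← Set.Ioc_union_Ioi_eq_Ioi (zero_le_one (α := ℝ)), integrableOn_union]
  constructor
  · refine Integrable.mono' (g := fun _ => 1 / e.re) (integrableOn_const (by simp))
      ((hm.mono Set.Ioc_subset_Ioi_self).aestronglyMeasurable measurableSet_Ioc) ?_
    refine (ae_restrict_iff' measurableSet_Ioc).mpr (Filter.Eventually.of_forall fun y hy => ?_)
    -- Order A = 1 matches the simple pole at 0, which y^K absorbs since K ≥ 1; on y > 1 the order K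
    -- + 2 leaves y^{-2}.
    refine (hb one_ne_zero y hy.1).trans ?_
    have hy0 : 0 < y := hy.1
    rw [pow_one, Nat.factorial_one, Nat.cast_one, mul_one_div,
      div_le_div_iff₀ (by positivity) (by positivity), one_mul, mul_comm]
    have : y ^ K ≤ y ^ 1 := pow_le_pow_of_le_one hy0.le hy.2 (by omega)
    rw [pow_one] at this
    gcongr
  · have h1 : IntegrableOn (fun y : ℝ => y ^ (-2 : ℝ)) (Set.Ioi 1) :=
      integrableOn_Ioi_rpow_of_lt (by norm_num) one_pos
    refine Integrable.mono' (h1.const_mul ((K + 2)! / e.re ^ (K + 2)))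
      ((hm.mono (Set.Ioi_subset_Ioi zero_le_one)).aestronglyMeasurable measurableSet_Ioi) ?_
    refine (ae_restrict_iff' measurableSet_Ioi).mpr (Filter.Eventually.of_forall fun y hy => ?_)
    have hy1 : (1 : ℝ) < y := hy
    have hy0 : 0 < y := by linarith
    refine (hb (A := K + 2) (by omega) y hy0).trans (le_of_eq ?_)
    rw [Real.rpow_neg hy0.le, mul_pow, pow_add y]
    norm_cast
    field_simp

lemma hasSum_exp_neg_nat_mul {z : ℂ} (hz : 0 < z.re) :
    HasSum (fun n : ℕ+ => Complex.exp (-(n * z))) (1 / (Complex.exp z - 1)) := by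
  have h1 : ‖Complex.exp (-z)‖ < 1 := by
    rw [Complex.norm_exp, Real.exp_lt_one_iff]; simpa using hz
  have h2 := (hasSum_geometric_of_norm_lt_one h1).mul_left (Complex.exp (-z))
  have h3 : (fun n : ℕ => Complex.exp (-z) * Complex.exp (-z) ^ n) =
      fun n : ℕ => (fun k : ℕ => Complex.exp (-(k * z))) (n + 1) := by
    funext n
    simp only
    rw [← pow_succ', ← Complex.exp_nat_mul, mul_neg]
  rw [h3] at h2
  have h4 := (hasSum_pnat_iff_hasSum_succ (f := fun k : ℕ => Complex.exp (-(k * z)))).mpr h2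
  have h5 : Complex.exp z - 1 ≠ 0 := sub_ne_zero.mpr (exp_ne_one_of_re_pos hz)
  have h6 : 1 / (Complex.exp z - 1) = Complex.exp (-z) * (1 - Complex.exp (-z))⁻¹ := by
    have h7 : 1 - Complex.exp (-z) = Complex.exp (-z) * (Complex.exp z - 1) := by
      rw [mul_sub, ← Complex.exp_add]; simp
    have := Complex.exp_ne_zero (-z)
    rw [h7]
    field_simp
  rw [h6]
  exact h4

lemma zeta_nat_eq_tsum_pnat {k : ℕ} (hk : 1 < k) :
    riemannZeta k = ∑' n : ℕ+, 1 / (n : ℂ) ^ k := by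
  rw [zeta_nat_eq_tsum_of_gt_one hk, tsum_pnat_eq_tsum_of_eq_zero (f := fun n : ℕ => 1 / (n : ℂ) ^ k)]
  simp; omega

/-- Expand the kernel as the geometric series of exp(-ney) and integrate termwise; no contour
rotation is needed, since each exponential integral is known for complex e with positive real part.
-/
lemma integral_pow_mul_one_div_exp_sub_one {K : ℕ} (hK : K ≠ 0) {e : ℂ} (he : 0 < e.re) :
    ∫ y in Set.Ioi (0 : ℝ), (y : ℂ) ^ K * (1 / (Complex.exp (e * y) - 1)) =
      K ! * riemannZeta (K + 1 : ℕ) / e ^ (K + 1) := by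
  have hre : ∀ n : ℕ+, 0 < ((n : ℂ) * e).re := fun n => by
    have : ((n : ℂ) * e).re = n * e.re := by simp
    rw [this]
    positivity
  have h1 : Summable fun n : ℕ+ => ∫ y in Set.Ioi (0 : ℝ),
      ‖(y : ℂ) ^ K * Complex.exp (-((n : ℂ) * e * y))‖ := by
    have h2 : Summable fun n : ℕ+ => K ! / e.re ^ (K + 1) * (1 / (n : ℝ) ^ (K + 1)) :=
      ((Real.summable_one_div_nat_pow.mpr (by omega : 1 < K + 1)).comp_injective
        PNat.coe_injective).mul_left _
    refine h2.congr fun n => ?_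
    rw [setIntegral_congr_fun measurableSet_Ioi (fun y hy => norm_pow_mul_cexp_neg_mul K _ hy),
      integral_pow_mul_exp_neg_mul K (hre n)]
    have : ((n : ℂ) * e).re = n * e.re := by simp
    rw [this, mul_pow]
    field_simp
  have h3 := (hasSum_integral_of_summable_integral_norm
    (fun n => integrableOn_pow_mul_cexp_neg_mul K (hre n)) h1).tsum_eq
  have h4 : ∫ y in Set.Ioi (0 : ℝ), ∑' n : ℕ+, (y : ℂ) ^ K * Complex.exp (-((n : ℂ) * e * y)) =
      ∫ y in Set.Ioi (0 : ℝ), (y : ℂ) ^ K * (1 / (Complex.exp (e * y) - 1)) := by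
    refine setIntegral_congr_fun measurableSet_Ioi fun y hy => ?_
    rw [tsum_mul_left]
    congr 1
    have : (e * y).re = e.re * y := by simp
    rw [← (hasSum_exp_neg_nat_mul (by rw [this]; exact mul_pos he hy)).tsum_eq]
    simp_rw [mul_assoc]
  rw [← h4, ← h3]
  simp_rw [integral_pow_mul_cexp_neg_mul K (hre _)]
  rw [zeta_nat_eq_tsum_pnat (by omega), mul_div_assoc, ← tsum_div_const, ← tsum_mul_left]
  congr 1; funext n
  rw [mul_pow]
  field_simp

lemma riemannZeta_one_sub_two_mul {q : ℕ} (hq : q ≠ 0) :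
    riemannZeta (1 - 2 * q) =
      2 * (-1) ^ q * (2 * q - 1)! * riemannZeta (2 * q : ℕ) / (2 * Real.pi) ^ (2 * q) := by
  have h := riemannZeta_one_sub (s := (2 * q : ℕ))
    (fun n hn => by
      have : (((2 * q : ℕ) + n : ℕ) : ℂ) = 0 := by push_cast at hn ⊢; rw [hn]; ring
      have := Nat.cast_eq_zero.mp this
      omega)
    (fun h1 => by
      have : 2 * q = 1 := by exact_mod_cast h1
      omega)
  have hc : Complex.cos (Real.pi * (2 * q : ℕ) / 2) = (-1) ^ q := by
    rw [show (Real.pi : ℂ) * (2 * q : ℕ) / 2 = ((q * Real.pi : ℝ) : ℂ) by push_cast; ring,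
      ← Complex.ofReal_cos, Real.cos_nat_mul_pi]
    norm_cast
  obtain ⟨r, rfl⟩ : ∃ r, q = r + 1 := ⟨q - 1, by omega⟩
  rw [hc, Complex.cpow_neg, Complex.cpow_natCast,
    show ((2 * (r + 1) : ℕ) : ℂ) = ((2 * r + 1 : ℕ) : ℂ) + 1 by push_cast; ring,
    Complex.Gamma_nat_eq_factorial] at h
  rw [show (1 : ℂ) - 2 * ((r + 1 : ℕ) : ℂ) = 1 - (((2 * r + 1 : ℕ) : ℂ) + 1) by push_cast; ring, h,
    show 2 * (r + 1) - 1 = 2 * r + 1 by omega]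
  push_cast
  ring_nf

end

/-! ### Laplace and Mellin transforms expressed through `altBose` -/

section

open MeasureTheory

lemma altBose_zero (d : ℝ) : altBose 0 d = 1 / (Complex.exp (2 * Real.pi * d) - 1) := by
  simp [altBose, oddUnit]

lemma integral_exp_mul_psi_comp_mul (h : ℕ) {a d : ℝ} (ha : 0 < a) (hd : 0 < d) :
    ((∫ t in Set.Ioi (0 : ℝ), Real.exp (-t * (a * d ^ (2 * (2 * h + 1)))) *
        psi (2 * h + 1) (2 * h) (a * t) : ℝ) : ℂ) =
      Real.pi / (a * (2 * h + 1 : ℕ) * (d : ℂ) ^ (2 * h + 1)) * altBose h d := by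
  have h1 := integral_comp_mul_left_Ioi
    (fun s => Real.exp (-s * d ^ (2 * (2 * h + 1))) * psi (2 * h + 1) (2 * h) s) 0 ha
  rw [mul_zero] at h1
  have h2 : ∀ t : ℝ, Real.exp (-t * (a * d ^ (2 * (2 * h + 1)))) = 
      Real.exp (-(a * t) * d ^ (2 * (2 * h + 1))) := fun t => by ring_nf
  simp_rw [h2]
  rw [h1, smul_eq_mul, Complex.ofReal_mul, integral_exp_mul_psi_eq_altBose h hd]
  push_cast
  have : (a : ℂ) ≠ 0 := by exact_mod_cast ha.ne'
  field_simp

lemma integral_pow_mul_altBose (h : ℕ) {K : ℕ} (hK : K ≠ 0) {b : ℝ} (hb : 0 < b) :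
    ∫ y in Set.Ioi (0 : ℝ), (y : ℂ) ^ K * altBose h (b * y) =
      K ! * riemannZeta (K + 1 : ℕ) / (2 * Real.pi * b) ^ (K + 1) *
        ((-1) ^ h * ∑ j ∈ Finset.Icc (-(h : ℤ)) h, (-1 : ℂ) ^ j * (1 / oddUnit h j ^ (K + 1))) := by
  have hre : ∀ j ∈ Finset.Icc (-(h : ℤ)) h, 0 < (2 * Real.pi * b * oddUnit h j).re := by
    intro j hj
    have : (2 * Real.pi * b * oddUnit h j).re = 2 * Real.pi * b * (oddUnit h j).re := by
      rw [← Complex.re_ofReal_mul]; push_cast; rfl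
    rw [this]
    have := oddUnit_re_pos hj
    have := Real.pi_pos
    positivity
  have e : ∀ y : ℝ, (y : ℂ) ^ K * altBose h (b * y) =
      ∑ j ∈ Finset.Icc (-(h : ℤ)) h, ((-1) ^ h * (-1 : ℂ) ^ j) *
        ((y : ℂ) ^ K * (1 / (Complex.exp ((2 * Real.pi * b * oddUnit h j) * y) - 1))) := by
    intro y
    rw [altBose, Finset.mul_sum, Finset.mul_sum]
    refine Finset.sum_congr rfl fun j _ => ?_
    rw [show 2 * (Real.pi : ℂ) * (((b * y : ℝ) : ℂ) * oddUnit h j) =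
      (2 * Real.pi * b * oddUnit h j) * y by push_cast; ring]
    ring
  simp_rw [e]
  rw [integral_finsetSum _ fun j hj =>
    (integrableOn_pow_mul_one_div_exp_sub_one hK (hre j hj)).const_mul _, Finset.mul_sum,
    Finset.mul_sum]
  refine Finset.sum_congr rfl fun j hj => ?_
  rw [integral_const_mul, integral_pow_mul_one_div_exp_sub_one hK (hre j hj), mul_pow]
  field_simp

/-- The substitution s = y^N reduces to a Mellin integral giving ζ(2M), and the functional equation
converts it to ζ(1-2M). This is how the left-hand Lambert series produces the zeta term of the
right-hand side. -/
lemma integral_pow_mul_altBose_zero_pow {N M : ℕ} (hN : 0 < N) (hM : 0 < M) {c : ℝ} (hc : 0 < c) :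
    ∫ y in Set.Ioi (0 : ℝ), (y : ℂ) ^ (2 * N * M - 1) * altBose 0 (y ^ N / c) =
      1 / N * ((-(c : ℂ) ^ 2) ^ M * (1 / 2 * riemannZeta (1 - 2 * M))) := by
  have h1 := integral_comp_rpow_Ioi_of_pos (p := (N : ℝ))
    (g := fun s : ℝ => (1 / N : ℂ) * ((s : ℂ) ^ (2 * M - 1) * altBose 0 (c⁻¹ * s)))
    (by exact_mod_cast hN)
  have hN' : (N : ℂ) ≠ 0 := by exact_mod_cast hN.ne'
  have hc' : (c : ℂ) ≠ 0 := by exact_mod_cast hc.ne'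
  rw [integral_const_mul, integral_pow_mul_altBose 0 (by omega) (inv_pos.mpr hc)] at h1
  have h2 : ∫ y in Set.Ioi (0 : ℝ), (y : ℂ) ^ (2 * N * M - 1) * altBose 0 (y ^ N / c) =
      ∫ x in Set.Ioi (0 : ℝ), ((N : ℝ) * x ^ ((N : ℝ) - 1)) •
        ((1 / N : ℂ) * (((x ^ (N : ℝ) : ℝ) : ℂ) ^ (2 * M - 1) * altBose 0 (c⁻¹ * x ^ (N : ℝ)))) := by
    refine setIntegral_congr_fun measurableSet_Ioi fun x hx => ?_
    have hx0 : (0 : ℝ) < x := hx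
    have e1 : x ^ ((N : ℝ) - 1) = x ^ (N - 1) := by
      rw [← Real.rpow_natCast, Nat.cast_sub hN, Nat.cast_one]
    have e2 : 2 * N * M - 1 = (N - 1) + N * (2 * M - 1) := by
      obtain ⟨m, rfl⟩ : ∃ m, M = m + 1 := ⟨M - 1, by omega⟩
      obtain ⟨n, rfl⟩ : ∃ n, N = n + 1 := ⟨N - 1, by omega⟩
      rw [show 2 * (m + 1) - 1 = 2 * m + 1 by omega, Nat.add_sub_cancel]
      rw [show 2 * (n + 1) * (m + 1) = (n + (n + 1) * (2 * m + 1)) + 1 by ring, Nat.add_sub_cancel]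
    simp only [e1, Real.rpow_natCast, Complex.real_smul]
    rw [e2, pow_add, pow_mul, inv_mul_eq_div]
    push_cast
    field_simp
  rw [h2, h1, riemannZeta_one_sub_two_mul (by omega : M ≠ 0), show 2 * M - 1 + 1 = 2 * M by omega]
  have hsum : ((-1 : ℂ) ^ 0 * ∑ j ∈ Finset.Icc (-((0 : ℕ) : ℤ)) (0 : ℕ), (-1 : ℂ) ^ j *
      (1 / oddUnit 0 j ^ (2 * M))) = 1 := by simp [oddUnit]
  rw [hsum, neg_pow ((c : ℂ) ^ 2), ← pow_mul]
  have hh := neg_one_pow_mul_self' M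
  generalize ((2 * M - 1)! : ℂ) = F
  generalize riemannZeta _ = Z
  push_cast
  rw [mul_pow, inv_pow]
  field_simp
  linear_combination (-F * Z) * hh

/-- The substitution y = x^N turns the root into a linear argument and the exponent into 2NM - 1,
giving ζ(2NM) and then ζ(1-2NM), the zeta term of the left-hand side. -/
lemma integral_pow_mul_altBose_rpow (h : ℕ) {M : ℕ} (hM : 0 < M) {c : ℝ} (hc : 0 < c) :
    ∫ y in Set.Ioi (0 : ℝ), (y : ℂ) ^ (2 * M - 1) * altBose h ((c * y) ^ (1 / (2 * h + 1 : ℕ) : ℝ)) =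
      (2 * h + 1 : ℕ) * (1 / (-(c : ℂ) ^ 2) ^ M * (1 / 2 * riemannZeta (1 - 2 * ((2 * h + 1 : ℕ) * M : ℕ)))) := by
  set N := 2 * h + 1 with hN
  have hNpos : 0 < N := by omega
  have hNr : (0 : ℝ) < N := by exact_mod_cast hNpos
  have hc' : (c : ℂ) ≠ 0 := by exact_mod_cast hc.ne'
  set b : ℝ := c ^ (1 / N : ℝ) with hb
  have hb0 : 0 < b := Real.rpow_pos_of_pos hc _
  have hbN : b ^ N = c := by
    rw [hb, ← Real.rpow_natCast, ← Real.rpow_mul hc.le, one_div, inv_mul_cancel₀ hNr.ne', Real.rpow_one]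
  have h1 := integral_comp_rpow_Ioi_of_pos (p := (N : ℝ))
    (g := fun y : ℝ => (y : ℂ) ^ (2 * M - 1) * altBose h ((c * y) ^ (1 / N : ℝ))) hNr
  have h2 : ∫ x in Set.Ioi (0 : ℝ), ((N : ℝ) * x ^ ((N : ℝ) - 1)) •
        (((x ^ (N : ℝ) : ℝ) : ℂ) ^ (2 * M - 1) * altBose h ((c * x ^ (N : ℝ)) ^ (1 / N : ℝ))) =
      ∫ x in Set.Ioi (0 : ℝ), (N : ℂ) * ((x : ℂ) ^ (2 * N * M - 1) * altBose h (b * x)) := by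
    refine setIntegral_congr_fun measurableSet_Ioi fun x hx => ?_
    have hx0 : (0 : ℝ) < x := hx
    have e1 : x ^ ((N : ℝ) - 1) = x ^ (N - 1) := by
      rw [← Real.rpow_natCast, Nat.cast_sub hNpos, Nat.cast_one]
    have e2 : 2 * N * M - 1 = (N - 1) + N * (2 * M - 1) := by
      obtain ⟨m, rfl⟩ : ∃ m, M = m + 1 := ⟨M - 1, by omega⟩
      rw [show 2 * (m + 1) - 1 = 2 * m + 1 by omega]
      have : 2 * N * (m + 1) = N + N * (2 * m + 1) := by ring
      omega
    have e3 : (c * x ^ N) ^ (1 / N : ℝ) = b * x := by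
      rw [Real.mul_rpow hc.le (by positivity), ← Real.rpow_natCast x, ← Real.rpow_mul hx0.le,
        one_div, mul_inv_cancel₀ hNr.ne', Real.rpow_one, hb, one_div]
    simp only [e1, Real.rpow_natCast, Complex.real_smul, e3]
    rw [e2, pow_add, pow_mul]
    push_cast
    ring
  rw [← h1, h2, integral_const_mul]
  have hNM : 0 < N * M := Nat.mul_pos hNpos hM
  rw [mul_assoc 2 N M, integral_pow_mul_altBose h (by omega) hb0,
    riemannZeta_one_sub_two_mul hNM.ne', show 2 * (N * M) - 1 + 1 = 2 * (N * M) by omega]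
  -- The exponent 2NM is an even multiple of N, so all phases become 1 and only the alternating sum
  -- of signs remains.
  have e4 : ∀ j : ℤ, oddUnit h j ^ (2 * (N * M)) = 1 := by
    intro j
    rw [show 2 * (N * M) = N * (M * 2) by ring, pow_mul, hN, oddUnit_pow, mul_comm, pow_mul, sq,
      neg_one_zpow_mul_self, one_pow]
  simp_rw [e4]
  simp only [div_one, mul_one]
  rw [sum_Icc_neg_one_zpow, neg_one_pow_mul_self', mul_one]
  have e5 : (b : ℂ) ^ (2 * (N * M)) = (c : ℂ) ^ (2 * M) := by
    rw [show 2 * (N * M) = N * (2 * M) by ring, pow_mul, ← hbN]; push_cast; rfl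
  have e6 : (-1 : ℂ) ^ (N * M) = (-1) ^ M := by
    rw [pow_mul, (by rw [hN]; simp : Odd N).neg_one_pow]
  rw [mul_pow, e5, e6, neg_pow ((c : ℂ) ^ 2), ← pow_mul]
  have hh := neg_one_pow_mul_self' M
  have hs : ((-1 : ℂ) ^ M)⁻¹ = (-1) ^ M := inv_eq_of_mul_eq_one_right hh
  rw [one_div ((-1 : ℂ) ^ M * _), mul_inv, hs]
  generalize ((2 * (N * M) - 1)! : ℂ) = F
  generalize riemannZeta _ = Z
  field_simp
  linear_combination (-(N : ℂ) * F * Z) * hh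

end

/-! ### The transformation formula for negative index -/

section

open MeasureTheory

lemma laplace_psi_one (N : ℕ) {c y : ℝ} (hc : 0 < c) (hy : 0 < y) :
    ((∫ t in Set.Ioi (0 : ℝ), Real.exp (-t * y ^ (2 * N)) * psi 1 0 (c ^ 2 * t) : ℝ) : ℂ) =
      Real.pi / (c * (y : ℂ) ^ N) * altBose 0 (y ^ N / c) := by
  have h := integral_exp_mul_psi_comp_mul 0 (a := c ^ 2) (d := y ^ N / c) (by positivity) (by positivity)
  have e : c ^ 2 * (y ^ N / c) ^ (2 * (2 * 0 + 1)) = y ^ (2 * N) := by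
    change c ^ 2 * (y ^ N / c) ^ 2 = y ^ (2 * N)
    rw [div_pow, ← pow_mul, mul_comm N 2]
    field_simp
  rw [e] at h
  simp only [mul_zero, zero_add] at h
  rw [h]
  have hc' : (c : ℂ) ≠ 0 := by exact_mod_cast hc.ne'
  congr 1
  push_cast
  field_simp

lemma rpow_one_div_pow {x : ℝ} (hx : 0 ≤ x) {N : ℕ} (hN : N ≠ 0) : (x ^ (1 / N : ℝ)) ^ N = x := by
  rw [one_div, Real.rpow_inv_natCast_pow hx hN]

lemma laplace_psi_odd (h : ℕ) {c y : ℝ} (hc : 0 < c) (hy : 0 < y) :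
    ((∫ t in Set.Ioi (0 : ℝ), Real.exp (-t * y ^ (2 * 1)) *
        psi (2 * h + 1) (2 * h) ((c ^ 2)⁻¹ * t) : ℝ) : ℂ) =
      Real.pi * c / ((2 * h + 1 : ℕ) * (y : ℂ)) * altBose h ((c * y) ^ (1 / (2 * h + 1 : ℕ) : ℝ)) := by
  have hcy : 0 < c * y := by positivity
  have hd := rpow_one_div_pow hcy.le (N := 2 * h + 1) (by omega)
  have h1 := integral_exp_mul_psi_comp_mul h (a := (c ^ 2)⁻¹)
    (d := (c * y) ^ (1 / (2 * h + 1 : ℕ) : ℝ)) (by positivity) (by positivity)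
  have hd2 : (((c * y) ^ (1 / (2 * h + 1 : ℕ) : ℝ) : ℝ) : ℂ) ^ (2 * h + 1) = c * y := by
    rw [← Complex.ofReal_pow, hd, Complex.ofReal_mul]
  have e : (c ^ 2)⁻¹ * ((c * y) ^ (1 / (2 * h + 1 : ℕ) : ℝ)) ^ (2 * (2 * h + 1)) = y ^ (2 * 1) := by
    rw [mul_comm 2 (2 * h + 1), pow_mul, hd]
    field_simp
  rw [e, hd2] at h1
  rw [h1]
  have hc' : (c : ℂ) ≠ 0 := by exact_mod_cast hc.ne'
  have hy' : (y : ℂ) ≠ 0 := by exact_mod_cast hy.ne'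
  have hN : ((2 * h + 1 : ℕ) : ℂ) ≠ 0 := by exact_mod_cast (by omega : 2 * h + 1 ≠ 0)
  congr 1
  push_cast at hN ⊢
  field_simp

lemma integral_psi_mul_psi_comp {N L p q : ℕ} (hN : 0 < N) (hL : 0 < L) (hp : Even p) (hq : Even q)
    (hNp : 2 * N ≤ p) {a : ℝ} (ha : 0 < a) :
    ∫ t in Set.Ioi (0 : ℝ), psi N p t * psi L q (a * t) =
      (∑' n : ℕ+, (n : ℝ) ^ p * ∫ t in Set.Ioi (0 : ℝ),
        Real.exp (-t * (n : ℝ) ^ (2 * N)) * psi L q (a * t)) -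
      ∫ y in Set.Ioi (0 : ℝ), y ^ p * ∫ t in Set.Ioi (0 : ℝ),
        Real.exp (-t * y ^ (2 * N)) * psi L q (a * t) := by
  obtain ⟨B, hB0, hB⟩ := exists_psi_bound hL hq
  obtain ⟨C, hC0, hC⟩ := exists_psi_le_pow' hL hq p
  -- Vanishing to order K = p suffices, because p + 2 ≤ 2N(p + 1).
  refine integral_psi_mul_eq_tsum_sub_integral hN (K := p) (B := B) (C := C * a ^ p) hp hNp
    ?_ ?_ (fun t ht => hB _ (mul_pos ha ht)) fun t ht => ?_
  · nlinarith
  · exact (continuousOn_psi hL q).comp (by fun_prop) fun t ht => mul_pos ha ht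
  · have := hC _ (mul_pos ha ht)
    rwa [mul_pow, ← mul_assoc] at this

/-- Both integrals in `integral_psi_mul_psi_swap` are evaluated, each as a Lambert series minus the
zeta term of the other side; moving the zeta terms across gives the formula. The boundary value 1/4
becomes the last term. -/
lemma lambert_transformation_neg (h : ℕ) {M : ℕ} (hM : 0 < M) {c : ℝ} (hc : 0 < c) :
    ∑' n : ℕ+, (n : ℂ) ^ (2 * (2 * h + 1) * M - 1) * altBose 0 ((n : ℝ) ^ (2 * h + 1) / c) +
        1 / 2 * riemannZeta (1 - 2 * ((2 * h + 1 : ℕ) * M : ℕ)) =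
      (-(c : ℂ) ^ 2) ^ M / (2 * h + 1 : ℕ) *
        (∑' n : ℕ+, (n : ℂ) ^ (2 * M - 1) * altBose h ((c * n) ^ (1 / (2 * h + 1 : ℕ) : ℝ)) +
          1 / 2 * riemannZeta (1 - 2 * M)) -
      (c : ℂ) / Real.pi * (if h = 0 ∧ M = 1 then 1 / 4 else 0) := by
  set N := 2 * h + 1 with hN
  have hNpos : 0 < N := by omega
  have hc' : (c : ℂ) ≠ 0 := by exact_mod_cast hc.ne'
  have hN' : (N : ℂ) ≠ 0 := by exact_mod_cast hNpos.ne'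
  have hpi : (Real.pi : ℂ) ≠ 0 := by exact_mod_cast Real.pi_ne_zero
  have hswap := integral_psi_mul_psi_swap h hM (a := c ^ 2) (by positivity)
  have hpow : 2 * h + 2 * N * M = N + (2 * N * M - 1) := by
    have : 0 < 2 * N * M := by positivity
    omega
  have hX : ((∫ t in Set.Ioi (0 : ℝ), psi N (2 * h + 2 * N * M) t * psi 1 0 (c ^ 2 * t) : ℝ) : ℂ) =
      Real.pi / c * (∑' n : ℕ+, (n : ℂ) ^ (2 * N * M - 1) * altBose 0 ((n : ℝ) ^ N / c) -
        1 / N * ((-(c : ℂ) ^ 2) ^ M * (1 / 2 * riemannZeta (1 - 2 * M)))) := by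
    have hterm : ∀ y : ℝ, 0 < y → ((y ^ (2 * h + 2 * N * M) * ∫ t in Set.Ioi (0 : ℝ),
        Real.exp (-t * y ^ (2 * N)) * psi 1 0 (c ^ 2 * t) : ℝ) : ℂ) =
        Real.pi / c * ((y : ℂ) ^ (2 * N * M - 1) * altBose 0 (y ^ N / c)) := by
      intro y hy
      have hy' : (y : ℂ) ≠ 0 := by exact_mod_cast hy.ne'
      rw [Complex.ofReal_mul, laplace_psi_one N hc hy, hpow, pow_add]
      push_cast
      field_simp
    rw [integral_psi_mul_psi_comp hNpos one_pos
      ((even_two_mul h).add (by rw [mul_assoc]; exact even_two_mul _)) (by simp)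
      (by have : 2 * N * 1 ≤ 2 * N * M := Nat.mul_le_mul_left _ hM
          omega) (by positivity), Complex.ofReal_sub, Complex.ofReal_tsum,
      tsum_congr fun n : ℕ+ => hterm n (by positivity), tsum_mul_left, ← integral_complex_ofReal,
      setIntegral_congr_fun (μ := volume) measurableSet_Ioi fun y hy => hterm y hy,
      integral_const_mul, integral_pow_mul_altBose_zero_pow hNpos hM hc]
    simp only [Complex.ofReal_natCast]
    ring
  have hY : ((∫ t in Set.Ioi (0 : ℝ), psi N (2 * h) t * psi 1 (2 * M) (c ^ 2 * t) : ℝ) : ℂ) =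
      Real.pi / (N * c) * (∑' n : ℕ+, (n : ℂ) ^ (2 * M - 1) * altBose h ((c * n) ^ (1 / N : ℝ)) -
        N * (1 / (-(c : ℂ) ^ 2) ^ M * (1 / 2 * riemannZeta (1 - 2 * (N * M : ℕ))))) := by
    have hterm : ∀ y : ℝ, 0 < y → ((y ^ (2 * M) * ∫ t in Set.Ioi (0 : ℝ),
        Real.exp (-t * y ^ (2 * 1)) * psi N (2 * h) ((c ^ 2)⁻¹ * t) : ℝ) : ℂ) =
        Real.pi * c / N * ((y : ℂ) ^ (2 * M - 1) * altBose h ((c * y) ^ (1 / N : ℝ))) := by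
      intro y hy
      have hy' : (y : ℂ) ≠ 0 := by exact_mod_cast hy.ne'
      rw [Complex.ofReal_mul, laplace_psi_odd h hc hy,
        show 2 * M = 1 + (2 * M - 1) by omega, pow_add, Nat.add_sub_cancel_left, ← hN]
      push_cast
      field_simp
    -- Here the differentiated factor carries the scale c²; rescaling t moves the scale onto the
    -- other factor, whose Laplace transform is known.
    have hsub : ∫ t in Set.Ioi (0 : ℝ), psi N (2 * h) t * psi 1 (2 * M) (c ^ 2 * t) =
        (c ^ 2)⁻¹ * ∫ s in Set.Ioi (0 : ℝ), psi 1 (2 * M) s * psi N (2 * h) ((c ^ 2)⁻¹ * s) := by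
      have h1 := integral_comp_mul_left_Ioi
        (fun s => psi 1 (2 * M) s * psi N (2 * h) ((c ^ 2)⁻¹ * s)) 0 (b := c ^ 2) (by positivity)
      rw [mul_zero, smul_eq_mul] at h1
      rw [← h1]
      congr 1; funext t
      rw [inv_mul_cancel_left₀ (by positivity), mul_comm]
    rw [hsub, Complex.ofReal_mul, integral_psi_mul_psi_comp one_pos hNpos (even_two_mul M)
      (even_two_mul h) (by omega) (by positivity), Complex.ofReal_sub, Complex.ofReal_tsum,
      tsum_congr fun n : ℕ+ => hterm n (by positivity), tsum_mul_left, ← integral_complex_ofReal,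
      setIntegral_congr_fun (μ := volume) measurableSet_Ioi fun y hy => hterm y hy,
      integral_const_mul, integral_pow_mul_altBose_rpow h hM hc]
    simp only [Complex.ofReal_natCast, ← hN]
    push_cast
    field_simp
  have hswap' := congrArg (Complex.ofReal) hswap
  rw [Complex.ofReal_sub, Complex.ofReal_mul, hX, hY] at hswap'
  have hbd : (((if h = 0 ∧ M = 1 then 1 / 4 else 0 : ℝ)) : ℂ) = if h = 0 ∧ M = 1 then 1 / 4 else 0 := by
    split_ifs <;> push_cast <;> ring
  rw [hbd] at hswap'
  push_cast at hswap' ⊢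
  have hq : (-(c : ℂ) ^ 2) ^ M ≠ 0 := pow_ne_zero _ (neg_ne_zero.mpr (pow_ne_zero _ hc'))
  generalize (-(c : ℂ) ^ 2) ^ M = Q at *
  generalize (if h = 0 ∧ M = 1 then (1 / 4 : ℂ) else 0) = E at *
  generalize riemannZeta (1 - 2 * (M : ℂ)) = Z1 at *
  generalize riemannZeta (1 - 2 * ((N : ℂ) * M)) = Z2 at *
  field_simp at hswap' ⊢
  linear_combination hswap'

end

/-! ### Convergence, and the transformation formula for positive index -/

lemma summable_zpow_mul_one_div_exp_sub_one (a : ℤ) {z : ℕ+ → ℂ} {κ : ℝ} (hκ : 0 < κ) {N : ℕ}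
    (hN : N ≠ 0) (hz : ∀ n, 0 < (z n).re) (hz' : ∀ n : ℕ+, κ * n ≤ (z n).re ^ N) :
    Summable fun n : ℕ+ => (n : ℂ) ^ a * (1 / (Complex.exp (z n) - 1)) := by
  -- The kernel is estimated to order NL; as (Re z_n)^N ≥ κn this gives n^{-L}, and the 2 in L
  -- leaves n^{-2} after multiplying by n^a.
  set L : ℕ := a.toNat + 2 with hL
  have hA : N * L ≠ 0 := Nat.mul_ne_zero hN (by omega)
  have h1 : Summable fun n : ℕ+ => (N * L)! / κ ^ L * (1 / (n : ℝ) ^ 2) :=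
    ((Real.summable_one_div_nat_pow.mpr one_lt_two).comp_injective PNat.coe_injective).mul_left _
  refine Summable.of_norm_bounded h1 fun n => ?_
  have hn : (1 : ℝ) ≤ n := by exact_mod_cast n.2
  have hn0 : (0 : ℝ) < n := by linarith
  have h2 := norm_one_div_exp_sub_one_le (hz n) hA
  have h3 : κ ^ L * (n : ℝ) ^ L ≤ (z n).re ^ (N * L) := by
    rw [← mul_pow, pow_mul]
    exact pow_le_pow_left₀ (by positivity) (hz' n) L
  have h4 : (n : ℝ) ^ a ≤ (n : ℝ) ^ a.toNat := by
    rw [← zpow_natCast]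
    exact zpow_le_zpow_right₀ hn (Int.self_le_toNat a)
  rw [norm_mul, norm_zpow, Complex.norm_natCast]
  calc (n : ℝ) ^ a * ‖1 / (Complex.exp (z n) - 1)‖
      ≤ (n : ℝ) ^ a.toNat * ((N * L)! / (κ ^ L * (n : ℝ) ^ L)) := by
        refine mul_le_mul h4 (h2.trans ?_) (norm_nonneg _) (by positivity)
        exact div_le_div_of_nonneg_left (by positivity) (by positivity) h3
    _ = (N * L)! / κ ^ L * (1 / (n : ℝ) ^ 2) := by
        rw [hL, pow_add (n : ℝ)]
        field_simp

lemma summable_zpow_mul_altBose_term (a : ℤ) {h : ℕ} {j : ℤ} (hj : j ∈ Finset.Icc (-(h : ℤ)) h)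
    {N : ℕ} (hN : N ≠ 0) {κ : ℝ} (hκ : 0 < κ) {d : ℕ+ → ℝ} (hd : ∀ n, 0 < d n)
    (hd' : ∀ n : ℕ+, κ * n ≤ d n ^ N) :
    Summable fun n : ℕ+ => (n : ℂ) ^ a *
      (1 / (Complex.exp (2 * Real.pi * (d n * oddUnit h j)) - 1)) := by
  have hp := Real.pi_pos
  have ho := oddUnit_re_pos hj
  have e : ∀ n : ℕ+, (2 * Real.pi * (d n * oddUnit h j)).re = (2 * Real.pi * (oddUnit h j).re) * d n := by
    intro n
    have : 2 * (Real.pi : ℂ) * (d n * oddUnit h j) = ((2 * Real.pi * d n : ℝ) : ℂ) * oddUnit h j := by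
      push_cast; ring
    rw [this, Complex.re_ofReal_mul]
    ring
  refine summable_zpow_mul_one_div_exp_sub_one a (κ := (2 * Real.pi * (oddUnit h j).re) ^ N * κ)
    (by positivity) hN (fun n => ?_) fun n => ?_
  · rw [e]
    have := hd n
    positivity
  · rw [e, mul_pow _ (d n), mul_assoc]
    exact mul_le_mul_of_nonneg_left (hd' n) (by positivity)

lemma summable_zpow_mul_altBose (a : ℤ) (h : ℕ) {N : ℕ} (hN : N ≠ 0) {κ : ℝ} (hκ : 0 < κ)
    {d : ℕ+ → ℝ} (hd : ∀ n, 0 < d n) (hd' : ∀ n : ℕ+, κ * n ≤ d n ^ N) :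
    Summable fun n : ℕ+ => (n : ℂ) ^ a * altBose h (d n) := by
  have := (summable_sum fun j (hj : j ∈ Finset.Icc (-(h : ℤ)) h) =>
    (summable_zpow_mul_altBose_term a hj hN hκ hd hd').mul_left ((-1 : ℂ) ^ j)).mul_left ((-1 : ℂ) ^ h)
  refine this.congr fun n => ?_
  simp only [altBose, Finset.mul_sum]
  exact Finset.sum_congr rfl fun j _ => by ring

lemma summable_one_div_pnat_pow {k : ℕ} (hk : 1 < k) : Summable fun n : ℕ+ => 1 / (n : ℂ) ^ k := by
  have h1 : Summable fun n : ℕ+ => 1 / (n : ℝ) ^ k :=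
    (Real.summable_one_div_nat_pow.mpr hk).comp_injective PNat.coe_injective
  refine Summable.of_norm_bounded h1 fun n => ?_
  rw [norm_div, norm_pow, Complex.norm_natCast, norm_one]

lemma summable_prod_of_norm_le {f : ℕ+ × ℕ+ → ℂ} {C : ℝ}
    (hf : ∀ n k : ℕ+, ‖f (n, k)‖ ≤ C * (1 / (n : ℝ) ^ 2 * (1 / (k : ℝ) ^ 2))) : Summable f := by
  have h1 : Summable fun n : ℕ+ => 1 / (n : ℝ) ^ 2 :=
    (Real.summable_one_div_nat_pow.mpr one_lt_two).comp_injective PNat.coe_injective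
  exact Summable.of_norm_bounded
    ((h1.mul_of_nonneg h1 (fun n => by positivity) fun n => by positivity).mul_left C)
    fun x => hf x.1 x.2

/-- The geometric sum for (u^M - v^M)/(u - v), divided by u^M v^M. It separates the variables, which
the factor 1/(u - v) had coupled. -/
lemma pow_sub_mul_inv (u v : ℂ) (hu : u ≠ 0) (hv : v ≠ 0) (huv : u - v ≠ 0) (M : ℕ) :
    1 / u ^ M / (u - v) - 1 / v ^ M * (1 / (u - v)) =
      -∑ i ∈ Finset.range M, 1 / v ^ (i + 1) * (1 / u ^ (M - i)) := by
  have h := geom_sum₂_mul u v M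
  have e : ∑ i ∈ Finset.range M, 1 / v ^ (i + 1) * (1 / u ^ (M - i)) =
      (∑ i ∈ Finset.range M, u ^ i * v ^ (M - 1 - i)) / (u ^ M * v ^ M) := by
    rw [Finset.sum_div]
    refine Finset.sum_congr rfl fun i hi => ?_
    have hi' := Finset.mem_range.mp hi
    have hu1 : u ^ M = u ^ i * u ^ (M - i) := by rw [← pow_add]; congr 1; omega
    have hv1 : v ^ M = v ^ (i + 1) * v ^ (M - 1 - i) := by rw [← pow_add]; congr 1; omega
    rw [hu1, hv1]
    have := pow_ne_zero i hu
    have := pow_ne_zero (M - 1 - i) hv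
    field_simp
  rw [e]
  have hS : ∑ i ∈ Finset.range M, u ^ i * v ^ (M - 1 - i) = (u ^ M - v ^ M) / (u - v) := by
    rw [eq_div_iff huv, h]
  rw [hS]
  have := pow_ne_zero M hu
  have := pow_ne_zero M hv
  field_simp
  ring

lemma HasSum.mul_of_norm {f g : ℕ+ → ℂ} {a b : ℂ} (hf : HasSum f a) (hg : HasSum g b) :
    HasSum (fun x : ℕ+ × ℕ+ => f x.1 * g x.2) (a * b) :=
  hf.mul hg (summable_mul_of_summable_norm hf.summable.norm hg.summable.norm)

lemma hasSum_one_div_pnat_pow {k : ℕ} (hk : 1 < k) :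
    HasSum (fun n : ℕ+ => 1 / (n : ℂ) ^ k) (riemannZeta k) := by
  rw [zeta_nat_eq_tsum_pnat hk]
  exact (summable_one_div_pnat_pow hk).hasSum

lemma norm_pow_add_mul_sq (N : ℕ) (c : ℝ) (n k : ℕ+) :
    ‖(n : ℂ) ^ (2 * N) + c ^ 2 * (k : ℂ) ^ 2‖ = (n : ℝ) ^ (2 * N) + c ^ 2 * (k : ℝ) ^ 2 := by
  have : (n : ℂ) ^ (2 * N) + c ^ 2 * (k : ℂ) ^ 2 =
      (((n : ℝ) ^ (2 * N) + c ^ 2 * (k : ℝ) ^ 2 : ℝ) : ℂ) := by push_cast; rfl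
  rw [this, Complex.norm_of_nonneg (by positivity)]

lemma summable_lambert_left (h : ℕ) {M : ℕ} (hM : 0 < M) {c : ℝ} (hc : 0 < c) :
     Summable fun x : ℕ+ × ℕ+ => (x.2 : ℂ) ^ (2 * h) / (x.2 : ℂ) ^ (2 * (2 * h + 1) * M) /
    ((x.2 : ℂ) ^ (2 * (2 * h + 1)) + c ^ 2 * (x.1 : ℂ) ^ 2) := by
  refine summable_prod_of_norm_le (C := 1 / c ^ 2) fun k n => ?_
  simp only
  have hn : (1 : ℝ) ≤ n := by exact_mod_cast n.2
  rw [norm_div, norm_div, norm_pow, norm_pow, norm_pow_add_mul_sq, Complex.norm_natCast]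
  have h1 : (n : ℝ) ^ (2 * h) / (n : ℝ) ^ (2 * (2 * h + 1) * M) ≤ 1 / (n : ℝ) ^ 2 := by
    rw [div_le_div_iff₀ (by positivity) (by positivity), ← pow_add, one_mul]
    refine pow_le_pow_right₀ hn ?_
    have : 2 * (2 * h + 1) * 1 ≤ 2 * (2 * h + 1) * M := Nat.mul_le_mul_left _ hM
    omega
  calc _ ≤ 1 / (n : ℝ) ^ 2 / (c ^ 2 * (k : ℝ) ^ 2) := by
        refine div_le_div₀ (by positivity) h1 (by positivity) ?_
        have : 0 ≤ (n : ℝ) ^ (2 * (2 * h + 1)) := by positivity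
        linarith
    _ = _ := by field_simp

lemma summable_lambert_right (h : ℕ) {M : ℕ} (hM : 0 < M) {c : ℝ} (hc : 0 < c) :
     Summable fun x : ℕ+ × ℕ+ => (x.2 : ℂ) ^ (2 * h) / (x.1 : ℂ) ^ (2 * M) /
    ((x.2 : ℂ) ^ (2 * (2 * h + 1)) + c ^ 2 * (x.1 : ℂ) ^ 2) := by
  refine summable_prod_of_norm_le (C := 1) fun k n => ?_
  rw [mul_comm (1 / (k : ℝ) ^ 2)]
  simp only
  have hn : (1 : ℝ) ≤ n := by exact_mod_cast n.2
  have hk : (1 : ℝ) ≤ k := by exact_mod_cast k.2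
  rw [norm_div, norm_div, norm_pow, norm_pow, norm_pow_add_mul_sq, Complex.norm_natCast, Complex.norm_natCast]
  calc (n : ℝ) ^ (2 * h) / (k : ℝ) ^ (2 * M) / ((n : ℝ) ^ (2 * (2 * h + 1)) + c ^ 2 * (k : ℝ) ^ 2)
      ≤ (n : ℝ) ^ (2 * h) / (k : ℝ) ^ 2 / (n : ℝ) ^ (2 * (2 * h + 1)) := by
        refine div_le_div₀ (by positivity) ?_ (by positivity) (by
          have : 0 ≤ c ^ 2 * (k : ℝ) ^ 2 := by positivity
          linarith)
        exact div_le_div_of_nonneg_left (by positivity) (by positivity)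
          (pow_le_pow_right₀ hk (by omega))
    _ = 1 * (1 / (n : ℝ) ^ (2 * h + 2) * (1 / (k : ℝ) ^ 2)) := by
        rw [show 2 * (2 * h + 1) = 2 * h + (2 * h + 2) by ring, pow_add _ (2 * h) (2 * h + 2)]
        field_simp
    _ ≤ _ := by
        gcongr
        · omega

/-- Take u = n^{2N} and v = -c²k², so that u - v is the common kernel denominator, and multiply by
n^{2h}. -/
lemma lambert_term_sub (h M : ℕ) {c : ℝ} (hc : 0 < c) (n k : ℕ+) :
    (n : ℂ) ^ (2 * h) / (n : ℂ) ^ (2 * (2 * h + 1) * M) /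
        ((n : ℂ) ^ (2 * (2 * h + 1)) + c ^ 2 * (k : ℂ) ^ 2) -
      1 / (-(c : ℂ) ^ 2) ^ M * ((n : ℂ) ^ (2 * h) / (k : ℂ) ^ (2 * M) /
        ((n : ℂ) ^ (2 * (2 * h + 1)) + c ^ 2 * (k : ℂ) ^ 2)) =
    -∑ i ∈ Finset.range M, 1 / (-(c : ℂ) ^ 2) ^ (i + 1) * (1 / (k : ℂ) ^ (2 * (i + 1)) *
      (1 / (n : ℂ) ^ (2 * h + 2 + 2 * (2 * h + 1) * (M - 1 - i)))) := by
  set N := 2 * h + 1 with hN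
  have hc' : (c : ℂ) ≠ 0 := by exact_mod_cast hc.ne'
  have hn : (n : ℂ) ≠ 0 := by exact_mod_cast n.ne_zero
  have hk : (k : ℂ) ≠ 0 := by exact_mod_cast k.ne_zero
  have hu : (n : ℂ) ^ (2 * N) ≠ 0 := pow_ne_zero _ hn
  have hv : -(c : ℂ) ^ 2 * (k : ℂ) ^ 2 ≠ 0 :=
    mul_ne_zero (neg_ne_zero.mpr (pow_ne_zero _ hc')) (pow_ne_zero _ hk)
  have huv : (n : ℂ) ^ (2 * N) - (-(c : ℂ) ^ 2 * (k : ℂ) ^ 2) ≠ 0 := by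
    rw [neg_mul, sub_neg_eq_add, ← norm_pos_iff, norm_pow_add_mul_sq]
    positivity
  have key := pow_sub_mul_inv _ _ hu hv huv M
  have key2 := congrArg (fun w => (n : ℂ) ^ (2 * h) * w) key
  beta_reduce at key2
  rw [neg_mul ((c : ℂ) ^ 2), sub_neg_eq_add] at key2
  calc _ = (n : ℂ) ^ (2 * h) * (1 / ((n : ℂ) ^ (2 * N)) ^ M / ((n : ℂ) ^ (2 * N) + c ^ 2 * (k : ℂ) ^ 2) -
        1 / (-((c : ℂ) ^ 2 * (k : ℂ) ^ 2)) ^ M * (1 / ((n : ℂ) ^ (2 * N) + c ^ 2 * (k : ℂ) ^ 2))) := by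
        rw [← pow_mul, ← neg_mul, mul_pow _ ((k : ℂ) ^ 2), ← pow_mul (k : ℂ)]
        field_simp
    _ = _ := by
        rw [key2, mul_neg, Finset.mul_sum]
        congr 1
        refine Finset.sum_congr rfl fun i hi => ?_
        have hi' := Finset.mem_range.mp hi
        rw [← neg_mul, mul_pow _ ((k : ℂ) ^ 2), ← pow_mul (k : ℂ), ← pow_mul]
        have e : (n : ℂ) ^ (2 * N * (M - i)) =
            (n : ℂ) ^ (2 * h) * (n : ℂ) ^ (2 * h + 2 + 2 * N * (M - 1 - i)) := by
          rw [← pow_add]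
          congr 1
          obtain ⟨q, hq⟩ : ∃ q, M - i = q + 1 := ⟨M - i - 1, by omega⟩
          rw [hq, show M - 1 - i = q by omega, hN]
          ring
        rw [e]
        have := pow_ne_zero (2 * h) hn
        field_simp

lemma tsum_tsum_lambert_sub (h : ℕ) {M : ℕ} (hM : 0 < M) {c : ℝ} (hc : 0 < c) :
    (∑' n : ℕ+, ∑' k : ℕ+, (n : ℂ) ^ (2 * h) / (n : ℂ) ^ (2 * (2 * h + 1) * M) /
        ((n : ℂ) ^ (2 * (2 * h + 1)) + c ^ 2 * (k : ℂ) ^ 2)) -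
      1 / (-(c : ℂ) ^ 2) ^ M * ∑' k : ℕ+, ∑' n : ℕ+, (n : ℂ) ^ (2 * h) / (k : ℂ) ^ (2 * M) /
        ((n : ℂ) ^ (2 * (2 * h + 1)) + c ^ 2 * (k : ℂ) ^ 2) =
    -∑ i ∈ Finset.range M, 1 / (-(c : ℂ) ^ 2) ^ (i + 1) * (riemannZeta (2 * (i + 1) : ℕ) *
      riemannZeta (2 * h + 2 + 2 * (2 * h + 1) * (M - 1 - i) : ℕ)) := by
  rw [Summable.tsum_comm (f := fun k n : ℕ+ => (n : ℂ) ^ (2 * h) / (n : ℂ) ^ (2 * (2 * h + 1) * M) /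
      ((n : ℂ) ^ (2 * (2 * h + 1)) + c ^ 2 * (k : ℂ) ^ 2)) (summable_lambert_left h hM hc), ← (summable_lambert_left h hM hc).tsum_prod, ← (summable_lambert_right h hM hc).tsum_prod,
    ← tsum_mul_left, ← (summable_lambert_left h hM hc).tsum_sub ((summable_lambert_right h hM hc).mul_left _)]
  have hzeta : ∀ i ∈ Finset.range M, HasSum (fun x : ℕ+ × ℕ+ => 1 / (-(c : ℂ) ^ 2) ^ (i + 1) *
      (1 / (x.1 : ℂ) ^ (2 * (i + 1)) * (1 / (x.2 : ℂ) ^ (2 * h + 2 + 2 * (2 * h + 1) * (M - 1 - i)))))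
      (1 / (-(c : ℂ) ^ 2) ^ (i + 1) * (riemannZeta (2 * (i + 1) : ℕ) *
      riemannZeta (2 * h + 2 + 2 * (2 * h + 1) * (M - 1 - i) : ℕ))) := by
    intro i _
    exact ((hasSum_one_div_pnat_pow (by omega)).mul_of_norm
      (hasSum_one_div_pnat_pow (by omega))).mul_left _
  rw [← (hasSum_sum hzeta).tsum_eq, ← tsum_neg]
  exact tsum_congr fun x => lambert_term_sub h M hc x.2 x.1

/-- The partial fractions for N = 1 at d = n^N/c. Their polar correction 1/(2d) gives the extra
power of n, which later supplies the term of index 0 in the finite sum. -/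
lemma one_div_pow_mul_altBose_zero (h M : ℕ) {c : ℝ} (hc : 0 < c) (n : ℕ+) :
    1 / (n : ℂ) ^ (2 * (2 * h + 1) * M + 1) * altBose 0 ((n : ℝ) ^ (2 * h + 1) / c) +
        1 / 2 * (1 / (n : ℂ) ^ (2 * (2 * h + 1) * M + 1)) =
      (c : ℂ) / Real.pi * (1 / 2 * (1 / (n : ℂ) ^ (2 * h + 2 + 2 * (2 * h + 1) * M)) +
        ∑' k : ℕ+, (n : ℂ) ^ (2 * h) / (n : ℂ) ^ (2 * (2 * h + 1) * M) /
          ((n : ℂ) ^ (2 * (2 * h + 1)) + c ^ 2 * (k : ℂ) ^ 2)) := by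
  have hn0 : (0 : ℝ) < n := by exact_mod_cast n.pos
  have hn : (n : ℂ) ≠ 0 := by exact_mod_cast n.ne_zero
  have hc' : (c : ℂ) ≠ 0 := by exact_mod_cast hc.ne'
  have hp : (Real.pi : ℂ) ≠ 0 := by exact_mod_cast Real.pi_ne_zero
  have hd : 0 < (n : ℝ) ^ (2 * h + 1) / c := by positivity
  have key := ((hasSum_altBose 0 hd).mul_left
    (1 / (n : ℂ) ^ (2 * (2 * h + 1) * M + 1) / c)).tsum_eq
  have e : ∀ k : ℕ+, 1 / (n : ℂ) ^ (2 * (2 * h + 1) * M + 1) / c *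
      ((2 * 0 + 1 : ℕ) * (((n : ℝ) ^ (2 * h + 1) / c : ℝ) : ℂ) ^ (2 * 0 + 1) * (k : ℂ) ^ (2 * 0) /
        ((k : ℂ) ^ (2 * (2 * 0 + 1)) + (((n : ℝ) ^ (2 * h + 1) / c : ℝ) : ℂ) ^ (2 * (2 * 0 + 1)))) =
      (n : ℂ) ^ (2 * h) / (n : ℂ) ^ (2 * (2 * h + 1) * M) /
          ((n : ℂ) ^ (2 * (2 * h + 1)) + c ^ 2 * (k : ℂ) ^ 2) := by
    intro k
    have hD : (n : ℂ) ^ (2 * (2 * h + 1)) + c ^ 2 * (k : ℂ) ^ 2 ≠ 0 := by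
      rw [← norm_pos_iff, norm_pow_add_mul_sq]
      positivity
    have e1 : (k : ℂ) ^ (2 * (2 * 0 + 1)) +
        (((n : ℝ) ^ (2 * h + 1) / c : ℝ) : ℂ) ^ (2 * (2 * 0 + 1)) =
        ((n : ℂ) ^ (2 * (2 * h + 1)) + c ^ 2 * (k : ℂ) ^ 2) / c ^ 2 := by
      push_cast
      field_simp
      ring
    rw [e1]
    push_cast
    field_simp
    ring
  rw [tsum_congr e] at key
  rw [key]
  push_cast
  field_simp
  ring

lemma one_div_pow_mul_altBose (h M : ℕ) {c : ℝ} (hc : 0 < c) (k : ℕ+) :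
    1 / (k : ℂ) ^ (2 * M + 1) * altBose h ((c * k) ^ (1 / (2 * h + 1 : ℕ) : ℝ)) +
        1 / 2 * (1 / (k : ℂ) ^ (2 * M + 1)) =
      (2 * h + 1 : ℕ) * (c : ℂ) / Real.pi *
        (1 / 2 * 0 ^ (2 * h) / c ^ 2 * (1 / (k : ℂ) ^ (2 * (M + 1))) +
        ∑' n : ℕ+, (n : ℂ) ^ (2 * h) / (k : ℂ) ^ (2 * M) /
          ((n : ℂ) ^ (2 * (2 * h + 1)) + c ^ 2 * (k : ℂ) ^ 2)) := by
  have hk0 : (0 : ℝ) < k := by exact_mod_cast k.pos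
  have hk : (k : ℂ) ≠ 0 := by exact_mod_cast k.ne_zero
  have hc' : (c : ℂ) ≠ 0 := by exact_mod_cast hc.ne'
  have hp : (Real.pi : ℂ) ≠ 0 := by exact_mod_cast Real.pi_ne_zero
  have hN : ((2 * h + 1 : ℕ) : ℂ) ≠ 0 := Nat.cast_ne_zero.mpr (by omega)
  have hd : 0 < (c * k) ^ (1 / (2 * h + 1 : ℕ) : ℝ) := Real.rpow_pos_of_pos (by positivity) _
  have hdN : ((((c * k) ^ (1 / (2 * h + 1 : ℕ) : ℝ) : ℝ)) : ℂ) ^ (2 * h + 1) = c * k := by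
    exact_mod_cast rpow_one_div_pow (x := c * k) (N := 2 * h + 1) (by positivity) (by omega)
  have key := ((hasSum_altBose h hd).mul_left
    (1 / (k : ℂ) ^ (2 * M + 1) / c / (2 * h + 1 : ℕ))).tsum_eq
  have e : ∀ n : ℕ+, 1 / (k : ℂ) ^ (2 * M + 1) / c / (2 * h + 1 : ℕ) *
      ((2 * h + 1 : ℕ) * (((c * k) ^ (1 / (2 * h + 1 : ℕ) : ℝ) : ℝ) : ℂ) ^ (2 * h + 1) *
        (n : ℂ) ^ (2 * h) / ((n : ℂ) ^ (2 * (2 * h + 1)) +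
          (((c * k) ^ (1 / (2 * h + 1 : ℕ) : ℝ) : ℝ) : ℂ) ^ (2 * (2 * h + 1)))) =
      (n : ℂ) ^ (2 * h) / (k : ℂ) ^ (2 * M) /
          ((n : ℂ) ^ (2 * (2 * h + 1)) + c ^ 2 * (k : ℂ) ^ 2) := by
    intro n
    rw [mul_comm 2 (2 * h + 1), pow_mul _ (2 * h + 1) 2, pow_mul _ (2 * h + 1) 2, hdN, mul_pow (c : ℂ),
      pow_succ (k : ℂ) (2 * M)]
    have hkM := pow_ne_zero (2 * M) hk
    generalize ((n : ℂ) ^ (2 * h + 1)) ^ 2 + (c : ℂ) ^ 2 * (k : ℂ) ^ 2 = D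
    field_simp
  rw [tsum_congr e] at key
  rw [key, hdN, pow_succ (k : ℂ) (2 * M), show 2 * (M + 1) = 2 * M + 1 + 1 by ring,
    pow_succ (k : ℂ) (2 * M + 1), pow_succ (k : ℂ) (2 * M)]
  generalize altBose h _ = A
  generalize (0 : ℂ) ^ (2 * h) = Z
  have hkM := pow_ne_zero (2 * M) hk
  field_simp
  ring

/-- Both sides become double series whose difference is known. The polar corrections fit the same
pattern as end terms because ζ(0) = -1/2: index 0 always, and index M + 1 only for h = 0. -/
lemma lambert_transformation_pos (h : ℕ) {M : ℕ} (hM : 0 < M) {c : ℝ} (hc : 0 < c) :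
    ∑' n : ℕ+, 1 / (n : ℂ) ^ (2 * (2 * h + 1) * M + 1) *
          altBose 0 ((n : ℝ) ^ (2 * h + 1) / c) +
        1 / 2 * riemannZeta (2 * (2 * h + 1) * M + 1 : ℕ) =
      1 / (-(c : ℂ) ^ 2) ^ M / (2 * h + 1 : ℕ) * (∑' k : ℕ+, 1 / (k : ℂ) ^ (2 * M + 1) *
          altBose h ((c * k) ^ (1 / (2 * h + 1 : ℕ) : ℝ)) + 1 / 2 * riemannZeta (2 * M + 1 : ℕ)) -
      (c : ℂ) / Real.pi * (∑ i ∈ Finset.range (M + 1), 1 / (-(c : ℂ) ^ 2) ^ i *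
          (riemannZeta (2 * i : ℕ) *
            riemannZeta (2 * h + 2 + 2 * (2 * h + 1) * (M - i) : ℕ)) +
        if h = 0 then 1 / (-(c : ℂ) ^ 2) ^ (M + 1) * (riemannZeta (2 * (M + 1) : ℕ) * (-1 / 2))
        else 0) := by
  have hc' : (c : ℂ) ≠ 0 := by exact_mod_cast hc.ne'
  have hp : (Real.pi : ℂ) ≠ 0 := by exact_mod_cast Real.pi_ne_zero
  have hN : ((2 * h + 1 : ℕ) : ℂ) ≠ 0 := Nat.cast_ne_zero.mpr (by omega)
  have hM2 : 1 < 2 * (2 * h + 1) * M + 1 := by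
    have : 0 < 2 * (2 * h + 1) * M := by positivity
    omega
  have sA : Summable fun n : ℕ+ => 1 / (n : ℂ) ^ (2 * (2 * h + 1) * M + 1) *
      altBose 0 ((n : ℝ) ^ (2 * h + 1) / c) := by
    refine (summable_zpow_mul_altBose (-((2 * (2 * h + 1) * M + 1 : ℕ) : ℤ)) 0 (N := 1) one_ne_zero
      (κ := 1 / c) (d := fun n : ℕ+ => (n : ℝ) ^ (2 * h + 1) / c) (by positivity)
      (fun n => ?_) fun n => ?_).congr fun n => ?_
    · have hn0 : (0 : ℝ) < n := by exact_mod_cast n.pos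
      positivity
    · have hn : (1 : ℝ) ≤ n := by exact_mod_cast n.2
      have := le_self_pow₀ hn (show 2 * h + 1 ≠ 0 by omega)
      rw [pow_one, one_div_mul_eq_div]
      gcongr
    · rw [zpow_neg, zpow_natCast, ← one_div]
  have sB : Summable fun k : ℕ+ => 1 / (k : ℂ) ^ (2 * M + 1) *
      altBose h ((c * k) ^ (1 / (2 * h + 1 : ℕ) : ℝ)) := by
    refine (summable_zpow_mul_altBose (-((2 * M + 1 : ℕ) : ℤ)) h (N := 2 * h + 1) (by omega)
      (κ := c) (d := fun k : ℕ+ => (c * k) ^ (1 / (2 * h + 1 : ℕ) : ℝ)) hc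
      (fun k => ?_) fun k => ?_).congr fun k => ?_
    · have hn0 : (0 : ℝ) < k := by exact_mod_cast k.pos
      exact Real.rpow_pos_of_pos (by positivity) _
    · have hn0 : (0 : ℝ) < k := by exact_mod_cast k.pos
      exact (rpow_one_div_pow (by positivity) (by omega)).ge
    · rw [zpow_neg, zpow_natCast, ← one_div]
  have L : ∑' n : ℕ+, 1 / (n : ℂ) ^ (2 * (2 * h + 1) * M + 1) *
          altBose 0 ((n : ℝ) ^ (2 * h + 1) / c) +
        1 / 2 * riemannZeta (2 * (2 * h + 1) * M + 1 : ℕ) =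
      (c : ℂ) / Real.pi * (1 / 2 * riemannZeta (2 * h + 2 + 2 * (2 * h + 1) * M : ℕ) +
        ∑' n : ℕ+, ∑' k : ℕ+, (n : ℂ) ^ (2 * h) / (n : ℂ) ^ (2 * (2 * h + 1) * M) /
          ((n : ℂ) ^ (2 * (2 * h + 1)) + c ^ 2 * (k : ℂ) ^ 2)) := by
    have z1 := hasSum_one_div_pnat_pow hM2
    have z2 := hasSum_one_div_pnat_pow (k := 2 * h + 2 + 2 * (2 * h + 1) * M) (by omega)
    have d1 : Summable fun n : ℕ+ => ∑' k : ℕ+, (n : ℂ) ^ (2 * h) /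
        (n : ℂ) ^ (2 * (2 * h + 1) * M) / ((n : ℂ) ^ (2 * (2 * h + 1)) + c ^ 2 * (k : ℂ) ^ 2) :=
      (summable_lambert_left h hM hc).prod_symm.prod
    rw [← (sA.hasSum.add (z1.mul_left (1 / 2))).tsum_eq,
      ← (((z2.mul_left (1 / 2)).add d1.hasSum).mul_left ((c : ℂ) / Real.pi)).tsum_eq]
    exact tsum_congr fun n => one_div_pow_mul_altBose_zero h M hc n
  have R : ∑' k : ℕ+, 1 / (k : ℂ) ^ (2 * M + 1) *
          altBose h ((c * k) ^ (1 / (2 * h + 1 : ℕ) : ℝ)) + 1 / 2 * riemannZeta (2 * M + 1 : ℕ) =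
      (2 * h + 1 : ℕ) * (c : ℂ) / Real.pi *
        (1 / 2 * 0 ^ (2 * h) / c ^ 2 * riemannZeta (2 * (M + 1) : ℕ) +
        ∑' k : ℕ+, ∑' n : ℕ+, (n : ℂ) ^ (2 * h) / (k : ℂ) ^ (2 * M) /
          ((n : ℂ) ^ (2 * (2 * h + 1)) + c ^ 2 * (k : ℂ) ^ 2)) := by
    have z1 := hasSum_one_div_pnat_pow (k := 2 * M + 1) (by omega)
    have z2 := hasSum_one_div_pnat_pow (k := 2 * (M + 1)) (by omega)
    have d1 := (summable_lambert_right h hM hc).prod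
    rw [← (sB.hasSum.add (z1.mul_left (1 / 2))).tsum_eq,
      ← (((z2.mul_left (1 / 2 * 0 ^ (2 * h) / (c : ℂ) ^ 2)).add d1.hasSum).mul_left
        ((2 * h + 1 : ℕ) * (c : ℂ) / Real.pi)).tsum_eq]
    exact tsum_congr fun k => one_div_pow_mul_altBose h M hc k
  have D := tsum_tsum_lambert_sub h hM hc
  have hz0 : riemannZeta (2 * 0 : ℕ) = -1 / 2 := by
    rw [mul_zero, Nat.cast_zero, riemannZeta_zero]
  rw [L, R, Finset.sum_range_succ']
  have e : ∑ i ∈ Finset.range M, 1 / (-(c : ℂ) ^ 2) ^ (i + 1) * (riemannZeta (2 * (i + 1) : ℕ) *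
      riemannZeta (2 * h + 2 + 2 * (2 * h + 1) * (M - (i + 1)) : ℕ)) =
      ∑ i ∈ Finset.range M, 1 / (-(c : ℂ) ^ 2) ^ (i + 1) * (riemannZeta (2 * (i + 1) : ℕ) *
      riemannZeta (2 * h + 2 + 2 * (2 * h + 1) * (M - 1 - i) : ℕ)) :=
    Finset.sum_congr rfl fun i _ => by rw [show M - (i + 1) = M - 1 - i by omega]
  have hZ : (1 / 2 * 0 ^ (2 * h) / (c : ℂ) ^ 2 * riemannZeta (2 * (M + 1) : ℕ)) / (-(c : ℂ) ^ 2) ^ M =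
      if h = 0 then 1 / (-(c : ℂ) ^ 2) ^ (M + 1) * (riemannZeta (2 * (M + 1) : ℕ) * (-1 / 2))
        else 0 := by
    split_ifs with h0
    · subst h0
      have : (-(c : ℂ) ^ 2) ^ M ≠ 0 := pow_ne_zero _ (neg_ne_zero.mpr (pow_ne_zero _ hc'))
      rw [pow_succ (-(c : ℂ) ^ 2)]
      generalize riemannZeta _ = Z
      field_simp
      simp
    · simp [h0]
  rw [e, hz0, ← hZ, Nat.sub_zero, pow_zero]
  rw [sub_eq_iff_eq_add] at D
  rw [D]
  generalize ∑ i ∈ Finset.range M, 1 / (-(c : ℂ) ^ 2) ^ (i + 1) * _ = S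
  generalize (tsum _ _ : ℂ) = T
  generalize riemannZeta _ = Z1
  generalize riemannZeta _ = Z2
  have : (-(c : ℂ) ^ 2) ^ M ≠ 0 := pow_ne_zero _ (neg_ne_zero.mpr (pow_ne_zero _ hc'))
  generalize (-(c : ℂ) ^ 2) ^ M = E at *
  generalize (0 : ℂ) ^ (2 * h) = W
  generalize ((2 * h + 1 : ℕ) : ℂ) = N at *
  field_simp
  ring

/-! ### Both signs of the index in one formula -/

lemma sum_Icc_zero_natCast (f : ℤ → ℂ) (M : ℕ) :
    ∑ j ∈ Finset.Icc (0 : ℤ) M, f j = ∑ i ∈ Finset.range (M + 1), f i := by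
  symm
  refine Finset.sum_nbij (fun i : ℕ => (i : ℤ)) (fun i hi => ?_) (fun i _ j _ hij => ?_)
    (fun j hj => ?_) fun i _ => rfl
  · simp only [Finset.mem_range, Finset.mem_Icc] at hi ⊢
    omega
  · simpa using hij
  · simp only [Finset.coe_Icc, Set.mem_Icc] at hj
    refine ⟨j.toNat, ?_, ?_⟩
    · simp only [Finset.coe_range, Set.mem_Iio]
      omega
    · simp only
      omega

/-- Transformation formula for the Lambert series of odd index `2 * h + 1`, with all even zeta
values left unevaluated. -/
lemma lambert_transformation (h : ℕ) {m : ℤ} (hm : m ≠ 0) {c : ℝ} (hc : 0 < c) :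
    ∑' n : ℕ+, (n : ℂ) ^ (-2 * ((2 * h + 1 : ℕ) : ℤ) * m - 1) *
          altBose 0 ((n : ℝ) ^ (2 * h + 1) / c) +
        1 / 2 * riemannZeta (2 * (2 * h + 1 : ℕ) * m + 1) =
      (-(c : ℂ) ^ 2) ^ (-m) / (2 * h + 1 : ℕ) * (∑' k : ℕ+, (k : ℂ) ^ (-2 * m - 1) *
          altBose h ((c * k) ^ (1 / (2 * h + 1 : ℕ) : ℝ)) + 1 / 2 * riemannZeta (2 * m + 1)) -
      (c : ℂ) / Real.pi * ∑ j ∈ Finset.Icc (0 : ℤ) (if h = 0 then m + 1 else m),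
        (-(c : ℂ) ^ 2) ^ (-j) * (riemannZeta ((2 * j).toNat : ℕ) *
          riemannZeta ((((2 * h + 1 : ℕ) : ℤ) + 1 + 2 * ((2 * h + 1 : ℕ) : ℤ) * (m - j)).toNat : ℕ)) := by
  have hz0 : riemannZeta ((0 : ℕ) : ℂ) = -1 / 2 := by rw [Nat.cast_zero, riemannZeta_zero]
  rcases lt_or_gt_of_ne hm with hneg | hpos
  · obtain ⟨M, rfl⟩ : ∃ M : ℕ, m = -(M : ℤ) := ⟨(-m).toNat, by omega⟩
    have hM : 0 < M := by omega
    have key := lambert_transformation_neg h hM hc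
    have e1 : ∀ n : ℕ+, (n : ℂ) ^ (2 * (2 * h + 1) * M - 1) =
        (n : ℂ) ^ (-2 * ((2 * h + 1 : ℕ) : ℤ) * -(M : ℤ) - 1) := by
      intro n
      rw [← zpow_natCast]
      congr 1
      have : 0 < 2 * (2 * h + 1) * M := by positivity
      rw [Nat.cast_sub (by omega)]
      push_cast
      ring
    have e2 : ∀ n : ℕ+, (n : ℂ) ^ (2 * M - 1) = (n : ℂ) ^ (-2 * -(M : ℤ) - 1) := by
      intro n
      rw [← zpow_natCast]
      congr 1
      omega
    have e3 : (1 : ℂ) - 2 * ((2 * h + 1 : ℕ) * M : ℕ) = 2 * (2 * h + 1 : ℕ) * (-(M : ℤ) : ℤ) + 1 := by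
      push_cast
      ring
    have e4 : (1 : ℂ) - 2 * M = 2 * (-(M : ℤ) : ℤ) + 1 := by
      push_cast
      ring
    have e5 : ∑ j ∈ Finset.Icc (0 : ℤ) (if h = 0 then -(M : ℤ) + 1 else -(M : ℤ)),
        (-(c : ℂ) ^ 2) ^ (-j) * (riemannZeta ((2 * j).toNat : ℕ) *
          riemannZeta ((((2 * h + 1 : ℕ) : ℤ) + 1 + 2 * ((2 * h + 1 : ℕ) : ℤ) *
            (-(M : ℤ) - j)).toNat : ℕ)) = if h = 0 ∧ M = 1 then 1 / 4 else 0 := by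
      split_ifs with h0 h1 h1
      · obtain ⟨rfl, rfl⟩ := h1
        -- The only nonempty finite sum for negative index is h = 0, m = -1, where ζ(0)² = 1/4 is
        -- exactly the boundary term of the integration by parts.
        have : Finset.Icc (0 : ℤ) (-((1 : ℕ) : ℤ) + 1) = {0} := by decide
        rw [this, Finset.sum_singleton]
        norm_num [riemannZeta_zero]
      · rw [Finset.Icc_eq_empty (by omega), Finset.sum_empty]
      · omega
      · rw [Finset.Icc_eq_empty (by omega), Finset.sum_empty]
    rw [tsum_congr fun n => by rw [e1 n], tsum_congr (β := ℕ+) (f := fun n : ℕ+ =>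
      (n : ℂ) ^ (2 * M - 1) * altBose h ((c * n) ^ (1 / (2 * h + 1 : ℕ) : ℝ)))
      fun n => by rw [e2 n], e3, e4] at key
    rw [e5, neg_neg, zpow_natCast]
    exact key
  · obtain ⟨M, rfl⟩ : ∃ M : ℕ, m = (M : ℤ) := ⟨m.toNat, by omega⟩
    have hM : 0 < M := by omega
    have key := lambert_transformation_pos h hM hc
    have e1 : ∀ n : ℕ+, 1 / (n : ℂ) ^ (2 * (2 * h + 1) * M + 1) =
        (n : ℂ) ^ (-2 * ((2 * h + 1 : ℕ) : ℤ) * (M : ℤ) - 1) := by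
      intro n
      rw [← zpow_natCast, one_div, ← zpow_neg]
      congr 1
      push_cast
      ring
    have e2 : ∀ n : ℕ+, 1 / (n : ℂ) ^ (2 * M + 1) = (n : ℂ) ^ (-2 * (M : ℤ) - 1) := by
      intro n
      rw [← zpow_natCast, one_div, ← zpow_neg]
      congr 1
      push_cast
      ring
    have e3 : ((2 * (2 * h + 1) * M + 1 : ℕ) : ℂ) = 2 * (2 * h + 1 : ℕ) * ((M : ℤ) : ℂ) + 1 := by
      push_cast
      ring
    have e4 : ((2 * M + 1 : ℕ) : ℂ) = 2 * ((M : ℤ) : ℂ) + 1 := by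
      push_cast
      ring
    set f : ℤ → ℂ := fun j => (-(c : ℂ) ^ 2) ^ (-j) * (riemannZeta ((2 * j).toNat : ℕ) *
          riemannZeta ((((2 * h + 1 : ℕ) : ℤ) + 1 + 2 * ((2 * h + 1 : ℕ) : ℤ) *
            ((M : ℤ) - j)).toNat : ℕ)) with hf
    have e6 : ∑ i ∈ Finset.range (M + 1), 1 / (-(c : ℂ) ^ 2) ^ i * (riemannZeta (2 * i : ℕ) *
            riemannZeta (2 * h + 2 + 2 * (2 * h + 1) * (M - i) : ℕ)) =
        ∑ i ∈ Finset.range (M + 1), f i := by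
      refine Finset.sum_congr rfl fun i hi => ?_
      have hi' := Finset.mem_range.mp hi
      rw [hf]
      beta_reduce
      rw [zpow_neg, zpow_natCast, one_div]
      congr 4
      have : (((2 * h + 1 : ℕ) : ℤ) + 1 + 2 * ((2 * h + 1 : ℕ) : ℤ) * ((M : ℤ) - i)) =
          ((2 * h + 2 + 2 * (2 * h + 1) * (M - i) : ℕ) : ℤ) := by
        push_cast [Nat.cast_sub (show i ≤ M by omega)]
        ring
      rw [this, Int.toNat_natCast]
    have e5 : ∑ j ∈ Finset.Icc (0 : ℤ) (if h = 0 then (M : ℤ) + 1 else (M : ℤ)), f j =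
        ∑ i ∈ Finset.range (M + 1), f i + if h = 0 then 1 / (-(c : ℂ) ^ 2) ^ (M + 1) *
          (riemannZeta (2 * (M + 1) : ℕ) * (-1 / 2)) else 0 := by
      split_ifs with h0
      · subst h0
        rw [← Nat.cast_succ, sum_Icc_zero_natCast, Finset.sum_range_succ]
        congr 1
        rw [hf]
        beta_reduce
        rw [zpow_neg, zpow_natCast, one_div, ← hz0]
        congr 4
        push_cast
        ring_nf
        rfl
      · rw [sum_Icc_zero_natCast, add_zero]
    rw [tsum_congr fun n => by rw [e1 n], tsum_congr (β := ℕ+) (f := fun n : ℕ+ =>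
      1 / (n : ℂ) ^ (2 * M + 1) * altBose h ((c * n) ^ (1 / (2 * h + 1 : ℕ) : ℝ)))
      fun n => by rw [e2 n], e3, e4, e6, ← e5] at key
    rw [key, zpow_neg, zpow_natCast, one_div]

/-! ### From zeta values and c to Bernoulli numbers and α, β -/

/-- The fraction (N+1)/(2N) equals 1 for N = 1 and lies in (0, 1) for larger N, which reproduces the
case distinction on h. -/
lemma floor_half_add_int (h : ℕ) (m : ℤ) :
    ⌊(((2 * h + 1 : ℕ) : ℝ) + 1) / (2 * ((2 * h + 1 : ℕ) : ℝ)) + (m : ℝ)⌋ =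
      if h = 0 then m + 1 else m := by
  rw [Int.floor_add_intCast]
  split_ifs with h0
  · subst h0
    norm_num
    ring
  · have : ⌊(((2 * h + 1 : ℕ) : ℝ) + 1) / (2 * ((2 * h + 1 : ℕ) : ℝ))⌋ = 0 := by
      rw [Int.floor_eq_zero_iff, Set.mem_Ico]
      refine ⟨by positivity, ?_⟩
      have : (1 : ℝ) ≤ h := by exact_mod_cast Nat.one_le_iff_ne_zero.mpr h0
      rw [div_lt_one (by positivity)]
      push_cast
      linarith
    rw [this, zero_add]

lemma riemannZeta_toNat_even {j : ℤ} (hj : 0 ≤ j) :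
    riemannZeta ((2 * j).toNat : ℕ) = (-1 : ℂ) ^ (j + 1) * (2 : ℂ) ^ (2 * j - 1) *
      (Real.pi : ℂ) ^ (2 * j) * (((bernoulli (2 * j).toNat : ℚ) : ℝ) : ℂ) / ((2 * j).toNat ! : ℝ) := by
  obtain ⟨k, rfl⟩ : ∃ k : ℕ, j = k := ⟨j.toNat, by omega⟩
  have e : (2 * (k : ℤ)).toNat = 2 * k := by omega
  have key := riemannZeta_two_mul_nat' (k := k)
  rw [e, Nat.cast_mul, Nat.cast_ofNat, key]
  rw [← Nat.cast_succ, zpow_natCast, show (2 * (k : ℤ)) = ((2 * k : ℕ) : ℤ) by push_cast; rfl,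
    zpow_natCast]
  push_cast
  rfl

lemma rpow_div_eq_zpow {x : ℝ} (hx : 0 ≤ x) (z : ℤ) (s : ℝ) :
    x ^ ((z : ℝ) / s) = (x ^ (1 / s)) ^ z := by
  rw [← Real.rpow_intCast, ← Real.rpow_mul hx, one_div_mul_eq_div]

lemma neg_one_zpow_eq_of_even_sub {a b : ℤ} (hab : Even (a - b)) : (-1 : ℂ) ^ a = (-1) ^ b := by
  rw [show a = b + (a - b) by ring, zpow_add₀ (by norm_num), hab.neg_one_zpow, mul_one]

lemma lambert_monomial {A B C p : ℂ} (hA : A ≠ 0) (hB : B ≠ 0) {N : ℕ} (hp : p = A * B ^ N)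
    (hC : C = 2 * p / (2 ^ N * A ^ (N + 1))) (m j : ℤ) :
    A ^ (-(2 * (N : ℤ) * m)) * (C / p) * (C ^ 2) ^ (-j) *
      (2 ^ (2 * j - 1) * p ^ (2 * j)) *
      (2 ^ ((N : ℤ) + 1 + 2 * N * (m - j) - 1) * p ^ ((N : ℤ) + 1 + 2 * N * (m - j))) =
    2 ^ (2 * (N : ℤ) * m) * A ^ (2 * j) * B ^ ((N : ℤ) * (N + 1) + 2 * N ^ 2 * (m - j)) := by
  have h2 : (2 : ℂ) ≠ 0 := two_ne_zero
  have hp' : p = A ^ (1 : ℤ) * B ^ (N : ℤ) := by rw [hp, zpow_one, zpow_natCast]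
  have hC' : C = 2 ^ (1 - (N : ℤ)) * A ^ (-(N : ℤ)) * B ^ (N : ℤ) := by
    rw [hC, hp, zpow_sub₀ h2, zpow_neg, zpow_one, zpow_natCast, zpow_natCast, zpow_natCast]
    field_simp
    ring
  have hCp : C / p = 2 ^ (1 - (N : ℤ)) * A ^ (-(N : ℤ) - 1) := by
    rw [hC', hp', zpow_sub₀ hA]
    field_simp
  rw [hCp, hC', hp', ← zpow_natCast]
  simp only [mul_zpow, ← zpow_mul]
  calc _ = (2 ^ (1 - (N : ℤ)) * 2 ^ ((1 - (N : ℤ)) * ((2 : ℕ) : ℤ) * -j) * 2 ^ (2 * j - 1) *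
          2 ^ ((N : ℤ) + 1 + 2 * N * (m - j) - 1)) *
        (A ^ (-(2 * (N : ℤ) * m)) * A ^ (-(N : ℤ) - 1) * A ^ (-(N : ℤ) * ((2 : ℕ) : ℤ) * -j) *
          A ^ (1 * (2 * j)) * A ^ (1 * ((N : ℤ) + 1 + 2 * N * (m - j)))) *
        (B ^ ((N : ℤ) * ((2 : ℕ) : ℤ) * -j) * B ^ ((N : ℤ) * (2 * j)) *
          B ^ ((N : ℤ) * ((N : ℤ) + 1 + 2 * N * (m - j)))) := by
        generalize (2 : ℂ) ^ (_ : ℤ) = x1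
        generalize (2 : ℂ) ^ (_ : ℤ) = x2
        generalize (2 : ℂ) ^ (_ : ℤ) = x3
        generalize (2 : ℂ) ^ (_ : ℤ) = x4
        generalize A ^ (_ : ℤ) = y1
        generalize A ^ (_ : ℤ) = y2
        generalize A ^ (_ : ℤ) = y3
        generalize A ^ (_ : ℤ) = y4
        generalize A ^ (_ : ℤ) = y5
        generalize B ^ (_ : ℤ) = z1
        generalize B ^ (_ : ℤ) = z2
        generalize B ^ (_ : ℤ) = z3
        ring
    _ = _ := by
        simp only [← zpow_add₀ h2, ← zpow_add₀ hA, ← zpow_add₀ hB]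
        refine congrArg₂ _ (congrArg₂ _ (congrArg _ ?_) (congrArg _ ?_)) (congrArg _ ?_) <;>
          push_cast <;> ring

lemma lambert_finite_term {A B : ℝ} (hA : 0 < A) (hB : 0 < B) (h : ℕ)
    (hp : Real.pi = A * B ^ (2 * h + 1)) {c : ℝ}
    (hC : c = 2 * Real.pi / (2 ^ (2 * h + 1) * A ^ (2 * h + 1 + 1))) {m j : ℤ} (hj : 0 ≤ j)
    (hj' : 0 ≤ ((2 * h + 1 : ℕ) : ℤ) + 1 + 2 * ((2 * h + 1 : ℕ) : ℤ) * (m - j)) :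
    (A : ℂ) ^ (-(2 * ((2 * h + 1 : ℕ) : ℤ) * m)) * -((c : ℂ) / Real.pi * ((-(c : ℂ) ^ 2) ^ (-j) *
      (riemannZeta ((2 * j).toNat : ℕ) * riemannZeta ((((2 * h + 1 : ℕ) : ℤ) + 1 +
        2 * ((2 * h + 1 : ℕ) : ℤ) * (m - j)).toNat : ℕ)))) =
    (-1 : ℂ) ^ (m + (((2 * h + 1 : ℕ) : ℤ) + 3) / 2) * (2 : ℂ) ^ (2 * ((2 * h + 1 : ℕ) : ℤ) * m) *
      (((-1 : ℝ) ^ j * ((bernoulli (2 * j).toNat : ℚ) : ℝ) *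
        ((bernoulli (((2 * h + 1 : ℕ) : ℤ) + 1 + 2 * ((2 * h + 1 : ℕ) : ℤ) * (m - j)).toNat : ℚ) : ℝ) /
        (((2 * j).toNat ! : ℝ) *
          ((((2 * h + 1 : ℕ) : ℤ) + 1 + 2 * ((2 * h + 1 : ℕ) : ℤ) * (m - j)).toNat ! : ℝ)) *
        A ^ (2 * j) * B ^ (((2 * h + 1 : ℕ) : ℤ) * ((2 * h + 1 : ℕ) + 1) +
          2 * ((2 * h + 1 : ℕ) : ℤ) ^ 2 * (m - j)) : ℝ) : ℂ) := by
  have mono := lambert_monomial (A := A) (B := B) (C := c) (p := Real.pi) (N := 2 * h + 1)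
    (by exact_mod_cast hA.ne') (by exact_mod_cast hB.ne') (by exact_mod_cast hp)
    (by exact_mod_cast hC) m j
  set q : ℤ := (h : ℤ) + 1 + ((2 * h + 1 : ℕ) : ℤ) * (m - j) with hq
  have hq2 : ((2 * h + 1 : ℕ) : ℤ) + 1 + 2 * ((2 * h + 1 : ℕ) : ℤ) * (m - j) = 2 * q := by
    rw [hq]; push_cast; ring
  rw [hq2] at hj' mono ⊢
  -- Signs come from (-c²)^{-j} and from Euler's formula at 2j and at 2q; the exponents on the two
  -- sides differ by twice h(m-j) + 1 - j.
  have sgn : -((-1 : ℂ) ^ (-j) * (-1) ^ (j + 1) * (-1) ^ (q + 1)) =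
      (-1 : ℂ) ^ (m + (((2 * h + 1 : ℕ) : ℤ) + 3) / 2) * (-1) ^ j := by
    have e0 : (((2 * h + 1 : ℕ) : ℤ) + 3) / 2 = h + 2 := by omega
    have n0 : (-1 : ℂ) ≠ 0 := by norm_num
    rw [e0, ← neg_one_mul, ← zpow_add₀ n0, ← zpow_add₀ n0, ← zpow_add₀ n0, ← zpow_one_add₀ n0]
    refine neg_one_zpow_eq_of_even_sub ⟨(h : ℤ) * (m - j) + 1 - j, ?_⟩
    rw [hq]
    push_cast
    ring
  rw [riemannZeta_toNat_even hj, riemannZeta_toNat_even (show 0 ≤ q by omega), neg_eq_neg_one_mul ((c : ℂ) ^ 2),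
    mul_zpow]
  push_cast
  generalize ((bernoulli (2 * j).toNat : ℚ) : ℂ) = b1
  generalize ((bernoulli (2 * q).toNat : ℚ) : ℂ) = b2
  generalize ((2 * j).toNat ! : ℂ) = f1
  generalize ((2 * q).toNat ! : ℂ) = f2
  push_cast at mono sgn
  calc _ = -((-1 : ℂ) ^ (-j) * (-1) ^ (j + 1) * (-1) ^ (q + 1)) * (b1 * b2 / (f1 * f2)) *
        ((A : ℂ) ^ (-(2 * (2 * (h : ℤ) + 1) * m)) * (c / Real.pi) * ((c : ℂ) ^ 2) ^ (-j) *
          (2 ^ (2 * j - 1) * (Real.pi : ℂ) ^ (2 * j)) *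
          (2 ^ (2 * q - 1) * (Real.pi : ℂ) ^ (2 * q))) := by
        generalize (-1 : ℂ) ^ (-j) = s1
        generalize (-1 : ℂ) ^ (j + 1) = s2
        generalize (-1 : ℂ) ^ (q + 1) = s3
        generalize (2 : ℂ) ^ (2 * j - 1) = x1
        generalize (2 : ℂ) ^ (2 * q - 1) = x2
        generalize (Real.pi : ℂ) ^ (2 * j) = p1
        generalize (Real.pi : ℂ) ^ (2 * q) = p2
        generalize ((c : ℂ) ^ 2) ^ (-j) = c1
        generalize (A : ℂ) ^ (_ : ℤ) = a1
        ring
    _ = _ := by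
        rw [sgn, mono]
        generalize (-1 : ℂ) ^ j = s1
        generalize (-1 : ℂ) ^ (_ : ℤ) = s2
        generalize (2 : ℂ) ^ (_ : ℤ) = x1
        generalize (A : ℂ) ^ (_ : ℤ) = a1
        generalize (B : ℂ) ^ (_ : ℤ) = d1
        ring

lemma lambert_prefactor {A B : ℝ} (hA : 0 < A) (hB : 0 < B) {N : ℕ} {p : ℝ}
    (hp : p = A * B ^ N) {c : ℝ} (hC : c = 2 * p / (2 ^ N * A ^ (N + 1))) (m : ℤ) :
    (A : ℂ) ^ (-(2 * (N : ℤ) * m)) * (-(c : ℂ) ^ 2) ^ (-m) =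
      (((-(B ^ (2 * N))) ^ (-m) : ℝ) : ℂ) * (2 : ℂ) ^ (2 * m * ((N : ℤ) - 1)) := by
  have hA' : (A : ℂ) ≠ 0 := by exact_mod_cast hA.ne'
  have hB' : (B : ℂ) ≠ 0 := by exact_mod_cast hB.ne'
  have e : (A : ℂ) ^ (-(2 * (N : ℤ) * m)) = ((A : ℂ) ^ (2 * N)) ^ (-m) := by
    rw [← zpow_natCast, ← zpow_mul]
    congr 1
    push_cast
    ring
  have e2 : (2 : ℂ) ^ (2 * m * ((N : ℤ) - 1)) = ((2 : ℂ) ^ (2 - 2 * (N : ℤ))) ^ (-m) := by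
    rw [← zpow_mul]
    congr 1
    ring
  push_cast
  rw [e, e2, ← mul_zpow, ← mul_zpow]
  congr 1
  rw [hC, hp, zpow_sub₀ two_ne_zero, zpow_mul, zpow_natCast]
  push_cast
  simp only [pow_mul, pow_succ, zpow_ofNat]
  field_simp
  simp only [← pow_mul, mul_comm N 2]
  ring

lemma exp_two_mul_pow_mul (h : ℕ) {α c : ℝ} (hα : 0 < α)
    (hc : c = 2 * Real.pi / (2 ^ (2 * h + 1) * α)) (n : ℕ+) :
    1 / (Complex.exp ((2 * (n : ℂ)) ^ (2 * h + 1) * α) - 1) =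
      altBose 0 ((n : ℝ) ^ (2 * h + 1) / c) := by
  rw [altBose_zero]
  congr 3
  have hα' : (α : ℂ) ≠ 0 := by exact_mod_cast hα.ne'
  have hp : (Real.pi : ℂ) ≠ 0 := by exact_mod_cast Real.pi_ne_zero
  rw [hc]
  push_cast
  field_simp
  ring

/-- Comparing N-th powers, this is 2kβ^N = (2π)^N ck, which is the constraint αβ^N = π^{N+1} for
this value of c. -/
lemma two_mul_rpow_mul {N : ℕ} (hN : N ≠ 0) {α β c : ℝ} (hα : 0 < α) (hβ : 0 < β)
    (hαβ : α * β ^ N = Real.pi ^ (N + 1)) (hc : c = 2 * Real.pi / (2 ^ N * α)) (k : ℕ+) :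
    (2 * (k : ℝ)) ^ (1 / (N : ℝ)) * β = 2 * Real.pi * (c * k) ^ (1 / (N : ℝ)) := by
  have hp := Real.pi_pos
  have hc0 : 0 < c := by rw [hc]; positivity
  refine (pow_left_inj₀ (by positivity) (by positivity) hN).mp ?_
  rw [mul_pow, mul_pow, rpow_one_div_pow (by positivity) hN, rpow_one_div_pow (by positivity) hN, hc,
    mul_pow]
  field_simp
  rw [mul_comm, hαβ, pow_succ]

lemma lambert_term_left (h : ℕ) {α c : ℝ} (hα : 0 < α)
    (hc : c = 2 * Real.pi / (2 ^ (2 * h + 1) * α)) (a : ℤ) (n : ℕ+) :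
    (n : ℂ) ^ a / (Complex.exp ((2 * (n : ℂ)) ^ (2 * h + 1) * (α : ℂ)) - 1) =
      (n : ℂ) ^ a * altBose 0 ((n : ℝ) ^ (2 * h + 1) / c) := by
  rw [← exp_two_mul_pow_mul h hα hc, mul_one_div]

lemma lambert_term_right (h : ℕ) {α β : ℝ} (hα : 0 < α) (hβ : 0 < β)
    (hαβ : α * β ^ (2 * h + 1) = Real.pi ^ (2 * h + 1 + 1)) {c : ℝ}
    (hc : c = 2 * Real.pi / (2 ^ (2 * h + 1) * α)) (a : ℤ) (j : ℤ) (n : ℕ+) :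
    (n : ℂ) ^ a / (Complex.exp ((((2 * (n : ℝ)) ^ (1 / ((2 * h + 1 : ℕ) : ℝ)) * β : ℝ) : ℂ) *
        Complex.exp (Complex.I * (Real.pi : ℂ) * (j : ℂ) / ((2 * h + 1 : ℕ) : ℂ))) - 1) =
      (n : ℂ) ^ a * (1 / (Complex.exp (2 * Real.pi *
        (((c * n) ^ (1 / (2 * h + 1 : ℕ) : ℝ) : ℝ) * oddUnit h j)) - 1)) := by
  rw [two_mul_rpow_mul (by omega) hα hβ hαβ hc, mul_one_div, oddUnit]
  push_cast
  rw [mul_assoc (2 * (Real.pi : ℂ))]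

lemma summable_lambert_term_right (h : ℕ) (a : ℤ) {c : ℝ} (hc : 0 < c) {j : ℤ}
    (hj : j ∈ Finset.Icc (-(h : ℤ)) h) : Summable fun n : ℕ+ => (n : ℂ) ^ a *
      (1 / (Complex.exp (2 * Real.pi *
        (((c * n) ^ (1 / (2 * h + 1 : ℕ) : ℝ) : ℝ) * oddUnit h j)) - 1)) :=
  summable_zpow_mul_altBose_term a hj (show 2 * h + 1 ≠ 0 by omega) hc
    (d := fun n : ℕ+ => (c * n) ^ (1 / (2 * h + 1 : ℕ) : ℝ))
    (fun n => Real.rpow_pos_of_pos (mul_pos hc (by exact_mod_cast n.pos)) _)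
    fun n => (rpow_one_div_pow (by positivity) (by omega)).ge

lemma summable_lambert_term_left (h : ℕ) (a : ℤ) {c : ℝ} (hc : 0 < c) :
    Summable fun n : ℕ+ => (n : ℂ) ^ a * altBose 0 ((n : ℝ) ^ (2 * h + 1) / c) := by
  refine summable_zpow_mul_altBose _ 0 one_ne_zero
    (κ := 1 / c) (d := fun n : ℕ+ => (n : ℝ) ^ (2 * h + 1) / c) (by positivity)
    (fun n => ?_) fun n => ?_
  · have hn0 : (0 : ℝ) < n := by exact_mod_cast n.pos
    positivity
  · have hn : (1 : ℝ) ≤ n := by exact_mod_cast n.2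
    have := le_self_pow₀ hn (show 2 * h + 1 ≠ 0 by omega)
    rw [pow_one, one_div_mul_eq_div]
    gcongr

/-! ### Assembly of the identity and the case N = 1 -/

theorem lambert_identity (h : ℕ) {α β : ℝ} (hα : 0 < α) (hβ : 0 < β)
    (hαβ : α * β ^ (2 * h + 1) = Real.pi ^ (2 * h + 1 + 1)) {m : ℤ} (hm : m ≠ 0) :
    ((α ^ (-(2 * ((2 * h + 1 : ℕ) : ℝ) * (m : ℝ)) / (((2 * h + 1 : ℕ) : ℝ) + 1)) : ℝ) : ℂ) *
        (1 / 2 * riemannZeta (2 * ((2 * h + 1 : ℕ) : ℂ) * (m : ℂ) + 1) +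
          ∑' n : ℕ+, (n : ℂ) ^ (-2 * ((2 * h + 1 : ℕ) : ℤ) * m - 1) /
            (Complex.exp ((2 * (n : ℂ)) ^ (2 * h + 1) * (α : ℂ)) - 1)) =
      (((-(β ^ (2 * ((2 * h + 1 : ℕ) : ℝ) / (((2 * h + 1 : ℕ) : ℝ) + 1)))) ^ (-m) : ℝ) : ℂ) *
          ((2 : ℂ) ^ (2 * m * (((2 * h + 1 : ℕ) : ℤ) - 1)) / ((2 * h + 1 : ℕ) : ℂ)) *
          (1 / 2 * riemannZeta (2 * (m : ℂ) + 1) +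
            (-1 : ℂ) ^ ((2 * h + 1 + 3) / 2) *
              ∑ j ∈ Finset.Icc (-((((2 * h + 1 : ℕ) : ℤ) - 1) / 2)) ((((2 * h + 1 : ℕ) : ℤ) - 1) / 2),
                (-1 : ℂ) ^ j *
                  ∑' n : ℕ+, (n : ℂ) ^ (-2 * m - 1) /
                    (Complex.exp ((((2 * (n : ℝ)) ^ (1 / ((2 * h + 1 : ℕ) : ℝ)) * β : ℝ) : ℂ) *
                      Complex.exp (Complex.I * (Real.pi : ℂ) * (j : ℂ) / ((2 * h + 1 : ℕ) : ℂ))) - 1)) +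
        (-1 : ℂ) ^ (m + (((2 * h + 1 : ℕ) : ℤ) + 3) / 2) * (2 : ℂ) ^ (2 * ((2 * h + 1 : ℕ) : ℤ) * m) *
          ((∑ j ∈ Finset.Icc (0 : ℤ) ⌊(((2 * h + 1 : ℕ) : ℝ) + 1) / (2 * ((2 * h + 1 : ℕ) : ℝ)) + (m : ℝ)⌋,
            (-1 : ℝ) ^ j *
              ((bernoulli (2 * j).toNat : ℚ) : ℝ) *
              ((bernoulli (((2 * h + 1 : ℕ) : ℤ) + 1 + 2 * ((2 * h + 1 : ℕ) : ℤ) * (m - j)).toNat : ℚ) : ℝ) /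
              (((2 * j).toNat ! : ℝ) *
                (((((2 * h + 1 : ℕ) : ℤ) + 1 + 2 * ((2 * h + 1 : ℕ) : ℤ) * (m - j)).toNat) ! : ℝ)) *
              α ^ (2 * (j : ℝ) / (((2 * h + 1 : ℕ) : ℝ) + 1)) *
              β ^ (((2 * h + 1 : ℕ) : ℝ) + 2 * ((2 * h + 1 : ℕ) : ℝ) ^ 2 * ((m : ℝ) - (j : ℝ)) / (((2 * h + 1 : ℕ) : ℝ) + 1)) : ℝ) : ℂ) := by
  have hp := Real.pi_pos
  obtain ⟨c, hc⟩ : ∃ c : ℝ, c = 2 * Real.pi / (2 ^ (2 * h + 1) * α) := ⟨_, rfl⟩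
  have hc0 : 0 < c := by rw [hc]; positivity
  have eh : ((((2 * h + 1 : ℕ) : ℤ) - 1) / 2) = h := by omega
  have er : (-1 : ℂ) ^ ((2 * h + 1 + 3) / 2) * ∑ j ∈ Finset.Icc (-(h : ℤ)) h, (-1 : ℂ) ^ j *
        ∑' n : ℕ+, (n : ℂ) ^ (-2 * m - 1) * (1 / (Complex.exp (2 * Real.pi *
        (((c * n) ^ (1 / (2 * h + 1 : ℕ) : ℝ) : ℝ) * oddUnit h j)) - 1)) =
      ∑' k : ℕ+, (k : ℂ) ^ (-2 * m - 1) * altBose h ((c * k) ^ (1 / (2 * h + 1 : ℕ) : ℝ)) := by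
    have := hasSum_sum fun j hj => (summable_lambert_term_right h (-2 * m - 1) hc0 hj).hasSum.mul_left ((-1 : ℂ) ^ j)
    rw [show (2 * h + 1 + 3) / 2 = h + 2 by omega, pow_add, neg_one_sq, mul_one,
      ← (this.mul_left ((-1 : ℂ) ^ h)).tsum_eq]
    refine tsum_congr fun k => ?_
    simp only [altBose, Finset.mul_sum]
    exact Finset.sum_congr rfl fun j _ => by ring
  have hs : (((2 * h + 1 : ℕ) : ℝ) + 1) ≠ 0 := by positivity
  set A := α ^ (1 / (((2 * h + 1 : ℕ) : ℝ) + 1)) with hA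
  set B := β ^ (1 / (((2 * h + 1 : ℕ) : ℝ) + 1)) with hB
  have hA0 : 0 < A := Real.rpow_pos_of_pos hα _
  have hB0 : 0 < B := Real.rpow_pos_of_pos hβ _
  have eA : A ^ (2 * h + 1 + 1) = α := by
    rw [hA, ← Nat.cast_succ]
    exact rpow_one_div_pow hα.le (by omega)
  have eB : B ^ (2 * h + 1 + 1) = β := by
    rw [hB, ← Nat.cast_succ]
    exact rpow_one_div_pow hβ.le (by omega)
  -- The constraint αβ^N = π^{N+1} says that the (N+1)-th powers agree, and all quantities are
  -- positive.
  have hpi : Real.pi = A * B ^ (2 * h + 1) := by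
    refine (pow_left_inj₀ hp.le (by positivity) (show 2 * h + 1 + 1 ≠ 0 by omega)).mp ?_
    rw [mul_pow, ← pow_mul, mul_comm (2 * h + 1), pow_mul, eA, eB, hαβ]
  have hc' : c = 2 * Real.pi / (2 ^ (2 * h + 1) * A ^ (2 * h + 1 + 1)) := by rw [eA, hc]
  have a1 : α ^ (-(2 * ((2 * h + 1 : ℕ) : ℝ) * (m : ℝ)) / (((2 * h + 1 : ℕ) : ℝ) + 1)) =
      A ^ (-(2 * ((2 * h + 1 : ℕ) : ℤ) * m)) := by
    rw [← rpow_div_eq_zpow hα.le]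
    push_cast
    rfl
  have b1 : β ^ (2 * ((2 * h + 1 : ℕ) : ℝ) / (((2 * h + 1 : ℕ) : ℝ) + 1)) =
      B ^ (2 * (2 * h + 1)) := by
    rw [← zpow_natCast, ← rpow_div_eq_zpow hβ.le]
    push_cast
    rfl
  have a2 : ∀ j : ℤ, α ^ (2 * (j : ℝ) / (((2 * h + 1 : ℕ) : ℝ) + 1)) = A ^ (2 * j) := by
    intro j
    rw [← rpow_div_eq_zpow hα.le]
    push_cast
    rfl
  have b2 : ∀ j : ℤ, β ^ (((2 * h + 1 : ℕ) : ℝ) + 2 * ((2 * h + 1 : ℕ) : ℝ) ^ 2 *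
      ((m : ℝ) - (j : ℝ)) / (((2 * h + 1 : ℕ) : ℝ) + 1)) =
      B ^ (((2 * h + 1 : ℕ) : ℤ) * ((2 * h + 1 : ℕ) + 1) +
          2 * ((2 * h + 1 : ℕ) : ℤ) ^ 2 * (m - j)) := by
    intro j
    rw [← rpow_div_eq_zpow hβ.le]
    congr 1
    rw [eq_div_iff hs, add_mul, div_mul_cancel₀ _ hs]
    push_cast
    ring
  rw [eh, tsum_congr (lambert_term_left h hα hc _), Finset.sum_congr rfl fun j _ => by
      rw [tsum_congr (lambert_term_right h hα hβ hαβ hc _ j)], er, floor_half_add_int,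
    add_comm (1 / 2 * riemannZeta _), lambert_transformation h hm hc0, a1, b1,
    add_comm (1 / 2 * riemannZeta _), sub_eq_add_neg, mul_add, Complex.ofReal_zpow A]
  congr 1
  · rw [← mul_assoc, mul_div_assoc', lambert_prefactor hA0 hB0 hpi hc', mul_div_assoc]
  · rw [Finset.mul_sum, ← Finset.sum_neg_distrib, Finset.mul_sum, Complex.ofReal_sum,
      Finset.mul_sum]
    refine Finset.sum_congr rfl fun j hj => ?_
    rw [Finset.mem_Icc] at hj
    rw [a2, b2]
    refine lambert_finite_term hA0 hB0 h hpi hc' hj.1 ?_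
    have hj2 := hj.2
    split_ifs at hj2 with h0
    · subst h0
      push_cast
      omega
    · have : 0 ≤ m - j := by omega
      positivity

theorem ramanujan_formula {α β : ℝ} (hα : 0 < α) (hβ : 0 < β) (hαβ : α * β = Real.pi ^ 2)
    {m : ℤ} (hm : m ≠ 0) :
      ((α ^ (-m) : ℝ) : ℂ) *
          (1 / 2 * riemannZeta (2 * (m : ℂ) + 1) +
            ∑' n : ℕ+, (n : ℂ) ^ (-2 * m - 1) /
              (Complex.exp (2 * (α : ℂ) * (n : ℂ)) - 1)) =
        (((-β) ^ (-m) : ℝ) : ℂ) *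
            (1 / 2 * riemannZeta (2 * (m : ℂ) + 1) +
              ∑' n : ℕ+, (n : ℂ) ^ (-2 * m - 1) /
                (Complex.exp (2 * (β : ℂ) * (n : ℂ)) - 1)) -
          (2 : ℂ) ^ (2 * m) *
            ((∑ j ∈ Finset.Icc (0 : ℤ) (m + 1),
              (-1 : ℝ) ^ j *
                ((bernoulli (2 * j).toNat : ℚ) : ℝ) *
                ((bernoulli (2 * m + 2 - 2 * j).toNat : ℚ) : ℝ) /
                (((2 * j).toNat ! : ℝ) * ((2 * m + 2 - 2 * j).toNat ! : ℝ)) *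
                α ^ (m + 1 - j) * β ^ j : ℝ) : ℂ) := by
  have key := lambert_identity 0 hα hβ (by simpa using hαβ) hm
  have e1 : ∀ x : ℝ, x ^ (-(2 * ((2 * 0 + 1 : ℕ) : ℝ) * (m : ℝ)) / (((2 * 0 + 1 : ℕ) : ℝ) + 1)) =
      x ^ (-m) := by
    intro x
    rw [← Real.rpow_intCast]
    congr 1
    push_cast
    ring
  have e2 : β ^ (2 * ((2 * 0 + 1 : ℕ) : ℝ) / (((2 * 0 + 1 : ℕ) : ℝ) + 1)) = β := by
    norm_num
  have e3 : Finset.Icc (-((((2 * 0 + 1 : ℕ) : ℤ) - 1) / 2)) ((((2 * 0 + 1 : ℕ) : ℤ) - 1) / 2) =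
      {0} := by decide
  have e4 : (2 : ℂ) ^ (2 * m * (((2 * 0 + 1 : ℕ) : ℤ) - 1)) / ((2 * 0 + 1 : ℕ) : ℂ) = 1 := by
    simp
  rw [e1, e2, e3, e4, Finset.sum_singleton, floor_half_add_int, if_pos rfl] at key
  simp only [mul_zero, zero_add, Nat.cast_one, mul_one, pow_one] at key
  have e5 : ∑ x ∈ Finset.Icc (0 : ℤ) (m + 1), (-1 : ℝ) ^ x *
        ((bernoulli (2 * x).toNat : ℚ) : ℝ) * ((bernoulli (1 + 1 + 2 * (m - x)).toNat : ℚ) : ℝ) /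
          (((2 * x).toNat ! : ℝ) * ((1 + 1 + 2 * (m - x)).toNat ! : ℝ)) *
        α ^ (2 * (x : ℝ) / (1 + 1)) * β ^ (1 + 2 * 1 ^ 2 * ((m : ℝ) - (x : ℝ)) / (1 + 1)) =
      -- The general formula attaches α to B_{2j}, whereas the classical one attaches β; the
      -- reflection j ↦ m + 1 - j exchanges them at the cost of the sign -(-1)^m.
      -(-1 : ℝ) ^ m * ∑ j ∈ Finset.Icc (0 : ℤ) (m + 1), (-1 : ℝ) ^ j *
        ((bernoulli (2 * j).toNat : ℚ) : ℝ) * ((bernoulli (2 * m + 2 - 2 * j).toNat : ℚ) : ℝ) /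
          (((2 * j).toNat ! : ℝ) * ((2 * m + 2 - 2 * j).toNat ! : ℝ)) *
        α ^ (m + 1 - j) * β ^ j := by
    rw [Finset.mul_sum]
    refine Finset.sum_nbij' (fun j => m + 1 - j) (fun j => m + 1 - j)
      (fun j hj => ?_) (fun j hj => ?_) (fun j _ => by ring) (fun j _ => by ring) fun x _ => ?_
    · rw [Finset.mem_Icc] at hj ⊢
      omega
    · rw [Finset.mem_Icc] at hj ⊢
      omega
    · have i1 : 1 + 1 + 2 * (m - x) = 2 * (m + 1 - x) := by ring
      have i2 : 2 * m + 2 - 2 * (m + 1 - x) = 2 * x := by ring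
      have i3 : m + 1 - (m + 1 - x) = x := by ring
      have i4 : α ^ (2 * (x : ℝ) / (1 + 1)) = α ^ x := by
        rw [← Real.rpow_intCast]
        congr 1
        ring
      have i5 : β ^ (1 + 2 * 1 ^ 2 * ((m : ℝ) - (x : ℝ)) / (1 + 1)) = β ^ (m + 1 - x) := by
        rw [← Real.rpow_intCast]
        congr 1
        push_cast
        ring
      have i6 : (-1 : ℝ) ^ x = -(-1) ^ m * (-1) ^ (m + 1 - x) := by
        have n0 : (-1 : ℝ) ≠ 0 := by norm_num
        rw [neg_mul, ← zpow_add₀ n0, show m + (m + 1 - x) = x + (2 * (m - x) + 1) by ring,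
          zpow_add₀ n0, Odd.neg_one_zpow ⟨m - x, rfl⟩, mul_neg_one, neg_neg]
      rw [i1, i2, i3, i4, i5, i6]
      ring
  have e6 : ∀ n : ℕ+, (2 * (n : ℂ)) * α = 2 * α * n := fun n => by ring
  have e7 : ∀ n : ℕ+, (((2 * (n : ℝ)) ^ ((1 : ℝ) / 1) * β : ℝ) : ℂ) *
      Complex.exp (Complex.I * Real.pi * ((0 : ℤ) : ℂ) / 1) = 2 * β * n := by
    intro n
    rw [div_one, Real.rpow_one, Int.cast_zero, mul_zero, zero_div, Complex.exp_zero]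
    push_cast
    ring
  have e8 : (-1 : ℂ) ^ (m + (1 + 3) / 2) * -(-1) ^ m = -1 := by
    rw [mul_neg, ← zpow_add₀ (by norm_num), Even.neg_one_zpow ⟨m + 1, by omega⟩]
  rw [e5] at key
  simp only [e6, e7] at key
  rw [key, zpow_zero, one_mul,
    show (1 + 3) / 2 = 2 from rfl, neg_one_sq, one_mul]
  have e9 : ((-(-1 : ℝ) ^ m : ℝ) : ℂ) = -(-1) ^ m := by
    push_cast
    rfl
  rw [Complex.ofReal_mul (-(-1) ^ m), e9]
  generalize Complex.ofReal (Finset.sum _ _) = S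
  linear_combination (2 : ℂ) ^ (2 * m) * S * e8

theorem mainTheorem2 (N : ℕ) (hN : Odd N) (α β : ℝ) (hα : 0 < α) (hβ : 0 < β)
    (hαβ : α * β ^ N = Real.pi ^ (N + 1)) (m : ℤ) (hm : m ≠ 0) :
    -- convergence of the series
    (Summable fun n : ℕ+ =>
      ((n : ℕ) : ℂ) ^ (-2 * (N : ℤ) * m - 1) /
        (Complex.exp ((2 * ((n : ℕ) : ℂ)) ^ N * (α : ℂ)) - 1)) ∧
    (∀ j ∈ Finset.Icc (-(((N : ℤ) - 1) / 2)) (((N : ℤ) - 1) / 2),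
      Summable fun n : ℕ+ =>
        ((n : ℕ) : ℂ) ^ (-2 * m - 1) /
          (Complex.exp ((((2 * ((n : ℕ) : ℝ)) ^ (1 / (N : ℝ)) * β : ℝ) : ℂ) *
            Complex.exp (Complex.I * (Real.pi : ℂ) * (j : ℂ) / (N : ℂ))) - 1)) ∧
    -- the identity
    ((α ^ (-(2 * (N : ℝ) * (m : ℝ)) / ((N : ℝ) + 1)) : ℝ) : ℂ) *
        (1 / 2 * riemannZeta (2 * (N : ℂ) * (m : ℂ) + 1) +
          ∑' n : ℕ+, ((n : ℕ) : ℂ) ^ (-2 * (N : ℤ) * m - 1) /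
            (Complex.exp ((2 * ((n : ℕ) : ℂ)) ^ N * (α : ℂ)) - 1)) =
      (((-(β ^ (2 * (N : ℝ) / ((N : ℝ) + 1)))) ^ (-m) : ℝ) : ℂ) *
          ((2 : ℂ) ^ (2 * m * ((N : ℤ) - 1)) / (N : ℂ)) *
          (1 / 2 * riemannZeta (2 * (m : ℂ) + 1) +
            (-1 : ℂ) ^ ((N + 3) / 2) *
              ∑ j ∈ Finset.Icc (-(((N : ℤ) - 1) / 2)) (((N : ℤ) - 1) / 2),
                (-1 : ℂ) ^ j *
                  ∑' n : ℕ+, ((n : ℕ) : ℂ) ^ (-2 * m - 1) /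
                    (Complex.exp ((((2 * ((n : ℕ) : ℝ)) ^ (1 / (N : ℝ)) * β : ℝ) : ℂ) *
                      Complex.exp (Complex.I * (Real.pi : ℂ) * (j : ℂ) / (N : ℂ))) - 1)) +
        (-1 : ℂ) ^ (m + ((N : ℤ) + 3) / 2) * (2 : ℂ) ^ (2 * (N : ℤ) * m) *
          ((∑ j ∈ Finset.Icc (0 : ℤ) ⌊((N : ℝ) + 1) / (2 * (N : ℝ)) + (m : ℝ)⌋,
            (-1 : ℝ) ^ j *
              ((bernoulli (2 * j).toNat : ℚ) : ℝ) *
              ((bernoulli ((N : ℤ) + 1 + 2 * (N : ℤ) * (m - j)).toNat : ℚ) : ℝ) /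
              (((2 * j).toNat ! : ℝ) *
                ((((N : ℤ) + 1 + 2 * (N : ℤ) * (m - j)).toNat) ! : ℝ)) *
              α ^ (2 * (j : ℝ) / ((N : ℝ) + 1)) *
              β ^ ((N : ℝ) + 2 * (N : ℝ) ^ 2 * ((m : ℝ) - (j : ℝ)) / ((N : ℝ) + 1)) : ℝ) : ℂ) ∧
    -- the case `N = 1`
    (N = 1 →
      ((α ^ (-m) : ℝ) : ℂ) *
          (1 / 2 * riemannZeta (2 * (m : ℂ) + 1) +
            ∑' n : ℕ+, ((n : ℕ) : ℂ) ^ (-2 * m - 1) /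
              (Complex.exp (2 * (α : ℂ) * ((n : ℕ) : ℂ)) - 1)) =
        (((-β) ^ (-m) : ℝ) : ℂ) *
            (1 / 2 * riemannZeta (2 * (m : ℂ) + 1) +
              ∑' n : ℕ+, ((n : ℕ) : ℂ) ^ (-2 * m - 1) /
                (Complex.exp (2 * (β : ℂ) * ((n : ℕ) : ℂ)) - 1)) -
          (2 : ℂ) ^ (2 * m) *
            ((∑ j ∈ Finset.Icc (0 : ℤ) (m + 1),
              (-1 : ℝ) ^ j *
                ((bernoulli (2 * j).toNat : ℚ) : ℝ) *
                ((bernoulli (2 * m + 2 - 2 * j).toNat : ℚ) : ℝ) /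
                (((2 * j).toNat ! : ℝ) * ((2 * m + 2 - 2 * j).toNat ! : ℝ)) *
                α ^ (m + 1 - j) * β ^ j : ℝ) : ℂ)) := by
  obtain ⟨h, rfl⟩ := hN
  obtain ⟨c, hc⟩ : ∃ c : ℝ, c = 2 * Real.pi / (2 ^ (2 * h + 1) * α) := ⟨_, rfl⟩
  have hc0 : 0 < c := by
    have := Real.pi_pos
    rw [hc]
    positivity
  refine ⟨(summable_lambert_term_left h _ hc0).congr fun n => (lambert_term_left h hα hc _ n).symm,
    fun j hj => ?_, lambert_identity h hα hβ hαβ hm, fun h1 => ?_⟩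
  · rw [show (((2 * h + 1 : ℕ) : ℤ) - 1) / 2 = h by omega] at hj
    exact (summable_lambert_term_right h _ hc0 hj).congr fun n =>
      (lambert_term_right h hα hβ hαβ hc _ j n).symm
  · obtain rfl : h = 0 := by omega
    exact ramanujan_formula hα hβ (by simpa using hαβ) hm
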